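/- **Theorem (Simplicial Complex Reconstruction).** Let $d\ge 2$ and let $K$ be a finite geometric simplicial complex in $\mathbb R^d$ of dimension $\kappa<d$ (so $K\neq\emptyset$), with vertex set $K_0$, $n_0=|K_0|$ vertices and $n=|K|$ simplices in total. Assume that $K_0$ is in general position: (i) every set of at most $d+1$ vertices is affinely independent; (ii) no three vertices have collinear images under the orthogonal projection to the plane spanned by $e_1,e_2$; (iii) distinct vertices have distinct first coordinates. For a unit vector $s$ let $h_s(\sigma)=\max_{v\in\sigma}\langle s,v\rangle$ (maximum over the vertices of $\sigma$) be the lower-star filter function on $K$. List the simplices as $\sigma_1,\dots,\sigma_n$ such that every simplex comes after its proper faces and $h_s(\sigma_1)\le\dots\le h_s(\sigma_n)$. The $k$-dimensional augmented persistence diagram in direction $s$ is the multiset of points $(h_s(\sigma_i),h_s(\sigma_j))$ for $(i,j)$ in the $k$-dimensional persistence diagram (homology with coefficients in a fixed field) of the index filtration $F_i=\{\sigma_1,\dots,\sigma_i\}$, with $h_s(\sigma_\infty)=\infty$; points on the diagonal are kept. An oracle for $K$ returns, for a unit vector $s$, the list of the points of the augmented persistence diagrams of all dimensions in direction $s$,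 in any order; a query counts as one diagram and takes time $\Pi\ge 0$. All other time is measured on a real RAM: each arithmetic operation, square root, trigonometric function or exact comparison on reals, each operation on integers, and each operation on one cell of a list or array is one step. Consider the following algorithm $\mathrm{Reconstruct}$, which has no input except access to the oracle. 1. *Vertices.* Query $e_1$. For each $i=2,\dots,d$, query $e_i$ and a tilt of $e_1$ towards $e_i$ (a normalized $(1-\varepsilon)e_1+\varepsilon e_i$ with $\varepsilon>0$ so small, in terms of the smallest positive difference of heights in direction $e_1$ and the spread of heights in direction $e_i$, that the order of the vertices is kept); matching the sorted births in dimension $0$ gives the $i$-th coordinates. 2. *Edges.* Query $-e_1$. Process the vertices $v$ in ascending order of first coordinate; find the edges from $v$ to higher vertices by repeatedly halving intervals of the radially sorted higher vertices, in the $(e_1,e_2)$-plane. At each split, the number of edges from $v$ to the first half is obtained by counting deaths in dimension $0$ and births in dimension $1$ at the height of $v$ in a direction that separates the halves, and subtracting known edges; the number for the second half is the difference to the number for the interval. Intervals without edges are dropped. 3. *Higher simplices.* For $i=2,\dots,\kappa$ (where $\kappa$ is read off the diagram of $e_1$), for each $(i-1)$-simplex $\sigma$ found and each vertex $v\notin\sigma$,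 choose a direction $s_*$ orthogonal to the affine hull of $\sigma\cup\{v\}$ in which no further vertex has the height of $\sigma$, and a direction $s_3$ orthogonal to the affine hull of $\sigma$ in which $v$ is above $\sigma$; let $s_L$ be the tilt of $s_*$ towards $s_3$, and $s_U$ the negative of the tilt of $-s_*$ towards $s_3$. Declare $\sigma\cup\{v\}$ to be an $i$-simplex if and only if the $i$-indegrees of $\sigma$ in directions $s_U$ and $s_L$ differ by exactly $1$. Here the $i$-indegree of $\sigma$ in direction $s$, i.e. the number of $i$-dimensional cofaces of $\sigma$ at the height of $\sigma$, is computed recursively, with memoization: take the number of deaths in dimension $i-1$ plus births in dimension $i$ at the height of $\sigma$, and subtract, for each proper face $\tau$ of $\sigma$ in order of dimension, the $i$-indegree of $\tau$ in the tilt of $s$ towards a direction that is orthogonal to the affine hull of $\tau$ and in which the other vertices of $\sigma$ are above $\tau$. 4. Return all simplices found. Then, for every oracle for $K$, $\mathrm{Reconstruct}$ returns exactly the simplices of $K$. There is a constant $C$, independent of $d,K,\kappa,\Pi$ and of the oracle, such that its running time is at most $$C\Bigl(d\,n\,n_0^2+2^{\kappa}n\,n_0\bigl(n\,n_0+d^2+2^{\kappa}+\Pi\bigr)+d\,\Pi\Bigr)$$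 and it uses at most $C\,(d+2^{\kappa}n\,n_0)$ diagrams. -/

import Mathlib

noncomputable section

namespace Recon

/-- The ambient Euclidean space `ℝ^d`. -/
abbrev E (d : ℕ) : Type := EuclideanSpace ℝ (Fin d)

/-! ## Simplicial homology with field coefficients

Simplices are given by their vertex sets. A finite set `L` of simplices that is closed under
passing to faces is a (finite) complex. Simplices are oriented by the lexicographic order of the
coordinates of their vertices. -/

section Homology

variable {d : ℕ} (F : Type*) [Field F]

open scoped Classical in
/-- The sign `(-1)^j` of the facet opposite to `v`, where `j` is the position of `v` among the
vertices of `σ`. -/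
def facetSign (σ : Finset (E d)) (v : E d) : F :=
  (-1) ^ (σ.filter fun w => toLex (WithLp.ofLp w) < toLex (WithLp.ofLp v)).card

open scoped Classical in
/-- The simplicial boundary operator on formal linear combinations of simplices; the boundary of
a vertex is zero (homology is not reduced). -/
def boundaryMap : (Finset (E d) →₀ F) →ₗ[F] (Finset (E d) →₀ F) :=
  Finsupp.linearCombination F fun σ : Finset (E d) =>
    if σ.card ≤ 1 then 0 else ∑ v ∈ σ, Finsupp.single (σ.erase v) (facetSign F σ v)

/-- The `k`-chains of `L`. -/
def chains (L : Finset (Finset (E d))) (k : ℕ) : Submodule F (Finset (E d) →₀ F) :=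
  Finsupp.supported F F {σ | σ ∈ L ∧ σ.card = k + 1}

/-- The `k`-cycles of `L`. -/
def cycles (L : Finset (Finset (E d))) (k : ℕ) : Submodule F (Finset (E d) →₀ F) :=
  chains F L k ⊓ LinearMap.ker (boundaryMap F)

/-- The `k`-boundaries of `L`. -/
def boundaries (L : Finset (Finset (E d))) (k : ℕ) : Submodule F (Finset (E d) →₀ F) :=
  (chains F L (k + 1)).map (boundaryMap F)

/-- The quotient `Z / (Z ∩ B)` of submodules. -/
abbrev Subquotient {M : Type*} [AddCommGroup M] [Module F M] (Z B : Submodule F M) : Type _ :=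
  Z ⧸ B.comap Z.subtype

/-- The map of quotients induced by inclusions `Z ≤ Z'` and `B ≤ B'`. -/
def subquotientMap {M : Type*} [AddCommGroup M] [Module F M] {Z Z' B B' : Submodule F M}
    (hZ : Z ≤ Z') (hB : B ≤ B') : Subquotient F Z B →ₗ[F] Subquotient F Z' B' :=
  Submodule.mapQ _ _ (Submodule.inclusion hZ) fun _ hx => hB hx

/-- The `k`-th homology group `H_k(L; F)`, the quotient of the cycles by the boundaries. -/
abbrev Homology (L : Finset (Finset (E d))) (k : ℕ) : Type _ :=
  Subquotient F (cycles F L k) (boundaries F L k)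

theorem chains_mono {L L' : Finset (Finset (E d))} (h : L ⊆ L') (k : ℕ) :
    chains F L k ≤ chains F L' k :=
  Finsupp.supported_mono fun _ hσ => ⟨h hσ.1, hσ.2⟩

theorem cycles_mono {L L' : Finset (Finset (E d))} (h : L ⊆ L') (k : ℕ) :
    cycles F L k ≤ cycles F L' k :=
  inf_le_inf_right _ (chains_mono F h k)

theorem boundaries_mono {L L' : Finset (Finset (E d))} (h : L ⊆ L') (k : ℕ) :
    boundaries F L k ≤ boundaries F L' k :=
  Submodule.map_mono (chains_mono F h (k + 1))

/-- The map `H_k(L) → H_k(L')` induced by an inclusion `L ⊆ L'`. -/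
def homologyMap {L L' : Finset (Finset (E d))} (h : L ⊆ L') (k : ℕ) :
    Homology F L k →ₗ[F] Homology F L' k :=
  subquotientMap F (cycles_mono F h k) (boundaries_mono F h k)

end Homology

/-! ## Augmented persistence diagrams of lower-star filtrations -/

section Persistence

variable {d : ℕ} (F : Type*) [Field F]

/-- `l` lists the simplices of `K` in the order of an index filtration compatible with the filter
function `f`: every simplex appears exactly once, no simplex appears before one of its proper
faces, and the values of `f` do not decrease along the list. -/
structure IsIndexFiltration (K : Geometry.SimplicialComplex ℝ (E d)) (f : Finset (E d) → ℝ)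
    (l : List (Finset (E d))) : Prop where
  nodup : l.Nodup
  mem_iff : ∀ σ, σ ∈ l ↔ σ ∈ K.faces
  face_before : l.Pairwise fun σ τ => ¬ τ ⊂ σ
  compatible : l.Pairwise fun σ τ => f σ ≤ f τ

open scoped Classical in
/-- The `i`-th complex of the index filtration: it consists of the first `i` simplices. -/
def stage (l : List (Finset (E d))) (i : ℕ) : Finset (Finset (E d)) := (l.take i).toFinset

theorem stage_mono (l : List (Finset (E d))) {i j : ℕ} (h : i ≤ j) : stage l i ⊆ stage l j := by
  intro σ hσ
  rw [stage, List.mem_toFinset] at hσ ⊢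
  exact (List.take_subset_take_left l h) hσ

/-- `β_k^{i,j}`, the rank of `H_k(F_i) → H_k(F_j)` (for `i ≤ j`). -/
def pBetti (l : List (Finset (E d))) (k : ℕ) {i j : ℕ} (h : i ≤ j) : ℕ :=
  Module.finrank F (LinearMap.range (homologyMap F (stage_mono l h) k))

/-- The multiplicity `μ_k^{(i,j)} = β^{i,j-1} - β^{i,j} - β^{i-1,j-1} + β^{i-1,j}` of the point
`(i, j)`, `1 ≤ i < j`, written for `i = a + 1` and `j = b + 1`. -/
def multiplicity (l : List (Finset (E d))) (k : ℕ) {a b : ℕ} (h : a < b) : ℤ :=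
  (pBetti F l k (i := a + 1) (j := b) h : ℤ)
    - pBetti F l k (i := a + 1) (j := b + 1) (by omega)
    - pBetti F l k (i := a) (j := b) h.le
    + pBetti F l k (i := a) (j := b + 1) (by omega)

/-- The multiplicity of the point `(i, ∞)`, written for `i = a + 1`: the classes that are born at
index `i` and survive in the whole complex. -/
def essentialMultiplicity (l : List (Finset (E d))) (k : ℕ) (a : Fin l.length) : ℤ :=
  (pBetti F l k (i := a + 1) (j := l.length) a.isLt : ℤ)
    - pBetti F l k (i := a) (j := l.length) a.isLt.le

/-- A point `(birth, death)` of a diagram; the death is `⊤` for an essential class. -/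
abbrev Point : Type := ℝ × WithTop ℝ

/-- The `k`-dimensional augmented persistence diagram of the filter function `f`, computed from
the compatible index filtration `l`. Points on the diagonal are kept. -/
def apd (f : Finset (E d) → ℝ) (l : List (Finset (E d))) (k : ℕ) : Multiset Point :=
  ∑ a : Fin l.length,
    ((∑ b : Fin l.length,
        if h : a < b then
          Multiset.replicate (multiplicity F l k (Fin.lt_def.1 h)).toNat
            (f (l.get a), ((f (l.get b) : ℝ) : WithTop ℝ))
        else 0)
      + Multiset.replicate (essentialMultiplicity F l k a).toNat (f (l.get a), ⊤))

/-- The lower-star filter function of the direction `s`: the height of the highest vertex. -/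
def height (s : E d) (σ : Finset (E d)) : ℝ :=
  if h : σ.Nonempty then σ.sup' h fun v => inner ℝ s v else 0

/-- An oracle maps a direction to the list of diagrams of all dimensions. -/
abbrev Oracle (d : ℕ) : Type := E d → ℕ → List Point

/-- `O` is an oracle for `K`: for every unit vector `s` it returns, for each dimension `k`, the
points of the `k`-dimensional augmented persistence diagram in direction `s`, in some order. -/
def IsOracleFor (O : Oracle d) (K : Geometry.SimplicialComplex ℝ (E d)) : Prop :=
  ∀ s : E d, ‖s‖ = 1 → ∃ l, IsIndexFiltration K (height s) l ∧
    ∀ k, (O s k : Multiset Point) = apd F (height s) l k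

end Persistence

/-! ## Hypotheses on the complex -/

/-- The projection of `ℝ^d` onto the plane of the first two coordinates. -/
def planeProj {d : ℕ} (hd : 2 ≤ d) (x : E d) : E 2 := !₂[x ⟨0, by omega⟩, x ⟨1, by omega⟩]

/-- General position of a set of points in `ℝ^d`. -/
structure GeneralPosition {d : ℕ} (hd : 2 ≤ d) (V : Set (E d)) : Prop where
  affineIndependent : ∀ S : Finset (E d), (S : Set (E d)) ⊆ V → S.card ≤ d + 1 →
    AffineIndependent ℝ ((↑) : S → E d)
  not_collinear : ∀ x ∈ V, ∀ y ∈ V, ∀ z ∈ V, x ≠ y → x ≠ z → y ≠ z →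
    ¬ Collinear ℝ {planeProj hd x, planeProj hd y, planeProj hd z}
  heights : ∀ x ∈ V, ∀ y ∈ V, x ⟨0, by omega⟩ = y ⟨0, by omega⟩ → x = y

/-- The complex `K` has dimension `κ` (in particular it is not empty). -/
def HasDimension {d : ℕ} (K : Geometry.SimplicialComplex ℝ (E d)) (κ : ℕ) : Prop :=
  (∃ σ ∈ K.faces, σ.card = κ + 1) ∧ ∀ σ ∈ K.faces, σ.card ≤ κ + 1

/-! ## Real RAM computations with an oracle

A computation is run with an oracle and yields a value together with the number of elementary
steps and the number of oracle queries. Elementary steps (`op`) are the arithmetic operations,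
square roots, trigonometric functions and exact comparisons on real numbers, operations on
integers, and operations on a single cell of a list or array. -/

/-- The outcome of running a computation. -/
structure Outcome (α : Type) where
  /-- the value that is returned -/
  val : α
  /-- the number of elementary steps -/
  steps : ℕ
  /-- the number of oracle queries, that is, of diagrams used -/
  queries : ℕ

/-- The running time, if a query of the oracle takes time `T`. -/
def Outcome.time {α : Type} (r : Outcome α) (T : ℝ) : ℝ := r.steps + T * r.queries

/-- Computations with access to an oracle for directional diagrams in `ℝ^d`. -/
def Comp (d : ℕ) (α : Type) : Type := Oracle d → Outcome α

instance (d : ℕ) : Monad (Comp d) where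
  pure a := fun _ => ⟨a, 0, 0⟩
  bind x f := fun O =>
    let r := x O
    let t := f r.val O
    ⟨t.val, r.steps + t.steps, r.queries + t.queries⟩

section Primitives

variable {d : ℕ} {α β γ : Type}

/-- One elementary step with result `a`. -/
def op (a : α) : Comp d α := fun _ => ⟨a, 1, 0⟩

/-- `m` elementary steps. -/
def charge (m : ℕ) : Comp d Unit := fun _ => ⟨(), m, 0⟩

/-- Ask the oracle for the diagrams in direction `s`. -/
def query (s : E d) : Comp d (ℕ → List Point) := fun O => ⟨O s, 1, 1⟩

/-- Build a vector coordinate by coordinate, storing each coordinate. -/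
def vecC (f : Fin d → Comp d ℝ) : Comp d (E d) := fun O =>
  ⟨WithLp.toLp 2 fun i => (f i O).val, ∑ i, ((f i O).steps + 1), ∑ i, (f i O).queries⟩

/-- Sum over the coordinates, with one addition for each. -/
def sumC (f : Fin d → Comp d ℝ) : Comp d ℝ := fun O =>
  ⟨∑ i, (f i O).val, ∑ i, ((f i O).steps + 1), ∑ i, (f i O).queries⟩

/-- A loop over a list. -/
def foldC (f : β → α → Comp d β) : β → List α → Comp d β
  | b, [] => pure b
  | b, a :: l => do
    charge 1
    let b' ← f b a
    foldC f b' l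

/-- Apply a computation to all entries of a list. -/
def mapC (f : α → Comp d β) : List α → Comp d (List β)
  | [] => pure []
  | a :: l => do
    let b ← f a
    let bs ← mapC f l
    op (b :: bs)

/-- Combine two lists entry by entry. -/
def zipC (f : α → β → Comp d γ) : List α → List β → Comp d (List γ)
  | a :: l, b :: m => do
    let c ← f a b
    let cs ← zipC f l m
    op (c :: cs)
  | _, _ => pure []

/-- The entries of a list that pass a test. -/
def filterC (p : α → Comp d Bool) : List α → Comp d (List α)
  | [] => pure []
  | a :: l => do
    charge 1
    let t ← p a
    let l' ← filterC p l
    if t then op (a :: l') else pure l'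

/-- The number of entries of a list that pass a test. -/
def countC (p : α → Comp d Bool) (l : List α) : Comp d ℤ :=
  foldC (fun c a => do
    let t ← p a
    if t then op (c + 1) else pure c) 0 l

/-- Insert an entry into a sorted list. -/
def insertC (le : α → α → Comp d Bool) (a : α) : List α → Comp d (List α)
  | [] => op [a]
  | b :: l => do
    let t ← le a b
    if t then op (a :: b :: l)
    else do
      let l' ← insertC le a l
      op (b :: l')

/-- Sort a list. -/
def sortC (le : α → α → Comp d Bool) : List α → Comp d (List α)
  | [] => pure []
  | a :: l => do
    let l' ← sortC le l
    insertC le a l'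

/-- Concatenate two lists. -/
def appendC (l m : List α) : Comp d (List α) := do
  charge l.length
  op (l ++ m)

/-- Sort real numbers in ascending order. -/
def sortReals : List ℝ → Comp d (List ℝ) := sortC fun a b => op (decide (a ≤ b))

end Primitives

/-! ## Linear algebra and tilted directions -/

section Directions

variable {d : ℕ}

/-- The inner product `u · v`. -/
def dot (u v : E d) : Comp d ℝ := sumC fun i => op (u i * v i)

/-- The vector `a u + b v`. -/
def lincomb (a : ℝ) (u : E d) (b : ℝ) (v : E d) : Comp d (E d) :=
  vecC fun i => do
    let x ← op (a * u i)
    let y ← op (b * v i)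
    op (x + y)

/-- The norm of `u`. -/
def normC (u : E d) : Comp d ℝ := do
  let q ← dot u u
  op (Real.sqrt q)

/-- The vector `u / ‖u‖`. -/
def normalize (u : E d) : Comp d (E d) := do
  let r ← normC u
  vecC fun i => op (u i / r)

/-- The standard basis vector `e_i`. -/
def basisVec (i : Fin d) : Comp d (E d) := vecC fun j => op (if j = i then 1 else 0)

/-- The smallest positive difference of consecutive entries of a sorted list. -/
def minGap : List ℝ → Comp d (Option ℝ)
  | a :: b :: l => do
    let g ← minGap (b :: l)
    let δ ← op (b - a)
    let t ← op (decide (0 < δ))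
    if t then
      match g with
      | none => pure (some δ)
      | some g' => do
        let m ← op (min δ g')
        pure (some m)
    else pure g
  | _ => pure none

/-- The difference of the largest and the smallest entry of a list. -/
def spread : List ℝ → Comp d ℝ
  | [] => pure 0
  | a :: l => do
    let hi ← foldC (fun x y => op (max x y)) a l
    let lo ← foldC (fun x y => op (min x y)) a l
    op (hi - lo)

/-- The tilt `(1 - ε) s + ε s'` (normalized) of `s` towards `s'`, where `H` and `H'` list the heights
of the vertices in directions `s` and `s'`. If `g` is the smallest positive difference of heights in
`H` (`1` if there is none) and `r` is the difference of the extreme heights in `H'`, then no two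
vertices at distinct heights change their order before `ε = g / (g + r)`; half of this value is
used. -/
def tilt (H H' : List ℝ) (s s' : E d) : Comp d (E d) := do
  let Hs ← sortReals H
  let gap ← minGap Hs
  let g := gap.getD 1
  let r ← spread H'
  let q ← op (g + r)
  let q2 ← op (2 * q)
  let ε ← op (g / q2)
  let ε' ← op (1 - ε)
  let u ← lincomb ε' s ε s'
  normalize u

/-- The component of `x` orthogonal to the orthonormal vectors `us`. -/
def residual (us : List (E d)) (x : E d) : Comp d (E d) :=
  foldC (fun r u => do
    let c ← dot u x
    lincomb 1 r (-c) u) x us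

/-- Gram-Schmidt: an orthonormal basis of the span of the vectors `x - p`, for `x` in the list
of points, extending the orthonormal vectors `us`. -/
def gramSchmidt (p : E d) (us : List (E d)) (xs : List (E d)) : Comp d (List (E d)) :=
  foldC (fun us x => do
    let y ← lincomb 1 x (-1) p
    let r ← residual us y
    let u ← normalize r
    op (u :: us)) us xs

/-- A unit vector orthogonal to the orthonormal vectors `us`, obtained from the first standard basis
vector in the given list that is not in their span. -/
def perpDirAux (us : List (E d)) : List (Fin d) → Comp d (E d)
  | [] => pure 0
  | j :: js => do
    let e ← basisVec j
    let r ← residual us e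
    let q ← dot r r
    let t ← op (decide (q = 0))
    if t then perpDirAux us js else normalize r

/-- A direction orthogonal to the orthonormal vectors `us`. -/
def perpDir (us : List (E d)) : Comp d (E d) := perpDirAux us (List.finRange d)

/-- Given the orthonormal vectors `us` and a direction `s` orthogonal to them, a direction orthogonal
to `us` in which no point of `Q` has the same height as `p`. A small multiple of the
component of `q - p` orthogonal to `us` is added to `s` whenever `q` and `p` are at the same height;
`m` is a lower bound for the height differences obtained so far. -/
def separatingDir (us : List (E d)) (p : E d) (s : E d) (Q : List (E d)) : Comp d (E d) := do
  let M ← foldC (fun M q => do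
    let y ← lincomb 1 q (-1) p
    let t ← dot y y
    op (max M t)) 0 Q
  let st ← foldC (fun (st : E d × ℝ) q => do
    let y ← lincomb 1 q (-1) p
    let r ← residual us y
    let a ← dot st.1 y
    let t ← op (decide (a = 0))
    if t then do
      let M2 ← op (2 * M)
      let δ ← op (st.2 / M2)
      let s' ← lincomb 1 st.1 δ r
      let rr ← dot r r
      let b ← op (δ * rr)
      let h ← op (st.2 / 2)
      let m' ← op (min h b)
      pure (s', m')
    else do
      let b ← op |a|
      let m' ← op (min st.2 b)
      pure (st.1, m')) (s, 1) Q
  normalize st.1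

/-- A direction orthogonal to the affine hull of `W` in which all points of `X` are strictly above
`W`, for affinely independent points `W ∪ X`. -/
def liftingDir (W X : List (E d)) : Comp d (E d) := do
  let p := W.headD 0
  let us ← gramSchmidt p [] W.tail
  let st ← foldC (fun (st : List (E d) × E d) x => do
    let y ← lincomb 1 x (-1) p
    let r ← residual st.1 y
    let ρ ← normC r
    let u ← normalize r
    let a ← dot st.2 y
    let b ← op (1 - a)
    let c ← op (b / ρ)
    let s' ← lincomb 1 st.2 c u
    let us' ← op (u :: st.1)
    pure (us', s')) (us, 0) X
  normalize st.2

end Directions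

/-! ## The reconstruction algorithm -/

/-- A reconstructed vertex: a name (a natural number) and a location. -/
structure Vertex (d : ℕ) where
  /-- the name of the vertex -/
  id : ℕ
  /-- the location of the vertex -/
  pos : E d

/-- A simplex is stored as the list of its vertices, in ascending order of names. -/
abbrev Simplex (d : ℕ) : Type := List (Vertex d)

/-! ### Vertices -/

section Vertices

variable {d : ℕ}

/-- The births of a list of points. -/
def births (D : List Point) : Comp d (List ℝ) := mapC (fun x => op x.1) D

/-- The `i`-th coordinates of all vertices, from the heights `H₁` in direction `e₁ = e_{i₁}` in
ascending order. -/
def findCoord (i₁ : Fin d) (e₁ : E d) (i : Fin d) (H₁ : List ℝ) : Comp d (List ℝ) := do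
  let e ← basisVec i
  let D ← query e
  let H ← births (D 0)
  let s ← tilt H₁ H e₁ e
  let Ds ← query s
  let B ← births (Ds 0)
  let Hs ← sortReals B
  let w := s i₁
  let h ← op (-(s i))
  zipC (fun a b => do
    let x ← op (w * a)
    let y ← op (x - b)
    op (y / h)) H₁ Hs

/-- The vertices in ascending order of their heights in direction `e₁`, together with the diagram
in direction `e₁`. -/
def findVertices (i₁ : Fin d) : Comp d (List (Vertex d) × (ℕ → List Point)) := do
  let e₁ ← basisVec i₁
  let D ← query e₁
  let B ← births (D 0)
  let H₁ ← sortReals B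
  let X₁ ← mapC (fun h => vecC fun j => op (if j = i₁ then h else 0)) H₁
  let X ← foldC (fun X i => do
    let t ← op (decide (i = i₁))
    if t then pure X
    else do
      let C ← findCoord i₁ e₁ i H₁
      zipC (fun x c => op (WithLp.toLp 2 (Function.update (WithLp.ofLp x) i c))) X C)
    X₁ (List.finRange d)
  let V ← mapC (fun p : E d × ℕ => op (Vertex.mk p.2 p.1)) X.zipIdx
  pure (V, D)

end Vertices

/-! ### Indegrees -/

section Indegree

variable {d : ℕ}

/-- Is `v` a vertex of `τ`? -/
def memC (v : Vertex d) (τ : Simplex d) : Comp d Bool :=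
  foldC (fun t w => op (t || decide (w.id = v.id))) false τ

/-- The list of the heights of the vertices in `V`. -/
def heightsC (V : List (Vertex d)) (s : E d) : Comp d (List ℝ) :=
  mapC (fun v => dot s v.pos) V

/-- The tilt of `s` towards `s'` with respect to the vertices in `V`. -/
def tiltV (V : List (Vertex d)) (s s' : E d) : Comp d (E d) := do
  let H ← heightsC V s
  let H' ← heightsC V s'
  tilt H H' s s'

/-- For `k ≥ 1`, the number of deaths at height `c` in the diagram of dimension `k - 1` plus the
number of births at height `c` in the diagram of dimension `k`. -/
def eventsAt (D : ℕ → List Point) (k : ℕ) (c : ℝ) : Comp d ℤ := do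
  let deaths ← countC (fun x => op (decide (x.2 = (c : WithTop ℝ)))) (D (k - 1))
  let newborns ← countC (fun x => op (decide (x.1 = c))) (D k)
  op (deaths + newborns)

/-- The table for memoization, with entries indexed by faces (given by names of vertices). -/
abbrev Table : Type := List ℕ → Option ℤ

/-- The proper faces of `σ`, in non-descending order by dimension. -/
def properFaces (σ : Simplex d) : List (Simplex d) :=
  (List.range' 1 (σ.length - 1)).flatMap fun j => List.sublistsLen j σ

/-- `ComputeIndegree`: the `k`-indegree of `σ` in direction `s`, for `k > dim σ`, together with the
updated table. The first argument bounds the depth of the recursion and should be at least the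
number of vertices of `σ`. Producing the next face of `σ` costs `|σ| + 1` steps; reading or writing
the table costs `k + 1` steps (as in a binary trie, since at most `k` vertices are involved). -/
def computeIndegree (V : List (Vertex d)) :
    ℕ → Simplex d → E d → ℕ → Table → Comp d (ℤ × Table)
  | 0, _, _, _, T => pure (0, T)
  | fuel + 1, σ, s, k, T => do
    let D ← query s
    let c ← dot s ((σ.map Vertex.pos).headD 0)
    let total ← eventsAt D k c
    let r ← foldC (fun (r : ℤ × Table) τ => do
      charge (σ.length + 1)
      let key := τ.map Vertex.id
      charge (k + 1)
      match r.2 key with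
      | some x => do
        let y ← op (r.1 + x)
        pure (y, r.2)
      | none => do
        let X ← filterC (fun v => do
          let t ← memC v τ
          op (!t)) σ
        let W' ← mapC (fun v => op (Vertex.pos v)) τ
        let X' ← mapC (fun v => op (Vertex.pos v)) X
        let s' ← liftingDir W' X'
        let st ← tiltV V s s'
        let res ← computeIndegree V fuel τ st k r.2
        charge (k + 1)
        let y ← op (r.1 + res.1)
        pure (y, Function.update res.2 key (some res.1))) (0, T) (properFaces σ)
    let ans ← op (total - r.1)
    pure (ans, r.2)

/-- The `k`-indegree of `σ` in direction `s`, starting with an empty table. -/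
def indegree (V : List (Vertex d)) (σ : Simplex d) (s : E d) (k : ℕ) : Comp d ℤ := do
  let r ← computeIndegree V σ.length σ s k (fun _ => none)
  pure r.1

end Indegree

/-! ### Edges -/

section Edges

variable {d : ℕ}

/-- A vertex seen from a given vertex `v` in the plane of the first two coordinates: `angle` is the
angle in `(0, π)` between the axis `e₂` and the line through `v` and the vertex, and `up` tells
whether the vertex is above `v` in direction `e₁`. -/
structure Ray (d : ℕ) where
  /-- the vertex that is seen -/
  vert : Vertex d
  /-- the angle of the line with the second axis -/
  angle : ℝ
  /-- whether the vertex is above the centre -/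
  up : Bool

/-- An edge interval centred at a vertex `v`: a list of vertices above `v` in clockwise order, and
the number of those that are adjacent to `v`. -/
structure EdgeInterval (d : ℕ) where
  /-- the vertices in the interval, in clockwise order -/
  rays : List (Ray d)
  /-- the number of edges in the interval -/
  count : ℤ

/-- The vertex `w` as seen from `v`. -/
def rayC (i₁ i₂ : Fin d) (v w : Vertex d) : Comp d (Ray d) := do
  let y ← op (w.pos i₁ - v.pos i₁)
  let x ← op (w.pos i₂ - v.pos i₂)
  let yy ← op (y * y)
  let xx ← op (x * x)
  let q ← op (xx + yy)
  let r ← op (Real.sqrt q)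
  let c ← op (x / r)
  let a ← op (Real.arccos c)
  let t ← op (decide (0 < y))
  if t then op ⟨w, a, true⟩
  else do
    let a' ← op (Real.pi - a)
    op ⟨w, a', false⟩

/-- The smallest angle between two lines in a list (`π` if there are fewer than two). -/
def minAngle : List (Ray d) → Comp d ℝ
  | [] => pure Real.pi
  | a :: l => do
    let m ← minAngle l
    foldC (fun m b => do
      let x ← op (a.angle - b.angle)
      let x' ← op |x|
      let x'' ← op (Real.pi - x')
      let y ← op (min x' x'')
      op (min m y)) m l

/-- `SplitInterval`: split an edge interval centred at `v` in two halves. The direction `s` is chosen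
such that exactly the first half of the interval is below `v`; `known` lists the vertices
that are already known to be adjacent to `v`, and `θ` is the smallest angle between two
lines through `v` and other vertices. -/
def splitInterval (i₁ i₂ : Fin d) (V : List (Vertex d)) (v : Vertex d) (θ : ℝ)
    (known : List (Vertex d)) (I : EdgeInterval d) : Comp d (EdgeInterval d × EdgeInterval d) := do
  charge I.rays.length
  let m ← op (I.rays.length / 2)
  let α := ((I.rays.map Ray.angle)[m - 1]?).getD 0
  let x₁ ← op (Real.pi / 2)
  let x₂ ← op (θ / 2)
  let x₃ ← op (α - x₁)
  let ω ← op (x₃ - x₂)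
  let y ← op (Real.sin ω)
  let x ← op (Real.cos ω)
  let s ← vecC fun j => op (if j = i₁ then y else if j = i₂ then x else 0)
  let deg ← indegree V [v] s 1
  let c ← dot s v.pos
  let below ← countC (fun w => do
    let h ← dot s w.pos
    op (decide (h < c))) known
  let left ← op (deg - below)
  let right ← op (I.count - left)
  charge I.rays.length
  pure (⟨I.rays.take m, left⟩, ⟨I.rays.drop m, right⟩)

/-- The main loop of `FindUpEdges`, with a stack of edge intervals. The first argument bounds the
number of iterations. It returns the list of all vertices known to be adjacent to `v`. -/
def upEdgesLoop (i₁ i₂ : Fin d) (V : List (Vertex d)) (v : Vertex d) (θ : ℝ) :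
    ℕ → List (EdgeInterval d) → List (Vertex d) → Comp d (List (Vertex d))
  | 0, _, known => pure known
  | _ + 1, [], known => pure known
  | fuel + 1, I :: stack, known => do
    let z ← op (decide (I.count = 0))
    if z then upEdgesLoop i₁ i₂ V v θ fuel stack known
    else
      match I.rays with
      | [] => upEdgesLoop i₁ i₂ V v θ fuel stack known
      | [r] => do
        let known' ← op (r.vert :: known)
        upEdgesLoop i₁ i₂ V v θ fuel stack known'
      | _ => do
        let J ← splitInterval i₁ i₂ V v θ known I
        let stack' ← op (J.1 :: J.2 :: stack)
        upEdgesLoop i₁ i₂ V v θ fuel stack' known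

/-- `FindUpEdges`: the vertices above `v` that are adjacent to `v`. Here `known` lists the vertices
below `v` that are adjacent to `v`, `D` is the diagram in direction `-e₁`, and `above` lists
the vertices above `v` in clockwise order. An interval with `m` vertices is split at most `m - 1`
times, so `2 m + 1` iterations empty the stack. -/
def findUpEdges (i₁ i₂ : Fin d) (V : List (Vertex d)) (v : Vertex d) (known : List (Vertex d))
    (above : List (Ray d)) (θ : ℝ) (D : ℕ → List Point) : Comp d (List (Vertex d)) := do
  let c ← op (-(v.pos i₁))
  let deg ← eventsAt D 1 c
  let all ← upEdgesLoop i₁ i₂ V v θ (2 * above.length + 1) [⟨above, deg⟩] known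
  filterC (fun w => op (decide (v.pos i₁ < w.pos i₁))) all

/-- `FindEdges`: all edges, as pairs of vertices in ascending order in direction `e₁`; the list `V`
of vertices is in this order. -/
def findEdges (i₁ i₂ : Fin d) (V : List (Vertex d)) : Comp d (List (Vertex d × Vertex d)) := do
  let s ← vecC fun j => op (if j = i₁ then -1 else 0)
  let D ← query s
  foldC (fun edges v => do
    let others ← filterC (fun w => op (decide (w.id ≠ v.id))) V
    let rays ← mapC (rayC i₁ i₂ v) others
    let θ ← minAngle rays
    let upper ← filterC (fun r => op r.up) rays
    let above ← sortC (fun a b => op (decide (b.angle ≤ a.angle))) upper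
    let old ← filterC (fun e => op (decide (e.2.id = v.id))) edges
    let known ← mapC (fun e => op (Prod.fst e)) old
    let new ← findUpEdges i₁ i₂ V v known above θ D
    let pairs ← mapC (fun w => op (v, w)) new
    appendC pairs edges) [] V

end Edges

/-! ### Higher-dimensional simplices -/

section Higher

variable {d : ℕ}

/-- `IsSimplex`: do the vertices of `σ`, together with the vertex `v`, span a simplex? -/
def isSimplex (V : List (Vertex d)) (σ : Simplex d) (v : Vertex d) : Comp d Bool := do
  charge σ.length
  let k := σ.length
  let W ← mapC (fun w => op (Vertex.pos w)) σ
  let p := W.headD 0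
  let us₀ ← gramSchmidt p [] W.tail
  let us ← gramSchmidt p us₀ [v.pos]
  let s₁ ← perpDir us
  let Q ← filterC (fun q => do
    let t ← memC q (v :: σ)
    op (!t)) V
  let Q' ← mapC (fun q => op (Vertex.pos q)) Q
  let s₂ ← separatingDir us p s₁ Q'
  let s ← tiltV V s₁ s₂
  let s₃ ← liftingDir W [v.pos]
  let sL ← tiltV V s s₃
  let negS ← vecC fun j => op (-(s j))
  let sU' ← tiltV V negS s₃
  let sU ← vecC fun j => op (-(sU' j))
  let degU ← indegree V σ sU k
  let degL ← indegree V σ sL k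
  let δ ← op (degU - degL)
  let δ' ← op |δ|
  op (decide (δ' = 1))

/-- Do two sorted lists of vertices contain the same vertices? -/
def sameSimplex (σ τ : Simplex d) : Comp d Bool := do
  charge (σ.length + τ.length + 1)
  pure (decide (σ.map Vertex.id = τ.map Vertex.id))

/-- Add a simplex to a list of simplices, unless it is already there. -/
def addSimplex (τ : Simplex d) (L : List (Simplex d)) : Comp d (List (Simplex d)) := do
  let t ← foldC (fun t ρ => do
    let t' ← sameSimplex ρ τ
    op (t || t')) false L
  if t then pure L else op (τ :: L)

/-- All `i`-simplices, from the list of all `(i - 1)`-simplices. -/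
def nextSimplices (V : List (Vertex d)) (L : List (Simplex d)) : Comp d (List (Simplex d)) :=
  foldC (fun L' σ =>
    foldC (fun L' v => do
      let t ← memC v σ
      if t then pure L'
      else do
        let t' ← isSimplex V σ v
        if t' then do
          let τ ← insertC (fun a b => op (decide (a.id ≤ b.id))) v σ
          addSimplex τ L'
        else pure L') L' V) [] L

/-- The dimension of the complex, read off a single diagram: there is an `i`-simplex if and only if
there is a point of dimension `i` or a point of dimension `i - 1` with finite death. -/
def findDimension (D : ℕ → List Point) : Comp d ℕ :=
  foldC (fun κ i => do
    let a ← countC (fun _ => op true) (D i)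
    let b ← countC (fun x => op (decide (x.2 ≠ ⊤))) (D (i - 1))
    let c ← op (a + b)
    let t ← op (decide (c = 0))
    if t then pure κ else op i) 0 (List.range' 1 (d - 1))

end Higher

/-- `Reconstruct`: the full reconstruction algorithm in `ℝ^d`. It has no input other than the access
to the oracle, and returns the list of all simplices. -/
def reconstruct {d : ℕ} (hd : 2 ≤ d) : Comp d (List (Simplex d)) := do
  let i₁ : Fin d := ⟨0, by omega⟩
  let i₂ : Fin d := ⟨1, by omega⟩
  let VD ← findVertices i₁
  let V := VD.1
  let κ ← findDimension VD.2
  let edges ← findEdges i₁ i₂ V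
  let K₀ ← mapC (fun v => op [v]) V
  let K₁ ← mapC (fun e => op [Prod.fst e, Prod.snd e]) edges
  let K₀₁ ← appendC K₀ K₁
  let r ← foldC (fun (r : List (Simplex d) × List (Simplex d)) (_ : ℕ) => do
    let L ← nextSimplices V r.1
    let K ← appendC L r.2
    pure (L, K)) (K₁, K₀₁) (List.range' 2 (κ - 1))
  pure r.2

open scoped Classical in
/-- The set of the vertex sets of the simplices in a list. -/
def facesOf {d : ℕ} (L : List (Simplex d)) : Set (Finset (E d)) :=
  {σ | ∃ t ∈ L, (t.map Vertex.pos).toFinset = σ}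

end Recon

end

/-! A diagram is used only as a counter. Adding one simplex of dimension k + 1 to a filtration
raises dim Z_{k+1} + dim B_k by exactly one, by rank-nullity for the boundary map, so the simplex is
recorded once: as a birth in dimension k + 1 or as a death in dimension k. Since diagonal points are
kept, births in dimension k + 1 plus deaths in dimension k at height c count the (k + 1)-simplices
of height c (`countP_apd_succ`), and the births in dimension 0 are the heights of the vertices
(`births_perm`).

Vertices: a tilt of e₁ that keeps the order of the vertices makes the sorted births match vertex by
vertex, and the i-th coordinate solves a linear equation (`spec_findCoord`).

Indegrees: let the vertices at height c be those of σ, and let B be the set of vertices below. A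
k-simplex of height c meets σ in a nonempty face τ and has its other vertices in B, so the simplices
of height c are counted by a sum over the faces τ (`eventCount_eq_sum`). If s is tilted towards a
direction that is constant on τ and larger on the rest of σ, then τ alone stays on the level and the
set below it is still B (`LevelAt.tilt`). Hence the term to be subtracted for τ depends on τ, B and
k, but not on the direction chosen, and a table indexed by τ is sound. Faces are processed by
dimension, so each nested call finds all of its own faces in the table and costs one query; an
indegree of σ costs at most 2^|σ| queries (`spec_indegree`).

Edges: a line through v, turned by half the smallest angle past the last ray of the first half, has
exactly the first part of the fan of upper vertices below it. The indegree of v counts its edges to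
vertices below the line. Edges to vertices lower in direction e₁ are known, and so are those to
earlier rays; the rest belongs to the first half (`spec_splitInterval`).

Higher simplices: take a direction in which the vertices of σ ∪ {v} are alone at their height, with
B below. The two tilts leave σ alone on the level, with B below it in one case and B ∪ {v} in the
other. For k = |σ| the only coface that makes a difference is σ ∪ {v} itself, so the test is exact
(`cofaceCount_of_tilts`, `spec_isSimplex`). As σ ∪ {v} has at most κ + 1 ≤ d vertices, an orthogonal
direction exists; with one more vertex there are at most d + 1 points, still affinely independent,
so that vertex can be moved off the level.

Costs: `Spec` joins a postcondition with bounds for steps and queries, and composes along the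
monadic code, so correctness and cost are proved together. At the end, polynomials in the number of
vertices of a simplex are absorbed in powers of two, geometric sums over the dimension are bounded
by a multiple of their last term, and the remaining terms are compared with N n + d², where N is the
number of simplices and n that of vertices. -/

noncomputable section

namespace Recon

/-! ### The boundary operator -/

section Boundary

variable {d : ℕ} (F : Type*) [Field F]

open scoped Classical in
theorem boundaryMap_single (σ : Finset (E d)) (a : F) :
    boundaryMap F (Finsupp.single σ a) =
      a • (if σ.card ≤ 1 then 0
        else ∑ v ∈ σ, Finsupp.single (σ.erase v) (facetSign F σ v)) := by
  rw [boundaryMap, Finsupp.linearCombination_single]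

/-- The coordinates of a point, in the lexicographic order. -/
def lexKey (v : E d) : Lex (Fin d → ℝ) := toLex (WithLp.ofLp v)

theorem lexKey_injective : Function.Injective (lexKey (d := d)) := fun _ _ h =>
  WithLp.ofLp_injective 2 (toLex.injective h)

open scoped Classical in
-- Deleting the earlier vertex v moves w forward by one place and flips its sign, while deleting w
-- does not affect the place of v. So the two orders of deleting both have opposite signs.
theorem facetSign_mul_of_lt {σ : Finset (E d)} {v w : E d} (hv : v ∈ σ)
    (h : lexKey v < lexKey w) :
    facetSign F σ v * facetSign F (σ.erase v) w
      + facetSign F σ w * facetSign F (σ.erase w) v = 0 := by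
  have h1 : (σ.filter fun u => lexKey u < lexKey w).card
      = ((σ.erase v).filter fun u => lexKey u < lexKey w).card + 1 := by
    rw [Finset.filter_erase, Finset.card_erase_add_one]
    exact Finset.mem_filter.2 ⟨hv, h⟩
  have h2 : ((σ.erase w).filter fun u => lexKey u < lexKey v)
      = (σ.filter fun u => lexKey u < lexKey v) := by
    rw [Finset.filter_erase, Finset.erase_eq_of_notMem]
    exact fun hw => (Finset.mem_filter.1 hw).2.not_gt h
  have e1 : facetSign F σ w = - facetSign F (σ.erase v) w := by
    change (-1 : F) ^ (σ.filter fun u => lexKey u < lexKey w).card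
      = - (-1 : F) ^ ((σ.erase v).filter fun u => lexKey u < lexKey w).card
    rw [h1, pow_succ]; ring
  have e2 : facetSign F (σ.erase w) v = facetSign F σ v := by
    change (-1 : F) ^ ((σ.erase w).filter fun u => lexKey u < lexKey v).card
      = (-1 : F) ^ (σ.filter fun u => lexKey u < lexKey v).card
    rw [h2]
  rw [e1, e2]; ring

open scoped Classical in
theorem facetSign_mul {σ : Finset (E d)} {v w : E d} (hv : v ∈ σ) (hw : w ∈ σ) (h : v ≠ w) :
    facetSign F σ v * facetSign F (σ.erase v) w
      + facetSign F σ w * facetSign F (σ.erase w) v = 0 := by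
  rcases lt_trichotomy (lexKey v) (lexKey w) with h' | h' | h'
  · exact facetSign_mul_of_lt F hv h'
  · exact absurd (lexKey_injective h') h
  · rw [add_comm]; exact facetSign_mul_of_lt F hw h'

/-- The terms of ∂∂σ are indexed by ordered pairs of distinct vertices, and swapping the pair is a
sign-reversing involution without fixed points. -/
theorem boundaryMap_comp_self :
    (boundaryMap F (d := d)) ∘ₗ boundaryMap F = 0 := by
  classical
  refine Finsupp.lhom_ext fun σ a => ?_
  rw [LinearMap.comp_apply, boundaryMap_single, LinearMap.zero_apply, map_smul]
  split_ifs with h1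
  · simp
  rw [map_sum]
  simp only [boundaryMap_single]
  suffices h : ∑ v ∈ σ, facetSign F σ v • (if (σ.erase v).card ≤ 1 then 0 else
      ∑ w ∈ σ.erase v, Finsupp.single ((σ.erase v).erase w) (facetSign F (σ.erase v) w)) = 0 by
    rw [h, smul_zero]
  by_cases h2 : σ.card ≤ 2
  -- For an edge the terms do not cancel in pairs; they vanish because the boundary of a vertex is
  -- zero by convention.
  · refine Finset.sum_eq_zero fun v hv => ?_
    rw [if_pos, smul_zero]
    rw [Finset.card_erase_of_mem hv]; omega
  have h3 : ∀ v ∈ σ, facetSign F σ v • (if (σ.erase v).card ≤ 1 then 0 else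
      ∑ w ∈ σ.erase v, Finsupp.single ((σ.erase v).erase w) (facetSign F (σ.erase v) w))
      = ∑ w ∈ σ.erase v, Finsupp.single ((σ.erase v).erase w)
          (facetSign F σ v * facetSign F (σ.erase v) w) := fun v hv => by
    rw [if_neg (by rw [Finset.card_erase_of_mem hv]; omega), Finset.smul_sum]
    simp [Finsupp.smul_single]
  rw [Finset.sum_congr rfl h3, Finset.sum_sigma']
  refine Finset.sum_involution (fun x _ => ⟨x.2, x.1⟩) ?_ ?_ ?_ ?_
  · rintro ⟨v, w⟩ h
    simp only [Finset.mem_sigma, Finset.mem_erase] at h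
    rw [Finset.erase_right_comm (a := w), ← Finsupp.single_add,
      facetSign_mul F h.1 h.2.2 (Ne.symm h.2.1), Finsupp.single_zero]
  · rintro ⟨v, w⟩ h - h'
    simp only [Finset.mem_sigma, Finset.mem_erase] at h
    exact h.2.1 (Sigma.mk.inj h').1
  · rintro ⟨v, w⟩ h
    simp only [Finset.mem_sigma, Finset.mem_erase] at h ⊢
    exact ⟨h.2.2, Ne.symm h.2.1, h.1⟩
  · rintro ⟨v, w⟩ _
    rfl

theorem boundaryMap_boundaryMap (x : Finset (E d) →₀ F) :
    boundaryMap F (boundaryMap F x) = 0 :=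
  LinearMap.congr_fun (boundaryMap_comp_self F) x

end Boundary

/-! ### Dimensions of chains, cycles and boundaries -/

section Dimensions

variable {d : ℕ} (F : Type*) [Field F]

/-- The simplices of dimension `k`. -/
def simplicesOfDim (L : Finset (Finset (E d))) (k : ℕ) : Finset (Finset (E d)) :=
  L.filter fun σ => σ.card = k + 1

theorem chains_eq (L : Finset (Finset (E d))) (k : ℕ) :
    chains F L k = Finsupp.supported F F (simplicesOfDim L k : Set (Finset (E d))) := by
  simp [chains, simplicesOfDim]

instance (L : Finset (Finset (E d))) (k : ℕ) : FiniteDimensional F (chains F L k) := by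
  rw [chains_eq]
  exact (Finsupp.supportedEquivFinsupp (M := F) (R := F)
    (simplicesOfDim L k : Set (Finset (E d)))).symm.finiteDimensional

theorem finrank_chains (L : Finset (Finset (E d))) (k : ℕ) :
    Module.finrank F (chains F L k) = (simplicesOfDim L k).card := by
  rw [chains_eq, (Finsupp.supportedEquivFinsupp (M := F) (R := F)
    (simplicesOfDim L k : Set (Finset (E d)))).finrank_eq, Module.finrank_finsupp_self]
  simp

instance (L : Finset (Finset (E d))) (k : ℕ) : FiniteDimensional F (cycles F L k) :=
  Submodule.finiteDimensional_inf_left _ _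

instance (L : Finset (Finset (E d))) (k : ℕ) : FiniteDimensional F (boundaries F L k) := by
  unfold boundaries; infer_instance

/-- Rank-nullity for ∂ on the (k + 1)-chains, with kernel Z_{k+1} and image B_k. All counts of
simplices below rest on this identity. -/
theorem finrank_cycles_add_finrank_boundaries (L : Finset (Finset (E d))) (k : ℕ) :
    Module.finrank F (cycles F L (k + 1)) + Module.finrank F (boundaries F L k)
      = (simplicesOfDim L (k + 1)).card := by
  rw [← finrank_chains F]
  have h := LinearMap.finrank_range_add_finrank_ker (K := F) (V := chains F L (k + 1))
    (V₂ := Finset (E d) →₀ F) ((boundaryMap F).domRestrict (chains F L (k + 1)))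
  rw [← h, add_comm]
  congr 1
  · rw [boundaries, LinearMap.range_domRestrict]
  · rw [LinearMap.ker_domRestrict, cycles]
    refine LinearEquiv.finrank_eq ?_
    refine (LinearEquiv.ofEq _ _ ?_).trans
      (Submodule.equivMapOfInjective _ (Submodule.subtype_injective _) _).symm
    exact (Submodule.map_comap_subtype _ _).symm

/-- Closedness under passing to nonempty faces. -/
def ClosedUnderFaces (L : Finset (Finset (E d))) : Prop :=
  ∀ σ ∈ L, ∀ τ ⊆ σ, τ.Nonempty → τ ∈ L

theorem boundaries_le_chains {L : Finset (Finset (E d))} (hL : ClosedUnderFaces L) (k : ℕ) :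
    boundaries F L k ≤ chains F L k := by
  classical
  rw [boundaries, chains, Finsupp.supported_eq_span_single, Submodule.map_span_le]
  rintro _ ⟨σ, ⟨hσ, hk⟩, rfl⟩
  rw [boundaryMap_single, one_smul]
  split_ifs
  · exact zero_mem _
  refine Submodule.sum_mem _ fun v hv => Finsupp.single_mem_supported _ _ ?_
  have hc : (σ.erase v).card = k + 1 := by rw [Finset.card_erase_of_mem hv]; omega
  exact ⟨hL σ hσ _ (Finset.erase_subset _ _) (Finset.card_pos.1 (by omega)), hc⟩

theorem boundaries_le_cycles {L : Finset (Finset (E d))} (hL : ClosedUnderFaces L) (k : ℕ) :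
    boundaries F L k ≤ cycles F L k := by
  refine le_inf (boundaries_le_chains F hL k) ?_
  rintro _ ⟨x, -, rfl⟩
  exact boundaryMap_boundaryMap F x

/-- Homology is not reduced, so every 0-chain is a cycle. -/
theorem finrank_cycles_zero (L : Finset (Finset (E d))) :
    Module.finrank F (cycles F L 0) = (simplicesOfDim L 0).card := by
  classical
  rw [← finrank_chains F]
  suffices h : cycles F L 0 = chains F L 0 by rw [h]
  rw [cycles, inf_eq_left, chains, Finsupp.supported_eq_span_single, Submodule.span_le]
  rintro _ ⟨σ, ⟨hσ, hk⟩, rfl⟩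
  rw [SetLike.mem_coe, LinearMap.mem_ker, boundaryMap_single, if_pos (by omega), smul_zero]

/-- The image is Z_k(L) modulo the cycles that bound in L', so persistent Betti numbers become
dimensions of subspaces of one chain space; quotients are no longer needed afterwards. -/
theorem finrank_range_homologyMap {L L' : Finset (Finset (E d))} (h : L ⊆ L') (k : ℕ) :
    Module.finrank F (LinearMap.range (homologyMap F h k))
      + Module.finrank F (cycles F L k ⊓ boundaries F L' k : Submodule F _)
      = Module.finrank F (cycles F L k) := by
  let g : cycles F L k →ₗ[F] Homology F L' k :=
    (Submodule.mkQ _).comp (Submodule.inclusion (cycles_mono F h k))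
  have hr : LinearMap.range (homologyMap F h k) = LinearMap.range g := by
    ext y
    constructor
    · rintro ⟨x, rfl⟩
      obtain ⟨z, rfl⟩ := Submodule.mkQ_surjective _ x
      exact ⟨z, rfl⟩
    · rintro ⟨z, rfl⟩
      exact ⟨Submodule.mkQ _ z, rfl⟩
  have hk : LinearMap.ker g = (boundaries F L' k).comap (cycles F L k).subtype := by
    ext x
    simp only [g, LinearMap.mem_ker, LinearMap.comp_apply, Submodule.mkQ_apply,
      Submodule.Quotient.mk_eq_zero, Submodule.mem_comap]
    rfl
  rw [hr, ← LinearMap.finrank_range_add_finrank_ker (K := F) (V := cycles F L k)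
    (V₂ := Homology F L' k) g, hk]
  congr 1
  rw [← Submodule.map_comap_subtype]
  exact ((Submodule.equivMapOfInjective _ (Submodule.subtype_injective _) _).finrank_eq).symm

end Dimensions
/-! ### Counting points of augmented persistence diagrams -/

/-- Multiplicities are mixed second differences. Summed over all deaths after a birth, or over all
births before a death, they telescope, so births and deaths at an index can be counted without
knowing the pairing. -/
theorem sum_ite_lt_sub (G : ℕ → ℤ) (a n : ℕ) :
    (∑ b ∈ Finset.range n, if a < b then G (b + 1) - G b else 0)
      = if a < n then G n - G (a + 1) else 0 := by
  induction n with
  | zero => simp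
  | succ n ih =>
    rw [Finset.sum_range_succ, ih]
    by_cases h : a < n
    · simp [h, Nat.lt_succ_of_lt h]
    · rcases eq_or_ne a n with rfl | h'
      · simp
      · simp [h, show ¬ a < n + 1 by omega]

theorem sum_ite_gt_sub (H : ℕ → ℤ) (b n : ℕ) (h : b ≤ n) :
    (∑ a ∈ Finset.range n, if a < b then H (a + 1) - H a else 0) = H b - H 0 := by
  rw [← Finset.sum_filter, ← Finset.sum_range_sub]
  congr 1
  ext a
  simp only [Finset.mem_filter, Finset.mem_range]
  omega

section Points

variable {d : ℕ} (F : Type*) [Field F] (l : List (Finset (E d)))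

/-- The dimension of `Z_k(F_i) ⊓ B_k(F_j)`. -/
def meetRank (k i j : ℕ) : ℤ :=
  Module.finrank F (cycles F (stage l i) k ⊓ boundaries F (stage l j) k : Submodule F _)

theorem pBetti_eq (k : ℕ) {i j : ℕ} (h : i ≤ j) :
    (pBetti F l k h : ℤ) = Module.finrank F (cycles F (stage l i) k) - meetRank F l k i j := by
  rw [pBetti, meetRank, ← finrank_range_homologyMap F (stage_mono l h) k]
  push_cast
  ring

/-- The dimensions of the cycle spaces cancel in the second difference; only the intersections with
boundaries remain. -/
theorem multiplicity_eq (k : ℕ) {a b : ℕ} (h : a < b) :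
    multiplicity F l k h = meetRank F l k (a + 1) (b + 1) - meetRank F l k (a + 1) b
      - (meetRank F l k a (b + 1) - meetRank F l k a b) := by
  simp only [multiplicity, pBetti_eq]
  ring

/-- With Z ≤ Z' and B ≤ B', the spaces Z' ⊓ B and Z ⊓ B' lie in Z' ⊓ B' and meet in Z ⊓ B.
Nonnegativity matters because `apd` truncates multiplicities to natural numbers. -/
theorem multiplicity_nonneg (k : ℕ) {a b : ℕ} (h : a < b) : 0 ≤ multiplicity F l k h := by
  rw [multiplicity_eq]
  simp only [meetRank]
  have hZ := cycles_mono F (stage_mono l a.le_succ) k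
  have hB := boundaries_mono F (stage_mono l b.le_succ) k
  set Z := cycles F (stage l a) k
  set Z' := cycles F (stage l (a + 1)) k
  set B := boundaries F (stage l b) k
  set B' := boundaries F (stage l (b + 1)) k
  have h1 := Submodule.finrank_sup_add_finrank_inf_eq (K := F) (Z' ⊓ B) (Z ⊓ B')
  have h2 : (Z' ⊓ B) ⊓ (Z ⊓ B') = Z ⊓ B :=
    le_antisymm (le_inf (inf_le_right.trans inf_le_left) (inf_le_left.trans inf_le_right))
      (le_inf (inf_le_inf_right _ hZ) (inf_le_inf_left _ hB))
  have h3 : Module.finrank F ((Z' ⊓ B) ⊔ (Z ⊓ B') : Submodule F _)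
      ≤ Module.finrank F (Z' ⊓ B' : Submodule F _) :=
    Submodule.finrank_mono (sup_le (inf_le_inf_left _ hB) (inf_le_inf_right _ hZ))
  rw [h2] at h1
  omega

/-- The same argument for Z and Z' ⊓ B inside Z', where B consists of the boundaries of the whole
complex. -/
theorem essentialMultiplicity_nonneg (k : ℕ) (a : Fin l.length) :
    0 ≤ essentialMultiplicity F l k a := by
  simp only [essentialMultiplicity, pBetti_eq, meetRank]
  have hZ := cycles_mono F (stage_mono l (a : ℕ).le_succ) k
  set Z := cycles F (stage l a) k
  set Z' := cycles F (stage l (a + 1)) k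
  set B := boundaries F (stage l l.length) k
  have h1 := Submodule.finrank_sup_add_finrank_inf_eq (K := F) Z (Z' ⊓ B)
  have h2 : Z ⊓ (Z' ⊓ B) = Z ⊓ B := by rw [← inf_assoc, inf_eq_left.2 hZ]
  have h3 : Module.finrank F (Z ⊔ (Z' ⊓ B) : Submodule F _) ≤ Module.finrank F Z' :=
    Submodule.finrank_mono (sup_le hZ inf_le_left)
  rw [h2] at h1
  omega

/-- The number of points of dimension `k` that are born at index `a + 1`. -/
def birthCount (k : ℕ) (a : Fin l.length) : ℕ :=
  (∑ b : Fin l.length, if h : a < b then (multiplicity F l k (Fin.lt_def.1 h)).toNat else 0)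
    + (essentialMultiplicity F l k a).toNat

/-- The number of points of dimension `k` that die at index `b + 1`. -/
def deathCount (k : ℕ) (b : Fin l.length) : ℕ :=
  ∑ a : Fin l.length, if h : a < b then (multiplicity F l k (Fin.lt_def.1 h)).toNat else 0

/-- The essential part supplies the upper end of the telescoping sum. What remains is the dimension
of H_k(F_{a+1}) minus the rank of H_k(F_a) → H_k(F_{a+1}). -/
theorem birthCount_eq (k : ℕ) (a : Fin l.length) :
    (birthCount F l k a : ℤ) =
      Module.finrank F (cycles F (stage l (a + 1)) k) - meetRank F l k (a + 1) (a + 1)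
        - (Module.finrank F (cycles F (stage l a) k) - meetRank F l k a (a + 1)) := by
  obtain ⟨G, hG⟩ : ∃ G : ℕ → ℤ, ∀ b, G b = meetRank F l k (a + 1) b - meetRank F l k a b :=
    ⟨_, fun _ => rfl⟩
  have h : (∑ b : Fin l.length,
      ((if h : a < b then (multiplicity F l k (Fin.lt_def.1 h)).toNat else 0 : ℕ) : ℤ))
      = ∑ b ∈ Finset.range l.length, if (a : ℕ) < b then G (b + 1) - G b else 0 := by
    rw [← Fin.sum_univ_eq_sum_range (fun b => if (a : ℕ) < b then G (b + 1) - G b else 0)]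
    refine Finset.sum_congr rfl fun b _ => ?_
    by_cases hab : a < b
    · rw [dif_pos hab, if_pos (Fin.lt_def.1 hab), Int.toNat_of_nonneg (multiplicity_nonneg F l k _),
        multiplicity_eq, hG, hG]
      ring
    · rw [dif_neg hab, if_neg (fun h => hab (Fin.lt_def.2 h))]; rfl
  rw [birthCount, Nat.cast_add, Nat.cast_sum, h, sum_ite_lt_sub, if_pos a.isLt,
    Int.toNat_of_nonneg (essentialMultiplicity_nonneg F l k a)]
  simp only [essentialMultiplicity, pBetti_eq, hG]
  ring

/-- What remains is the dimension of the kernel of H_k(F_b) → H_k(F_{b+1}); the lower end of the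
telescoping sum vanishes because F_0 is empty. -/
theorem deathCount_eq (k : ℕ) (b : Fin l.length) :
    (deathCount F l k b : ℤ) = meetRank F l k b (b + 1) - meetRank F l k b b := by
  obtain ⟨H, hH⟩ : ∃ H : ℕ → ℤ, ∀ a, H a = meetRank F l k a (b + 1) - meetRank F l k a b :=
    ⟨_, fun _ => rfl⟩
  have h : (∑ a : Fin l.length,
      ((if h : a < b then (multiplicity F l k (Fin.lt_def.1 h)).toNat else 0 : ℕ) : ℤ))
      = ∑ a ∈ Finset.range l.length, if a < (b : ℕ) then H (a + 1) - H a else 0 := by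
    rw [← Fin.sum_univ_eq_sum_range (fun a => if a < (b : ℕ) then H (a + 1) - H a else 0)]
    refine Finset.sum_congr rfl fun a _ => ?_
    by_cases hab : a < b
    · rw [dif_pos hab, if_pos (Fin.lt_def.1 hab), Int.toNat_of_nonneg (multiplicity_nonneg F l k _),
        multiplicity_eq, hH, hH]
    · rw [dif_neg hab, if_neg (fun h => hab (Fin.lt_def.2 h))]; rfl
  have h0 : ∀ j, meetRank F l k 0 j = 0 := fun j => by
    have : cycles F (stage l 0) k = ⊥ := by
      have hc : chains F (stage l 0) k = ⊥ := by simp [chains, stage]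
      rw [cycles, hc, bot_inf_eq]
    rw [meetRank, this, bot_inf_eq, finrank_bot]; rfl
  rw [deathCount, Nat.cast_sum, h, sum_ite_gt_sub _ _ _ b.isLt.le]
  simp only [hH, h0]
  ring

variable {l}

theorem IsIndexFiltration.closedUnderFaces_stage {K : Geometry.SimplicialComplex ℝ (E d)}
    {f : Finset (E d) → ℝ} (hl : IsIndexFiltration K f l) (i : ℕ) :
    ClosedUnderFaces (stage l i) := by
  intro σ hσ τ hτ hne
  rw [stage, List.mem_toFinset] at hσ ⊢
  rcases eq_or_ne τ σ with rfl | hne'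
  · exact hσ
  have hτl : τ ∈ l := (hl.mem_iff τ).2
    (K.down_closed ((hl.mem_iff σ).1 (List.mem_of_mem_take hσ)) hτ hne)
  rw [← List.take_append_drop i l, List.mem_append] at hτl
  refine hτl.resolve_right fun h => ?_
  have := hl.face_before
  rw [← List.take_append_drop i l, List.pairwise_append] at this
  exact this.2.2 σ hσ τ h (Finset.ssubset_iff_subset_ne.2 ⟨hτ, hne'⟩)

theorem simplicesOfDim_stage_succ (k : ℕ) (a : Fin l.length) (h : (l.get a).card ≠ k + 1) :
    simplicesOfDim (stage l (a + 1)) k = simplicesOfDim (stage l a) k := by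
  classical
  ext σ
  simp only [simplicesOfDim, stage, Finset.mem_filter, List.mem_toFinset,
    List.take_add_one, List.getElem?_eq_getElem a.isLt, Option.toList_some, List.mem_append,
    List.mem_singleton]
  constructor
  · rintro ⟨h' | rfl, hc⟩
    · exact ⟨h', hc⟩
    · exact absurd hc h
  · exact fun h' => ⟨Or.inl h'.1, h'.2⟩

theorem card_simplicesOfDim_stage_succ (hl : l.Nodup) (k : ℕ) (a : Fin l.length)
    (h : (l.get a).card = k + 1) :
    (simplicesOfDim (stage l (a + 1)) k).card = (simplicesOfDim (stage l a) k).card + 1 := by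
  classical
  have h1 : l.get a ∉ stage l a := by
    rw [stage, List.mem_toFinset]
    intro hm
    rw [List.get_eq_getElem, List.mem_take_iff_getElem] at hm
    obtain ⟨j, hj, he⟩ := hm
    have := (List.Nodup.getElem_inj_iff hl).1 he
    omega
  have h2 : simplicesOfDim (stage l (a + 1)) k
      = insert (l.get a) (simplicesOfDim (stage l a) k) := by
    ext σ
    simp only [simplicesOfDim, stage, Finset.mem_filter, List.mem_toFinset,
      List.take_add_one, List.getElem?_eq_getElem a.isLt, Option.toList_some, List.mem_append,
      List.mem_singleton, Finset.mem_insert, List.get_eq_getElem]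
    constructor
    · rintro ⟨h' | rfl, hc⟩
      · exact Or.inr ⟨h', hc⟩
      · exact Or.inl rfl
    · rintro (rfl | h')
      · exact ⟨Or.inr rfl, h⟩
      · exact ⟨Or.inl h'.1, h'.2⟩
  rw [h2, Finset.card_insert_of_notMem]
  exact fun hm => h1 (Finset.mem_filter.1 hm).1

theorem chains_congr {L L' : Finset (Finset (E d))} {k : ℕ}
    (h : simplicesOfDim L k = simplicesOfDim L' k) : chains F L k = chains F L' k := by
  rw [chains_eq, chains_eq, h]

/-- A new vertex enlarges Z_0 by one dimension and leaves B_0 alone; any other simplex leaves Z_0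
alone. -/
theorem birthCount_zero {K : Geometry.SimplicialComplex ℝ (E d)} {f : Finset (E d) → ℝ}
    (hl : IsIndexFiltration K f l) (a : Fin l.length) :
    birthCount F l 0 a = if (l.get a).card = 1 then 1 else 0 := by
  rw [← Nat.cast_inj (R := ℤ), birthCount_eq]
  simp only [meetRank]
  by_cases h : (l.get a).card = 1
  · have hB : boundaries F (stage l (a + 1)) 0 = boundaries F (stage l a) 0 := by
      rw [boundaries, boundaries,
        chains_congr F (simplicesOfDim_stage_succ (0 + 1) a (by omega))]
    rw [if_pos h, hB, inf_eq_right.2 (boundaries_le_cycles F (hl.closedUnderFaces_stage _) 0),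
      inf_eq_right.2 ((boundaries_le_cycles F (hl.closedUnderFaces_stage a) 0).trans
        (cycles_mono F (stage_mono l (a : ℕ).le_succ) 0)),
      finrank_cycles_zero, finrank_cycles_zero, card_simplicesOfDim_stage_succ hl.nodup 0 a h]
    push_cast; ring
  · have hZ : cycles F (stage l (a + 1)) 0 = cycles F (stage l a) 0 := by
      rw [cycles, cycles, chains_congr F (simplicesOfDim_stage_succ 0 a h)]
    rw [if_neg h, hZ]; push_cast; ring

/-- A new (k + 1)-simplex changes neither B_{k+1} nor Z_k, so births are the growth of dim Z_{k+1}
and deaths that of dim B_k; by rank-nullity the two add up to one. Any other simplex changes neither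
Z_{k+1} nor B_k. -/
theorem birthCount_succ_add_deathCount {K : Geometry.SimplicialComplex ℝ (E d)}
    {f : Finset (E d) → ℝ} (hl : IsIndexFiltration K f l) (k : ℕ) (a : Fin l.length) :
    birthCount F l (k + 1) a + deathCount F l k a = if (l.get a).card = k + 2 then 1 else 0 := by
  rw [← Nat.cast_inj (R := ℤ), Nat.cast_add, birthCount_eq, deathCount_eq]
  simp only [meetRank]
  by_cases h : (l.get a).card = k + 2
  · have hB : boundaries F (stage l (a + 1)) (k + 1) = boundaries F (stage l a) (k + 1) := by
      rw [boundaries, boundaries,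
        chains_congr F (simplicesOfDim_stage_succ (k + 1 + 1) a (by omega))]
    have hZ : cycles F (stage l (a + 1)) k = cycles F (stage l a) k := by
      rw [cycles, cycles, chains_congr F (simplicesOfDim_stage_succ k a (by omega))]
    have hle := boundaries_le_cycles F (hl.closedUnderFaces_stage (a + 1)) k
    rw [hZ] at hle
    rw [if_pos h, hB,
      inf_eq_right.2 (boundaries_le_cycles F (hl.closedUnderFaces_stage a) (k + 1)),
      inf_eq_right.2 ((boundaries_le_cycles F (hl.closedUnderFaces_stage a) (k + 1)).trans
        (cycles_mono F (stage_mono l (a : ℕ).le_succ) (k + 1))),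
      inf_eq_right.2 hle,
      inf_eq_right.2 (boundaries_le_cycles F (hl.closedUnderFaces_stage a) k)]
    have h1 := finrank_cycles_add_finrank_boundaries F (stage l (a + 1)) k
    have h2 := finrank_cycles_add_finrank_boundaries F (stage l a) k
    rw [card_simplicesOfDim_stage_succ hl.nodup (k + 1) a h] at h1
    omega
  · have hC := chains_congr F (simplicesOfDim_stage_succ (k + 1) a h)
    have hZ : cycles F (stage l (a + 1)) (k + 1) = cycles F (stage l a) (k + 1) := by
      rw [cycles, cycles, hC]
    have hB : boundaries F (stage l (a + 1)) k = boundaries F (stage l a) k := by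
      rw [boundaries, boundaries, hC]
    rw [if_neg h, hZ, hB]; push_cast; ring

theorem countP_replicate_ite {α : Type*} (p : α → Prop) [DecidablePred p] (n : ℕ) (a : α) :
    (Multiset.replicate n a).countP p = if p a then n else 0 := by
  split_ifs with h
  · rw [Multiset.countP_eq_card.2, Multiset.card_replicate]
    exact fun b hb => Multiset.eq_of_mem_replicate hb ▸ h
  · exact Multiset.countP_eq_zero.2 fun b hb => Multiset.eq_of_mem_replicate hb ▸ h

open scoped Classical in
theorem countP_apd_birth (f : Finset (E d) → ℝ) (k : ℕ) (p : ℝ → Prop) :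
    (apd F f l k).countP (fun x => p x.1)
      = ∑ a : Fin l.length, if p (f (l.get a)) then birthCount F l k a else 0 := by
  rw [apd, ← Multiset.coe_countPAddMonoidHom, map_sum]
  refine Finset.sum_congr rfl fun a _ => ?_
  rw [map_add, map_sum]
  simp only [apply_dite, map_zero, Multiset.coe_countPAddMonoidHom, countP_replicate_ite,
    birthCount]
  split_ifs <;> simp

open scoped Classical in
theorem countP_apd_death (f : Finset (E d) → ℝ) (k : ℕ) (p : ℝ → Prop) :
    (apd F f l k).countP (fun x => ∃ y : ℝ, x.2 = (y : WithTop ℝ) ∧ p y)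
      = ∑ a : Fin l.length, if p (f (l.get a)) then deathCount F l k a else 0 := by
  rw [apd, ← Multiset.coe_countPAddMonoidHom, map_sum]
  simp only [map_add, map_sum]
  have h : ∀ a b : Fin l.length, Multiset.countPAddMonoidHom
      (fun x : Point => ∃ y : ℝ, x.2 = (y : WithTop ℝ) ∧ p y) (if h : a < b then
          Multiset.replicate (multiplicity F l k (Fin.lt_def.1 h)).toNat
            (f (l.get a), ((f (l.get b) : ℝ) : WithTop ℝ)) else 0)
      = if p (f (l.get b)) then
        (if h : a < b then (multiplicity F l k (Fin.lt_def.1 h)).toNat else 0) else 0 := by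
    intro a b
    by_cases hab : a < b
    · simp only [dif_pos hab, Multiset.coe_countPAddMonoidHom, countP_replicate_ite]
      refine if_congr ?_ rfl rfl
      simp
    · simp [dif_neg hab]
  simp only [h, Multiset.coe_countPAddMonoidHom, countP_replicate_ite]
  simp only [WithTop.top_ne_coe, false_and, exists_false, if_false, add_zero]
  rw [Finset.sum_comm]
  refine Finset.sum_congr rfl fun b _ => ?_
  split_ifs
  · rfl
  · simp

theorem sum_ite_get {α : Type*} (l : List α) (p : α → Prop) [DecidablePred p] :
    (∑ a : Fin l.length, if p (l.get a) then 1 else 0) = l.countP (fun x => decide (p x)) := by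
  induction l with
  | nil => rfl
  | cons x l ih =>
    refine (Fin.sum_univ_succ (n := l.length)
      (fun a => if p ((x :: l).get a) then 1 else 0)).trans ?_
    rw [List.countP_cons, ← ih, add_comm]
    by_cases h : p x <;> simp [h]

theorem countP_eq_ncard {K : Geometry.SimplicialComplex ℝ (E d)} {f : Finset (E d) → ℝ}
    (hl : IsIndexFiltration K f l) (p : Finset (E d) → Prop) [DecidablePred p] :
    l.countP (fun x => decide (p x)) = {σ ∈ K.faces | p σ}.ncard := by
  classical
  rw [List.countP_eq_length_filter, ← List.toFinset_card_of_nodup (hl.nodup.filter _),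
    ← Set.ncard_coe_finset]
  congr 1
  ext σ
  simp [hl.mem_iff]

open scoped Classical in
theorem countP_apd_zero {K : Geometry.SimplicialComplex ℝ (E d)} {f : Finset (E d) → ℝ}
    (hl : IsIndexFiltration K f l) (p : ℝ → Prop) :
    (apd F f l 0).countP (fun x => p x.1) = {σ ∈ K.faces | σ.card = 1 ∧ p (f σ)}.ncard := by
  rw [countP_apd_birth, ← countP_eq_ncard hl, ← sum_ite_get]
  refine Finset.sum_congr rfl fun a _ => ?_
  rw [birthCount_zero F hl]
  by_cases h1 : p (f (l.get a)) <;> by_cases h2 : (l.get a).card = 1 <;>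
    simp only [h1, h2, if_true, if_false, and_self, and_false, and_true]

open scoped Classical in
-- The index-wise identity, summed over the simplices with an admissible height. Diagonal points are
-- essential here: a birth and a death at equal heights still stand for two simplices.
theorem countP_apd_succ {K : Geometry.SimplicialComplex ℝ (E d)} {f : Finset (E d) → ℝ}
    (hl : IsIndexFiltration K f l) (k : ℕ) (p : ℝ → Prop) :
    (apd F f l (k + 1)).countP (fun x => p x.1)
      + (apd F f l k).countP (fun x => ∃ y : ℝ, x.2 = (y : WithTop ℝ) ∧ p y)
      = {σ ∈ K.faces | σ.card = k + 2 ∧ p (f σ)}.ncard := by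
  rw [countP_apd_birth, countP_apd_death, ← Finset.sum_add_distrib, ← countP_eq_ncard hl,
    ← sum_ite_get]
  refine Finset.sum_congr rfl fun a _ => ?_
  have := birthCount_succ_add_deathCount F hl k a
  by_cases h1 : p (f (l.get a)) <;> by_cases h2 : (l.get a).card = k + 2 <;>
    simp only [h1, h2, if_true, if_false, and_self, and_false, and_true] at this ⊢ <;> omega

end Points
/-! ### Specifications of computations -/

section Spec

variable {d : ℕ} {α β γ : Type} {O : Oracle d}

/-- Run with the oracle `O`, the computation `x` returns a value that satisfies `P`, after at most
`s` steps and `q` queries. -/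
structure Spec (O : Oracle d) (x : Comp d α) (P : α → Prop) (s q : ℕ) : Prop where
  val : P (x O).val
  steps : (x O).steps ≤ s
  queries : (x O).queries ≤ q

theorem Spec.mono {x : Comp d α} {P P' : α → Prop} {s q s' q' : ℕ} (h : Spec O x P s q)
    (hP : ∀ a, P a → P' a) (hs : s ≤ s') (hq : q ≤ q') : Spec O x P' s' q' :=
  ⟨hP _ h.val, h.steps.trans hs, h.queries.trans hq⟩

theorem Spec.cost {x : Comp d α} {P : α → Prop} {s q s' q' : ℕ} (h : Spec O x P s q)
    (hs : s ≤ s') (hq : q ≤ q') : Spec O x P s' q' := h.mono (fun _ => id) hs hq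

theorem Spec.imp {x : Comp d α} {P P' : α → Prop} {s q : ℕ} (h : Spec O x P s q)
    (hP : ∀ a, P a → P' a) : Spec O x P' s q := h.mono hP le_rfl le_rfl

theorem Spec.pure {a : α} {P : α → Prop} (h : P a) : Spec O (Pure.pure a : Comp d α) P 0 0 :=
  ⟨h, le_rfl, le_rfl⟩

theorem Spec.op {a : α} {P : α → Prop} (h : P a) : Spec O (op a) P 1 0 := ⟨h, le_rfl, le_rfl⟩

theorem Spec.op_rfl {a : α} : Spec O (Recon.op a) (· = a) 1 0 := Spec.op rfl

theorem Spec.pure' {a : α} {P : α → Prop} {s q : ℕ} (h : P a) :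
    Spec O (Pure.pure a : Comp d α) P s q := ⟨h, Nat.zero_le _, Nat.zero_le _⟩

theorem Spec.op' {a : α} {P : α → Prop} {s q : ℕ} (h : P a) : Spec O (Recon.op a) P (s + 1) q :=
  ⟨h, Nat.le_add_left _ _, Nat.zero_le _⟩

theorem Spec.charge (m : ℕ) : Spec O (charge m) (fun _ => True) m 0 := ⟨trivial, le_rfl, le_rfl⟩

theorem Spec.query (s : E d) : Spec O (query s) (· = O s) 1 1 := ⟨rfl, le_rfl, le_rfl⟩

theorem Spec.bind {x : Comp d α} {f : α → Comp d β} {P : α → Prop} {Q : β → Prop}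
    {s q s' q' : ℕ} (hx : Spec O x P s q) (hf : ∀ a, P a → Spec O (f a) Q s' q') :
    Spec O (x >>= f) Q (s + s') (q + q') :=
  ⟨(hf _ hx.val).val, Nat.add_le_add hx.steps (hf _ hx.val).steps,
    Nat.add_le_add hx.queries (hf _ hx.val).queries⟩

theorem Spec.bind_eq {x : Comp d α} {f : α → Comp d β} {a : α} {Q : β → Prop}
    {s q s' q' : ℕ} (hx : Spec O x (· = a) s q) (hf : Spec O (f a) Q s' q') :
    Spec O (x >>= f) Q (s + s') (q + q') :=
  hx.bind fun _ h => h ▸ hf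

theorem Spec.bind_op {f : α → Comp d β} {a : α} {Q : β → Prop} {s q : ℕ}
    (hf : Spec O (f a) Q s q) : Spec O (Recon.op a >>= f) Q (1 + s) q :=
  (Spec.op_rfl.bind_eq hf).cost le_rfl (zero_add q).le

theorem Spec.bind_charge {f : Unit → Comp d β} {m : ℕ} {Q : β → Prop} {s q : ℕ}
    (hf : Spec O (f ()) Q s q) : Spec O (Recon.charge m >>= f) Q (m + s) q :=
  ((Spec.charge m).bind fun _ _ => hf).cost le_rfl (zero_add q).le

theorem Spec.ite {c : Prop} [Decidable c] {x y : Comp d α} {P : α → Prop} {s q : ℕ}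
    (hx : c → Spec O x P s q) (hy : ¬ c → Spec O y P s q) :
    Spec O (if c then x else y) P s q := by
  split_ifs with h
  exacts [hx h, hy h]

theorem Spec.ite_max {c : Prop} [Decidable c] {x y : Comp d α} {P : α → Prop} {s q s' q' : ℕ}
    (hx : c → Spec O x P s q) (hy : ¬ c → Spec O y P s' q') :
    Spec O (if c then x else y) P (max s s') (max q q') :=
  Spec.ite (fun h => (hx h).cost (le_max_left _ _) (le_max_left _ _))
    fun h => (hy h).cost (le_max_right _ _) (le_max_right _ _)

/-- The invariant speaks of the processed prefix of the list. Costs may vary with the entry, as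
needed for faces of different dimensions; the additional 1 is the step that the loop itself charges.
-/
theorem Spec.foldC_sum {f : β → α → Comp d β} {l : List α} {b : β} (I : List α → β → Prop)
    (s q : α → ℕ) (h0 : I [] b)
    (h : ∀ pre a suf b, l = pre ++ a :: suf → I pre b →
      Spec O (f b a) (I (pre ++ [a])) (s a) (q a)) :
    Spec O (foldC f b l) (I l) (l.map fun a => s a + 1).sum (l.map q).sum := by
  suffices H : ∀ suf pre b, l = pre ++ suf → I pre b →
      Spec O (foldC f b suf) (I l) (suf.map fun a => s a + 1).sum (suf.map q).sum from
    H l [] b rfl h0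
  intro suf
  induction suf with
  | nil => intro pre b hl hI; rw [hl, List.append_nil]; exact Spec.pure hI
  | cons a suf ih =>
    intro pre b hl hI
    refine (Spec.bind_charge ((h pre a suf b hl hI).bind fun b' hb' =>
      ih (pre ++ [a]) b' (by simp [hl]) hb')).cost ?_ ?_
    · simp only [List.map_cons, List.sum_cons]; omega
    · simp only [List.map_cons, List.sum_cons]; omega

theorem Spec.foldC {f : β → α → Comp d β} {l : List α} {b : β} (I : List α → β → Prop)
    {s q : ℕ} (h0 : I [] b)
    (h : ∀ pre a suf b, l = pre ++ a :: suf → I pre b → Spec O (f b a) (I (pre ++ [a])) s q) :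
    Spec O (foldC f b l) (I l) (l.length * (s + 1)) (l.length * q) := by
  refine (Spec.foldC_sum I (fun _ => s) (fun _ => q) h0 h).cost ?_ ?_ <;> simp

theorem Spec.foldC_eq {f : β → α → Comp d β} {l : List α} {b : β} (g : β → α → β)
    {s q : ℕ} (h : ∀ a ∈ l, ∀ b, Spec O (f b a) (· = g b a) s q) :
    Spec O (Recon.foldC f b l) (· = l.foldl g b) (l.length * (s + 1)) (l.length * q) := by
  refine Spec.foldC (fun pre x => x = pre.foldl g b) rfl ?_
  rintro pre a suf b' hl rfl
  refine (h a (by simp [hl]) _).imp ?_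
  rintro _ rfl
  simp

theorem Spec.mapC_forall {f : α → Comp d β} {l : List α} (R : α → β → Prop) {s q : ℕ}
    (h : ∀ a ∈ l, Spec O (f a) (R a) s q) :
    Spec O (mapC f l) (List.Forall₂ R l) (l.length * (s + 1)) (l.length * q) := by
  induction l with
  | nil => exact Spec.pure' List.Forall₂.nil
  | cons a l ih =>
    refine (Spec.bind (h a (by simp)) fun b hb => Spec.bind (ih fun a' ha' => h a' (by simp [ha']))
      fun bs hbs => Spec.op (List.Forall₂.cons hb hbs)).cost ?_ ?_
    · simp only [List.length_cons]; linarith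
    · simp only [List.length_cons]; linarith

theorem Spec.mapC {f : α → Comp d β} {l : List α} (g : α → β) {s q : ℕ}
    (h : ∀ a ∈ l, Spec O (f a) (· = g a) s q) :
    Spec O (mapC f l) (· = l.map g) (l.length * (s + 1)) (l.length * q) := by
  refine (Spec.mapC_forall (fun a b => b = g a) h).imp fun bs hbs => ?_
  induction hbs with
  | nil => rfl
  | cons h1 _ ih =>
    rw [h1, ih fun a ha => h a (by simp [ha]), List.map_cons]

theorem Spec.zipC {f : α → β → Comp d γ} {l : List α} {m : List β} (g : α → β → γ) {s q : ℕ}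
    (h : ∀ a b, Spec O (f a b) (· = g a b) s q) :
    Spec O (zipC f l m) (· = List.zipWith g l m) (l.length * (s + 1)) (l.length * q) := by
  induction l generalizing m with
  | nil => exact Spec.pure' (by simp)
  | cons a l ih =>
    cases m with
    | nil => exact Spec.pure' (by simp)
    | cons b m =>
      apply Spec.cost
      · exact Spec.bind_eq (h a b) (Spec.bind_eq ih (Spec.op rfl))
      · simp only [List.length_cons]; linarith
      · simp only [List.length_cons]; linarith

theorem Spec.filterC {f : α → Comp d Bool} {l : List α} (p : α → Bool) {s q : ℕ}
    (h : ∀ a ∈ l, Spec O (f a) (· = p a) s q) :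
    Spec O (filterC f l) (· = l.filter p) (l.length * (s + 2)) (l.length * q) := by
  induction l with
  | nil => exact Spec.pure' rfl
  | cons a l ih =>
    apply Spec.cost
    · refine Spec.bind_charge (Spec.bind_eq (h a (by simp))
        (Spec.bind_eq (ih fun a' ha' => h a' (by simp [ha'])) (Spec.ite_max
          (fun ht => Spec.op ?_) fun ht => Spec.pure ?_)))
      · simp [ht]
      · simp [ht]
    · rw [max_eq_left (Nat.zero_le 1), List.length_cons]; linarith
    · rw [max_self, List.length_cons]; linarith

theorem Spec.countC {f : α → Comp d Bool} {l : List α} (p : α → Bool) {s q : ℕ}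
    (h : ∀ a ∈ l, Spec O (f a) (· = p a) s q) :
    Spec O (countC f l) (· = (l.countP p : ℤ)) (l.length * (s + 2)) (l.length * q) := by
  refine (Spec.foldC (s := s + 1) (q := q)
    (fun pre (c : ℤ) => c = (pre.countP p : ℤ)) (by simp) ?_).imp (fun _ => id)
  rintro pre a suf _ hl rfl
  refine Spec.bind_eq (s' := 1) (q' := 0) (h a (by simp [hl])) (Spec.ite (fun ht => Spec.op ?_)
    fun ht => Spec.pure' ?_)
  · simp [ht, List.countP_append]
  · simp [ht, List.countP_append]

theorem Spec.insertC {f : α → α → Comp d Bool} (r : α → α → Prop) [DecidableRel r] {s q : ℕ}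
    (h : ∀ a b, Spec O (f a b) (· = decide (r a b)) s q) (a : α) (l : List α) :
    Spec O (insertC f a l) (· = l.orderedInsert r a) (l.length * (s + 1) + 1)
      (l.length * q) := by
  induction l with
  | nil => exact Spec.op' rfl
  | cons b l ih =>
    apply Spec.cost
    · refine Spec.bind_eq (h a b) (Spec.ite (s := l.length * (s + 1) + 1 + 1) (q := l.length * q + 0)
        (fun ht => Spec.op' ?_) fun ht => Spec.bind_eq ih (Spec.op ?_))
      · rw [List.orderedInsert, if_pos (of_decide_eq_true ht)]
      · rw [List.orderedInsert, if_neg (by simpa using ht)]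
    · simp only [List.length_cons]; linarith
    · simp only [List.length_cons]; linarith

theorem Spec.sortC {f : α → α → Comp d Bool} (r : α → α → Prop) [DecidableRel r] {s : ℕ}
    (h : ∀ a b, Spec O (f a b) (· = decide (r a b)) s 0) (l : List α) :
    Spec O (sortC f l) (· = l.insertionSort r) (l.length * (l.length * (s + 1) + 1)) 0 := by
  induction l with
  | nil => exact Spec.pure' rfl
  | cons a l ih =>
    refine (Spec.bind_eq ih (Spec.insertC r h a _)).cost ?_ (by simp)
    simp only [List.length_cons, List.length_insertionSort]
    nlinarith [Nat.zero_le (l.length * (s + 1))]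

theorem spec_appendC (l m : List α) :
    Spec O (appendC l m) (· = l ++ m) (l.length + 1) 0 :=
  Spec.bind_charge (Spec.op rfl)

theorem spec_sortReals (l : List ℝ) :
    Spec O (sortReals l) (· = l.insertionSort (· ≤ ·)) (l.length * (l.length * 2 + 1)) 0 :=
  Spec.sortC (s := 1) (· ≤ ·) (fun _ _ => Spec.op (by congr)) l

theorem Spec.vecC {f : Fin d → Comp d ℝ} (g : Fin d → ℝ) {s : ℕ}
    (h : ∀ i, Spec O (f i) (· = g i) s 0) :
    Spec O (vecC f) (· = WithLp.toLp 2 g) (d * (s + 1)) 0 := by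
  refine ⟨?_, ?_, ?_⟩
  · show WithLp.toLp 2 (fun i => (f i O).val) = _
    exact congrArg _ (funext fun i => (h i).val)
  · show (∑ i, ((f i O).steps + 1)) ≤ _
    refine (Finset.sum_le_card_nsmul _ _ (s + 1) fun i _ =>
      Nat.add_le_add_right (h i).steps 1).trans ?_
    simp
  · show (∑ i, (f i O).queries) ≤ 0
    exact Finset.sum_nonpos fun i _ => (h i).queries

theorem Spec.sumC {f : Fin d → Comp d ℝ} (g : Fin d → ℝ) {s : ℕ}
    (h : ∀ i, Spec O (f i) (· = g i) s 0) :
    Spec O (sumC f) (· = ∑ i, g i) (d * (s + 1)) 0 := by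
  refine ⟨?_, ?_, ?_⟩
  · show (∑ i, (f i O).val) = _
    exact Finset.sum_congr rfl fun i _ => (h i).val
  · show (∑ i, ((f i O).steps + 1)) ≤ _
    refine (Finset.sum_le_card_nsmul _ _ (s + 1) fun i _ =>
      Nat.add_le_add_right (h i).steps 1).trans ?_
    simp
  · show (∑ i, (f i O).queries) ≤ 0
    exact Finset.sum_nonpos fun i _ => (h i).queries

end Spec

/-! ### Vector operations -/

section Vectors

variable {d : ℕ} {O : Oracle d}

theorem spec_dot (u v : E d) : Spec O (dot u v) (· = inner ℝ u v) (d * 2) 0 := by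
  refine (Spec.sumC (s := 1) (fun i => u i * v i) fun i => Spec.op rfl).imp ?_
  rintro _ rfl
  rw [PiLp.inner_apply]
  exact Finset.sum_congr rfl fun i _ => mul_comm _ _

theorem spec_lincomb (a : ℝ) (u : E d) (b : ℝ) (v : E d) :
    Spec O (lincomb a u b v) (· = a • u + b • v) (d * 4) 0 := by
  refine (Spec.vecC (s := 1 + (1 + 1)) (fun i => a * u i + b * v i)
    fun i => Spec.bind_op (Spec.bind_op (Spec.op rfl))).imp ?_
  rintro _ rfl
  ext i
  simp

theorem spec_normC (u : E d) : Spec O (normC u) (· = ‖u‖) (d * 2 + 1) 0 := by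
  unfold normC
  refine Spec.bind_eq (q := 0) (q' := 0) (spec_dot u u) (Spec.op ?_)
  rw [real_inner_self_eq_norm_sq, Real.sqrt_sq (norm_nonneg u)]

theorem spec_normalize (u : E d) :
    Spec O (normalize u) (· = ‖u‖⁻¹ • u) (d * 4 + 1) 0 := by
  refine (Spec.bind_eq (spec_normC u)
    (Spec.vecC (s := 1) (fun i => u i / ‖u‖) fun i => Spec.op rfl)).mono ?_ (by omega) le_rfl
  rintro _ rfl
  ext i
  simp [div_eq_inv_mul]

theorem spec_basisVec (i : Fin d) :
    Spec O (basisVec i) (· = EuclideanSpace.single i 1) (d * 2) 0 := by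
  refine (Spec.vecC (s := 1) (fun j => if j = i then 1 else 0) fun i => Spec.op rfl).imp ?_
  rintro _ rfl
  ext j
  simp

end Vectors

/-! ### Tilted directions -/

section Tilt

variable {d : ℕ} {O : Oracle d}

/-- In a sorted list any two distinct entries are separated by some positive consecutive difference,
so the smallest one is a lower bound. The result `none` occurs only if all entries agree. -/
theorem spec_minGap {l : List ℝ} (hl : l.Pairwise (· ≤ ·)) :
    Spec O (minGap l) (fun g => (∀ δ, g = some δ → 0 < δ) ∧
      ∀ x ∈ l, ∀ y ∈ l, x < y → ∃ δ, g = some δ ∧ δ ≤ y - x) (l.length * 3) 0 := by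
  induction l with
  | nil => exact Spec.pure' (by simp)
  | cons a l ih =>
    cases l with
    | nil => exact Spec.pure' (by simp)
    | cons b l =>
      rw [List.pairwise_cons] at hl
      have hab : a ≤ b := hl.1 b (by simp)
      refine Spec.cost (s := (b :: l).length * 3 + (1 + (1 + 1))) (q := 0 + 0)
        (Spec.bind (ih hl.2) fun g hg => Spec.bind_op (Spec.bind_op (Spec.ite
        (fun ht => ?_) fun ht => ?_))) (by simp only [List.length_cons]; omega) le_rfl
      · rw [decide_eq_true_eq] at ht
        cases g with
        | none =>
          refine Spec.pure' ⟨?_, ?_⟩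
          · rintro δ hδ; cases hδ; exact ht
          · intro x hx y hy hxy
            refine ⟨_, rfl, ?_⟩
            -- The tail has no positive gap, hence is constant, and the first difference is the only
            -- one.
            have key : ∀ z ∈ b :: l, ∀ w ∈ b :: l, ¬ z < w := fun z hz w hw h => by
              obtain ⟨δ, h, -⟩ := hg.2 z hz w hw h
              cases h
            have ha : ∀ z ∈ b :: l, b ≤ z := fun z hz => not_lt.1 (key z hz b (by simp))
            rcases List.mem_cons.1 hx with hx | hx
            · rcases List.mem_cons.1 hy with hy | hy
              · linarith
              · linarith [ha y hy]
            · rcases List.mem_cons.1 hy with hy | hy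
              · linarith [ha x hx]
              · exact absurd hxy (key x hx y hy)
        | some g' =>
          dsimp only
          refine Spec.bind_op (s := 0) (Spec.pure (And.intro ?_ ?_))
          · rintro δ hδ; cases hδ; exact lt_min ht (hg.1 _ rfl)
          · intro x hx y hy hxy
            refine ⟨_, rfl, ?_⟩
            have hb : ∀ z ∈ b :: l, b ≤ z := fun z hz => by
              rcases List.mem_cons.1 hz with rfl | hz
              · exact le_rfl
              · exact (List.pairwise_cons.1 hl.2).1 z hz
            rcases List.mem_cons.1 hx with hx | hx
            · rcases List.mem_cons.1 hy with hy | hy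
              · linarith
              · exact (min_le_left _ _).trans (by linarith [hb y hy])
            · rcases List.mem_cons.1 hy with hy | hy
              · linarith [hb x hx]
              · obtain ⟨δ, h, h'⟩ := hg.2 x hx y hy hxy
                cases h
                exact (min_le_right _ _).trans h'
      · rw [decide_eq_true_eq] at ht
        have : a = b := by linarith
        subst this
        refine Spec.pure' ⟨hg.1, ?_⟩
        intro x hx y hy hxy
        refine hg.2 x ?_ y ?_ hxy
        · simpa using hx
        · simpa using hy

theorem foldl_max_spec (l : List ℝ) (a : ℝ) :
    a ≤ l.foldl max a ∧ ∀ x ∈ l, x ≤ l.foldl max a := by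
  induction l generalizing a with
  | nil => simp
  | cons b l ih =>
    have := ih (max a b)
    refine ⟨(le_max_left _ _).trans this.1, fun x hx => ?_⟩
    rcases List.mem_cons.1 hx with rfl | hx
    · exact (le_max_right _ _).trans this.1
    · exact this.2 x hx

theorem foldl_min_spec (l : List ℝ) (a : ℝ) :
    l.foldl min a ≤ a ∧ ∀ x ∈ l, l.foldl min a ≤ x := by
  induction l generalizing a with
  | nil => simp
  | cons b l ih =>
    have := ih (min a b)
    refine ⟨this.1.trans (min_le_left _ _), fun x hx => ?_⟩
    rcases List.mem_cons.1 hx with rfl | hx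
    · exact this.1.trans (min_le_right _ _)
    · exact this.2 x hx

theorem spec_spread (l : List ℝ) :
    Spec O (spread l) (fun r => 0 ≤ r ∧ ∀ x ∈ l, ∀ y ∈ l, y - x ≤ r) (l.length * 4 + 1) 0 := by
  cases l with
  | nil => exact Spec.pure' (by simp)
  | cons a l =>
    refine Spec.cost (s := l.length * (1 + 1) + (l.length * (1 + 1) + 1))
      (q := l.length * 0 + (l.length * 0 + 0))
      (Spec.bind_eq (Spec.foldC_eq max fun x _ y => Spec.op rfl)
      (Spec.bind_eq (Spec.foldC_eq min fun x _ y => Spec.op rfl)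
        (Spec.op ?_))) (by simp only [List.length_cons]; omega) (by simp)
    have h1 := foldl_max_spec l a
    have h2 := foldl_min_spec l a
    refine ⟨by linarith, fun x hx y hy => ?_⟩
    have hy' : y ≤ l.foldl max a := by
      rcases List.mem_cons.1 hy with rfl | hy
      exacts [h1.1, h1.2 _ hy]
    have hx' : l.foldl min a ≤ x := by
      rcases List.mem_cons.1 hx with rfl | hx
      exacts [h2.1, h2.2 _ hx]
    linarith

/-- An upper bound for the number of steps of `tilt` with `m` vertices. -/
def tiltCost (d m : ℕ) : ℕ := m * m * 2 + m * 8 + d * 8 + 7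

/-- A pair at distinct heights is at least (1 - ε) g apart after scaling, and the second direction
can undo at most ε r of this. The order is kept for ε < g / (g + r), and half of this threshold is
taken. The clause ε < 1/2 for r > 0 serves to exclude that the tilt of a unit vector towards its
negative vanishes. -/
theorem spec_tilt (H H' : List ℝ) (s s' : E d) :
    Spec O (tilt H H' s s') (fun u => ∃ ε : ℝ, 0 < ε ∧ ε ≤ 1 / 2 ∧
      (∀ x ∈ H, ∀ y ∈ H, x < y → ∀ x' ∈ H', ∀ y' ∈ H',
        (1 - ε) * x + ε * x' < (1 - ε) * y + ε * y') ∧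
      (∀ x' ∈ H', ∀ y' ∈ H', x' < y' → ε < 1 / 2) ∧
      u = ‖(1 - ε) • s + ε • s'‖⁻¹ • ((1 - ε) • s + ε • s'))
      (tiltCost d (max H.length H'.length)) 0 := by
  have hsort : (H.insertionSort (· ≤ ·)).Pairwise (· ≤ ·) := List.pairwise_insertionSort _ H
  apply Spec.cost
  · refine Spec.bind_eq (spec_sortReals H) (Spec.bind (spec_minGap hsort) fun gap hgap =>
      Spec.bind (spec_spread H') fun r hr => Spec.bind_op (Spec.bind_op (Spec.bind_op (Spec.bind_op
        (Spec.bind_eq (spec_lincomb _ _ _ _) ((spec_normalize _).imp ?_))))))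
    rintro _ rfl
    have hg : 0 < gap.getD 1 ∧ ∀ x ∈ H, ∀ y ∈ H, x < y → gap.getD 1 ≤ y - x := by
      constructor
      · cases gap with
        | none => simp
        | some g => exact hgap.1 g rfl
      · intro x hx y hy hxy
        obtain ⟨δ, rfl, h⟩ := hgap.2 x ((List.mem_insertionSort _).2 hx) y
          ((List.mem_insertionSort _).2 hy) hxy
        exact h
    set g := gap.getD 1
    obtain ⟨hg0, hg1⟩ := hg
    have hq : 0 < 2 * (g + r) := by linarith [hr.1]
    have hε : g / (2 * (g + r)) * (2 * (g + r)) = g := div_mul_cancel₀ _ hq.ne'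
    set ε := g / (2 * (g + r))
    have hε0 : 0 < ε := div_pos hg0 hq
    refine ⟨ε, hε0, ?_, ?_, ?_, rfl⟩
    · rw [div_le_div_iff₀ hq two_pos]; linarith [hr.1]
    · intro x hx y hy hxy x' hx' y' hy'
      have h1 := hg1 x hx y hy hxy
      have h2 := hr.2 y' hy' x' hx'
      have h3 : ε ≤ 1 / 2 := by rw [div_le_div_iff₀ hq two_pos]; linarith [hr.1]
      nlinarith
    · intro x hx y hy hxy
      have := hr.2 x hx y hy
      rw [div_lt_div_iff₀ hq two_pos]; linarith
  · rw [tiltCost, List.length_insertionSort]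
    have h1 := le_max_left H.length H'.length
    have h2 := le_max_right H.length H'.length
    nlinarith [Nat.mul_le_mul h1 h1]
  · exact le_rfl

end Tilt
/-! ### Orthonormal lists and orthogonal directions -/

section Orthonormal

variable {d : ℕ} {O : Oracle d}

/-- The vectors in the list are orthonormal. -/
def OrthonormalList (us : List (E d)) : Prop :=
  us.Pairwise (fun u v => inner ℝ u v = 0) ∧ ∀ u ∈ us, ‖u‖ = 1

/-- The span of the vectors in a list. -/
def listSpan (us : List (E d)) : Submodule ℝ (E d) := Submodule.span ℝ {u | u ∈ us}

/-- The span of the vectors `x - p`, for the points `x` in a list. -/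
def dirSpan (p : E d) (xs : List (E d)) : Submodule ℝ (E d) := listSpan (xs.map fun x => x - p)

theorem mem_listSpan {us : List (E d)} {u : E d} (h : u ∈ us) : u ∈ listSpan us :=
  Submodule.subset_span h

theorem listSpan_append (us vs : List (E d)) :
    listSpan (us ++ vs) = listSpan us ⊔ listSpan vs := by
  rw [listSpan, listSpan, listSpan, ← Submodule.span_union]
  congr 1
  ext u
  simp

theorem listSpan_cons (u : E d) (us : List (E d)) :
    listSpan (u :: us) = listSpan us ⊔ listSpan [u] := by
  rw [sup_comm, ← listSpan_append]; rfl

theorem listSpan_singleton (u : E d) : listSpan [u] = Submodule.span ℝ {u} := by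
  simp [listSpan]

theorem inner_eq_zero_of_mem_listSpan {us : List (E d)} {s x : E d}
    (hs : ∀ u ∈ us, inner ℝ u s = 0) (hx : x ∈ listSpan us) : inner ℝ x s = 0 := by
  refine Submodule.span_induction (p := fun x _ => inner ℝ x s = 0) (fun u hu => hs u hu) ?_ ?_ ?_ hx
  · simp
  · intro x y _ _ h1 h2
    rw [inner_add_left, h1, h2, add_zero]
  · intro a x _ h
    rw [real_inner_smul_left, h, mul_zero]

/-- `r` is the component of `x` orthogonal to the vectors `us`. -/
def IsResidual (us : List (E d)) (x r : E d) : Prop :=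
  (∀ u ∈ us, inner ℝ u r = 0) ∧ x - r ∈ listSpan us

theorem IsResidual.inner_self {us : List (E d)} {x r : E d} (h : IsResidual us x r) :
    inner ℝ r x = inner ℝ r r := by
  have := inner_eq_zero_of_mem_listSpan h.1 h.2
  rw [inner_sub_left, real_inner_comm] at this
  linarith

theorem IsResidual.norm_le {us : List (E d)} {x r : E d} (h : IsResidual us x r) :
    ‖r‖ ≤ ‖x‖ := by
  have h1 := real_inner_le_norm r x
  rw [h.inner_self, real_inner_self_eq_norm_sq] at h1
  by_contra hc
  push Not at hc
  nlinarith [norm_nonneg x, norm_nonneg r]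

theorem IsResidual.ne_zero {us : List (E d)} {x r : E d} (h : IsResidual us x r)
    (hx : x ∉ listSpan us) : r ≠ 0 := by
  rintro rfl
  exact hx (by simpa using h.2)

theorem spec_residual {us : List (E d)} (hus : OrthonormalList us) (x : E d) :
    Spec O (residual us x) (IsResidual us x) (us.length * (d * 6 + 1)) 0 := by
  refine (Spec.foldC (s := d * 2 + d * 4) (q := 0) (fun pre r => IsResidual pre x r) ?_ ?_).cost
    (le_of_eq (by ring)) (by simp)
  · exact ⟨by simp, by simp⟩
  · intro pre u suf r hl hr
    refine Spec.bind_eq (q := 0) (q' := 0) (spec_dot u x) ((spec_lincomb _ _ _ _).imp ?_)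
    rintro _ rfl
    have hpw := hus.1
    rw [hl, List.pairwise_append] at hpw
    have hu : ∀ u' ∈ pre, inner ℝ u' u = 0 := fun u' hu' => hpw.2.2 u' hu' u (by simp)
    have h1 : ‖u‖ = 1 := hus.2 u (by simp [hl])
    constructor
    · intro u' hu'
      rw [one_smul, inner_add_right, real_inner_smul_right]
      rcases List.mem_append.1 hu' with h | h
      · rw [hr.1 u' h, hu u' h, mul_zero, add_zero]
      · rw [List.mem_singleton] at h
        subst h
        -- The coefficient of u is computed from x instead of the current remainder r; both agree,
        -- since x - r lies in the span of the earlier vectors, which are orthogonal to u.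
        have := inner_eq_zero_of_mem_listSpan hu hr.2
        rw [inner_sub_left, real_inner_comm, real_inner_comm u' r] at this
        rw [real_inner_self_eq_norm_sq, h1]
        linarith
    · have : x - ((1 : ℝ) • r + -inner ℝ u x • u) = (x - r) + inner ℝ u x • u := by
        rw [one_smul, neg_smul]; abel
      rw [this, listSpan_append]
      refine Submodule.add_mem_sup hr.2 (Submodule.smul_mem _ _ (mem_listSpan (by simp)))

theorem OrthonormalList.cons {us : List (E d)} (hus : OrthonormalList us) {x r : E d}
    (hr : IsResidual us x r) (hx : x ∉ listSpan us) : OrthonormalList (‖r‖⁻¹ • r :: us) := by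
  have h0 := hr.ne_zero hx
  refine ⟨List.pairwise_cons.2 ⟨fun u hu => ?_, hus.1⟩, fun u hu => ?_⟩
  · rw [real_inner_smul_left, real_inner_comm, hr.1 u hu, mul_zero]
  · rcases List.mem_cons.1 hu with rfl | hu
    · rw [norm_smul, norm_inv, norm_norm, inv_mul_cancel₀ (norm_ne_zero_iff.2 h0)]
    · exact hus.2 u hu

theorem IsResidual.listSpan_cons {us : List (E d)} {x r : E d} (hr : IsResidual us x r)
    (h0 : r ≠ 0) : listSpan (‖r‖⁻¹ • r :: us) = listSpan us ⊔ listSpan [x] := by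
  rw [Recon.listSpan_cons, listSpan_singleton, listSpan_singleton,
    Submodule.span_singleton_smul_eq (IsUnit.mk0 _ (inv_ne_zero (norm_ne_zero_iff.2 h0)))]
  have e : x = (x - r) + r := by abel
  refine le_antisymm (sup_le le_sup_left ?_) (sup_le le_sup_left ?_)
  · rw [Submodule.span_singleton_le_iff_mem]
    have : r = - (x - r) + x := by abel
    rw [this]
    exact Submodule.add_mem_sup (Submodule.neg_mem _ hr.2) (Submodule.mem_span_singleton_self x)
  · rw [Submodule.span_singleton_le_iff_mem, e]
    exact Submodule.add_mem_sup hr.2 (Submodule.mem_span_singleton_self r)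

/-- Each of the points `xs` is affinely independent of `p` and its predecessors. -/
def IndepFrom (p : E d) (xs : List (E d)) : Prop :=
  ∀ pre a suf, xs = pre ++ a :: suf → a - p ∉ dirSpan p pre

theorem dirSpan_append (p : E d) (xs ys : List (E d)) :
    dirSpan p (xs ++ ys) = dirSpan p xs ⊔ dirSpan p ys := by
  rw [dirSpan, List.map_append, listSpan_append]; rfl

theorem IndepFrom.append_left {p : E d} {xs ys : List (E d)} (h : IndepFrom p (xs ++ ys)) :
    IndepFrom p xs := fun pre a suf hl => h pre a (suf ++ ys) (by simp [hl])

/-- If a - p were in the span of the earlier differences, a would lie in the affine span of p and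
the earlier points. -/
theorem indepFrom_of_affineIndependent {A : Set (E d)}
    (hA : AffineIndependent ℝ ((↑) : A → E d)) {p : E d} {xs : List (E d)}
    (hmem : ∀ x ∈ p :: xs, x ∈ A) (hnd : (p :: xs).Nodup) : IndepFrom p xs := by
  intro pre a suf hl hmem'
  have hp : p ∈ A := hmem p (by simp)
  have ha : a ∈ A := hmem a (by simp [hl])
  have hap : a ≠ p := by
    rintro rfl
    exact (List.nodup_cons.1 hnd).1 (by simp [hl])
  have hapre : a ∉ pre := by
    have := (List.nodup_cons.1 hnd).2
    rw [hl, List.nodup_append] at this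
    exact fun h => this.2.2 a h a (by simp) rfl
  have h1 : a ∈ affineSpan ℝ (insert p {x | x ∈ pre}) := by
    have h2 : a - p ∈ vectorSpan ℝ (insert p {x | x ∈ pre}) := by
      refine Submodule.span_mono ?_ hmem'
      intro y hy
      simp only [List.mem_map, Set.mem_ofPred_eq] at hy
      obtain ⟨x, hx, rfl⟩ := hy
      exact Set.vsub_mem_vsub (Set.mem_insert_of_mem _ hx) (Set.mem_insert _ _)
    have h3 := vadd_mem_affineSpan_of_mem_affineSpan_of_mem_vectorSpan
      (mem_affineSpan ℝ (Set.mem_insert p {x | x ∈ pre})) h2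
    simpa using h3
  have h4 := hA.notMem_affineSpan_sdiff ⟨a, ha⟩ Set.univ
  refine h4 (affineSpan_mono ℝ ?_ h1)
  rintro x (rfl | hx)
  · exact ⟨⟨x, hp⟩, ⟨trivial, fun h => hap (congrArg Subtype.val h).symm⟩, rfl⟩
  · exact ⟨⟨x, hmem x (by simp [hl, show x ∈ pre from hx])⟩,
      ⟨trivial, fun h => hapre (by
        have e : x = a := congrArg Subtype.val h
        rw [← e]
        exact hx)⟩, rfl⟩

/-- An upper bound for the number of steps of one iteration of Gram-Schmidt with at most `m`
vectors. -/
def gramStep (d m : ℕ) : ℕ := m * (d * 6 + 1) + d * 8 + 3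

/-- The list `base` records points whose differences from p already have the span of `us`. This
covers both a start from nothing and the extension of an existing basis by a further vertex. -/
theorem spec_gramSchmidt {p : E d} {us base xs : List (E d)} (hus : OrthonormalList us)
    (hbase : listSpan us = dirSpan p base) (h : IndepFrom p (base ++ xs)) :
    Spec O (gramSchmidt p us xs) (fun us' => OrthonormalList us' ∧
      listSpan us' = dirSpan p (base ++ xs) ∧ us'.length = us.length + xs.length)
      (xs.length * gramStep d (us.length + xs.length)) 0 := by
  refine (Spec.foldC (q := 0)
    (s := d * 4 + ((us.length + xs.length) * (d * 6 + 1) + (d * 4 + 1 + 1)))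
    (fun pre us' => OrthonormalList us' ∧ listSpan us' = dirSpan p (base ++ pre) ∧
      us'.length = us.length + pre.length) ?_ ?_).cost ?_ (by simp)
  · exact ⟨hus, by simpa using hbase, by simp⟩
  · rintro pre x suf us' hl ⟨h1, h2, h3⟩
    have hle : us'.length ≤ us.length + xs.length := by rw [h3, hl, List.length_append]; omega
    refine Spec.bind_eq (q := 0) (q' := 0) (spec_lincomb _ _ _ _)
      (Spec.bind (q := 0) (q' := 0) ((spec_residual h1 _).cost
        (Nat.mul_le_mul_right _ hle) le_rfl) fun r hr =>
        Spec.bind_eq (q := 0) (q' := 0) (spec_normalize r) (Spec.op ?_))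
    have hx : (1 : ℝ) • x + (-1 : ℝ) • p = x - p := by rw [one_smul, neg_one_smul, sub_eq_add_neg]
    rw [hx] at hr
    have hn : x - p ∉ listSpan us' := by
      rw [h2]
      exact h (base ++ pre) x suf (by simp [hl])
    refine ⟨h1.cons hr hn, ?_, ?_⟩
    · rw [hr.listSpan_cons (hr.ne_zero hn), h2, ← List.append_assoc, dirSpan_append p _ [x]]
      rfl
    · simp [h3]; omega
  · rw [gramStep]
    exact le_of_eq (by ring)

theorem orthonormalList_nil : OrthonormalList ([] : List (E d)) := ⟨by simp, by simp⟩

theorem spec_perpDirAux {us : List (E d)} (hus : OrthonormalList us) (js : List (Fin d))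
    (hjs : ∃ j ∈ js, EuclideanSpace.single j (1 : ℝ) ∉ listSpan us) :
    Spec O (perpDirAux us js) (fun s => ‖s‖ = 1 ∧ ∀ u ∈ us, inner ℝ u s = 0)
      (js.length * (us.length * (d * 6 + 1) + d * 4 + 1) + d * 4 + 1) 0 := by
  induction js with
  | nil => simp at hjs
  | cons j js ih =>
    refine Spec.cost (s := d * 2 + (us.length * (d * 6 + 1) + (d * 2 + (1 +
      (js.length * (us.length * (d * 6 + 1) + d * 4 + 1) + d * 4 + 1))))) (q := 0)
      (Spec.bind_eq (q := 0) (q' := 0) (spec_basisVec j)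
      (Spec.bind (q := 0) (q' := 0) (spec_residual hus _) fun r hr =>
        Spec.bind_eq (q := 0) (q' := 0) (spec_dot r r) (Spec.bind_op (Spec.ite (fun ht => ?_)
          fun ht => ?_)))) ?_ le_rfl
    · rw [decide_eq_true_eq, inner_self_eq_zero] at ht
      refine ih ?_
      obtain ⟨i, hi, hi'⟩ := hjs
      rcases List.mem_cons.1 hi with rfl | hi
      · exact absurd ht (hr.ne_zero hi')
      · exact ⟨i, hi, hi'⟩
    · rw [decide_eq_true_eq, inner_self_eq_zero] at ht
      refine (spec_normalize r).mono ?_ (by omega) le_rfl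
      rintro _ rfl
      refine ⟨?_, fun u hu => ?_⟩
      · rw [norm_smul, norm_inv, norm_norm, inv_mul_cancel₀ (norm_ne_zero_iff.2 ht)]
      · rw [real_inner_smul_right, hr.1 u hu, mul_zero]
    · simp only [List.length_cons]
      exact le_of_eq (by ring)

/-- Fewer than d vectors do not span the space, so some standard basis vector is outside their span
and has a nonzero residual. -/
theorem spec_perpDir {us : List (E d)} (hus : OrthonormalList us) (hlt : us.length < d) :
    Spec O (perpDir us) (fun s => ‖s‖ = 1 ∧ ∀ u ∈ us, inner ℝ u s = 0)
      (d * (us.length * (d * 6 + 1) + d * 4 + 1) + d * 4 + 1) 0 := by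
  refine (spec_perpDirAux hus (List.finRange d) ?_).cost (by simp) le_rfl
  by_contra hc
  push Not at hc
  have htop : listSpan us = ⊤ := by
    rw [eq_top_iff, ← (EuclideanSpace.basisFun (Fin d) ℝ).toBasis.span_eq, Submodule.span_le]
    rintro _ ⟨i, rfl⟩
    simpa using hc i (List.mem_finRange i)
  have h1 : Module.finrank ℝ (listSpan us) ≤ us.length := by
    classical
    have : listSpan us = Submodule.span ℝ (us.toFinset : Set (E d)) := by
      simp [listSpan]
    rw [this]
    exact (finrank_span_finset_le_card _).trans (List.toFinset_card_le us)
  rw [htop, finrank_top, finrank_euclideanSpace, Fintype.card_fin] at h1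
  omega

/-- An upper bound for the number of steps of `separatingDir`, for `m` orthonormal vectors and `n`
points. -/
def sepCost (d m n : ℕ) : ℕ := n * (m * (d * 6 + 1) + d * 18 + 12) + d * 4 + 1

theorem one_smul_add_neg_one_smul (x p : E d) : (1 : ℝ) • x + (-1 : ℝ) • p = x - p := by
  rw [one_smul, neg_one_smul, sub_eq_add_neg]

theorem norm_inv_smul_self {x : E d} (h : x ≠ 0) : ‖‖x‖⁻¹ • x‖ = 1 := by
  rw [norm_smul, norm_inv, norm_norm, inv_mul_cancel₀ (norm_ne_zero_iff.2 h)]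

/-- Invariant: the second component m is positive and bounds from below every height difference
obtained so far. If q is level with p, adding δ r, with r the residual of q - p, moves q by δ ⟨r, r⟩
> 0. With δ = m / (2 M) every earlier difference changes by at most m / 2, so min (m / 2) (δ ⟨r, r⟩)
is a valid new bound. The clause for an empty list keeps the later tilt towards this direction from
degenerating. -/
theorem spec_separatingDir {us : List (E d)} (hus : OrthonormalList us) {p s : E d}
    (hs : ‖s‖ = 1) (hperp : ∀ u ∈ us, inner ℝ u s = 0) {Q : List (E d)}
    (hQ : ∀ q ∈ Q, q - p ∉ listSpan us) :
    Spec O (separatingDir us p s Q) (fun t => ‖t‖ = 1 ∧ (∀ u ∈ us, inner ℝ u t = 0) ∧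
      (∀ q ∈ Q, inner ℝ t (q - p) ≠ 0) ∧ (Q = [] → t = s)) (sepCost d us.length Q.length) 0 := by
  have hM : Spec O (foldC (fun M q => do
      let y ← lincomb 1 q (-1) p
      let t ← dot y y
      op (max M t)) 0 Q) (fun M => ∀ q ∈ Q, ‖q - p‖ ^ 2 ≤ M)
      (Q.length * (d * 4 + (d * 2 + 1) + 1)) 0 := by
    refine (Spec.foldC (s := d * 4 + (d * 2 + 1)) (q := 0)
      (fun pre M => ∀ q ∈ pre, ‖q - p‖ ^ 2 ≤ M) (by simp) ?_).cost le_rfl (by simp)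
    intro pre q suf M hl hM
    refine Spec.bind_eq (q := 0) (q' := 0) (spec_lincomb _ _ _ _)
      (Spec.bind_eq (q := 0) (q' := 0) (spec_dot _ _) (Spec.op ?_))
    intro q' hq'
    rw [one_smul_add_neg_one_smul, real_inner_self_eq_norm_sq]
    rcases List.mem_append.1 hq' with h | h
    · exact (hM q' h).trans (le_max_left _ _)
    · rw [List.mem_singleton.1 h]
      exact le_max_right _ _
  refine Spec.cost (q := 0) (s := Q.length * (d * 4 + (d * 2 + 1) + 1) +
    (Q.length * ((d * 4 + (us.length * (d * 6 + 1) + (d * 2 + (1 + (d * 6 + 7))))) + 1)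
      + (d * 4 + 1)))
    (Spec.bind (q := 0) (q' := 0) hM fun M hM => Spec.bind (q := 0) (q' := 0)
      (P := fun st => 0 < st.2 ∧ (∀ u ∈ us, inner ℝ u st.1 = 0) ∧
        (∀ q ∈ Q, st.2 ≤ |inner ℝ st.1 (q - p)|) ∧ (Q = [] → st.1 = s)) ?_ fun st hst => ?_) ?_ le_rfl
  · refine (Spec.foldC (s := d * 4 + (us.length * (d * 6 + 1) + (d * 2 + (1 + (d * 6 + 7)))))
      (q := 0) (fun pre (st : E d × ℝ) => 0 < st.2 ∧ (∀ u ∈ us, inner ℝ u st.1 = 0) ∧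
        (∀ q ∈ pre, st.2 ≤ |inner ℝ st.1 (q - p)|) ∧ (pre = [] → st.1 = s)) ?_ ?_).cost
        le_rfl (by simp)
    · exact ⟨one_pos, hperp, by simp, fun _ => rfl⟩
    · rintro pre q suf ⟨t, m⟩ hl ⟨hm, ht, hpre, -⟩
      dsimp only at hm ht hpre
      have hqQ : q ∈ Q := by simp [hl]
      refine Spec.bind_eq (q := 0) (q' := 0) (spec_lincomb _ _ _ _)
        (Spec.bind (q := 0) (q' := 0) (spec_residual hus _) fun r hr =>
          Spec.bind_eq (q := 0) (q' := 0) (spec_dot _ _) (Spec.bind_op (Spec.ite (fun h0 => ?_)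
            fun h0 => ?_)))
      · rw [decide_eq_true_eq] at h0
        rw [one_smul_add_neg_one_smul] at hr h0
        have hr0 := hr.ne_zero (hQ q hqQ)
        have hMq := hM q hqQ
        refine Spec.cost (q := 0) (s := 1 + (1 + (d * 4 + (d * 2 + (1 + (1 + (1 + 0)))))))
          (Spec.bind_op (Spec.bind_op
          (Spec.bind_eq (q := 0) (q' := 0) (spec_lincomb _ _ _ _)
          (Spec.bind_eq (q := 0) (q' := 0) (spec_dot r r) (Spec.bind_op (Spec.bind_op (Spec.bind_op
            (Spec.pure ?_)))))))) (by omega) le_rfl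
        have hrpos : 0 < inner ℝ r r := by
          rw [real_inner_self_eq_norm_sq]
          exact pow_pos (norm_pos_iff.2 hr0) 2
        have hMpos : 0 < M := by
          refine lt_of_lt_of_le ?_ hMq
          exact pow_pos ((norm_pos_iff.2 hr0).trans_le hr.norm_le) 2
        have hδ : 0 < m / (2 * M) := by positivity
        have hδM : m / (2 * M) * M = m / 2 := by field_simp
        rw [one_smul]
        set δ := m / (2 * M)
        refine ⟨lt_min (by linarith) (mul_pos hδ hrpos), fun u hu => ?_, fun q' hq' => ?_,
          by simp⟩
        · dsimp only
          rw [inner_add_right, ht u hu, real_inner_smul_right, hr.1 u hu]; ring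
        · dsimp only
          rw [inner_add_left, real_inner_smul_left]
          rcases List.mem_append.1 hq' with h | h
          · refine (min_le_left _ _).trans ?_
            have h1 := hpre q' h
            -- Cauchy-Schwarz: the residual is no longer than q - p, and ‖q - p‖² and ‖q' - p‖² are
            -- both at most M.
            have h2 : |inner ℝ r (q' - p)| ≤ M := by
              have h3 := hM q' (by simp [hl, h])
              refine (abs_real_inner_le_norm _ _).trans ?_
              have h4 := hr.norm_le
              nlinarith [norm_nonneg r, norm_nonneg (q - p), norm_nonneg (q' - p),
                sq_nonneg (‖q - p‖ - ‖q' - p‖), mul_le_mul_of_nonneg_right h4 (norm_nonneg (q' - p))]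
            have h5 : |δ * inner ℝ r (q' - p)| ≤ m / 2 := by
              rw [abs_mul, abs_of_pos hδ, ← hδM]
              exact mul_le_mul_of_nonneg_left h2 hδ.le
            have h6 := abs_sub_abs_le_abs_sub (inner ℝ t (q' - p)) (-(δ * inner ℝ r (q' - p)))
            rw [abs_neg, sub_neg_eq_add] at h6
            linarith
          · rw [List.mem_singleton.1 h, h0, zero_add, hr.inner_self]
            exact (min_le_right _ _).trans (le_abs_self _)
      · rw [decide_eq_true_eq] at h0
        rw [one_smul_add_neg_one_smul] at h0 ⊢
        refine Spec.cost (q := 0) (s := 1 + (1 + 0)) (Spec.bind_op (Spec.bind_op (Spec.pure ?_)))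
          (by omega) le_rfl
        refine ⟨lt_min hm (abs_pos.2 h0), ht, fun q' hq' => ?_, by simp⟩
        rcases List.mem_append.1 hq' with h | h
        · exact (min_le_left _ _).trans (hpre q' h)
        · rw [List.mem_singleton.1 h]
          exact min_le_right _ _
  · obtain ⟨hpos, hperp', hsep, hnil⟩ := hst
    refine (spec_normalize _).imp ?_
    rintro _ rfl
    have h0 : st.1 ≠ 0 := by
      rcases eq_or_ne Q [] with h | h
      · rw [hnil h]
        rintro rfl
        simp at hs
      · obtain ⟨q, hq⟩ := List.exists_mem_of_ne_nil Q h
        intro h'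
        have := hsep q hq
        rw [h', inner_zero_left, abs_zero] at this
        linarith
    refine ⟨norm_inv_smul_self h0, fun u hu => ?_, fun q hq => ?_, fun h => ?_⟩
    · rw [real_inner_smul_right, hperp' u hu, mul_zero]
    · rw [real_inner_smul_left]
      refine mul_ne_zero (inv_ne_zero (norm_ne_zero_iff.2 h0)) fun h' => ?_
      have := hsep q hq
      rw [h', abs_zero] at this
      linarith
    · rw [hnil h, hs, inv_one, one_smul]
  · rw [sepCost]
    nlinarith [Nat.zero_le Q.length]

/-- An upper bound for the number of steps of `liftingDir`, for `m` points. -/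
def liftCost (d m : ℕ) : ℕ := m * (m * (d * 6 + 1) + d * 16 + 7) + d * 4 + 1

/-- The direction is built so that relative to p the points of W have height 0 and the processed
points of X height exactly 1. The unit residual u of x - p is orthogonal to all earlier differences
and has inner product ρ with x - p, so adding (1 - a) / ρ times u corrects the height a of x and no
other. Independence makes ρ positive. -/
theorem spec_liftingDir {p : E d} {W X : List (E d)} (h : IndepFrom p (W ++ X)) (hX : X ≠ []) :
    Spec O (liftingDir (p :: W) X) (fun s => ‖s‖ = 1 ∧ (∀ w ∈ W, inner ℝ s w = inner ℝ s p) ∧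
      ∀ x ∈ X, inner ℝ s p < inner ℝ s x) (liftCost d (W.length + X.length)) 0 := by
  refine Spec.cost (q := 0) (s := W.length * gramStep d ([].length + W.length) +
    (X.length * ((d * 4 + ((W.length + X.length) * (d * 6 + 1) + (d * 2 + 1 + (d * 4 + 1 + (d * 2 +
      (1 + (1 + (d * 4 + (1 + 0)))))))) + 1)) + (d * 4 + 1)))
    (Spec.bind (q := 0) (q' := 0)
      (spec_gramSchmidt (base := []) orthonormalList_nil (by simp [dirSpan]) h.append_left)
      fun us hus => Spec.bind (q := 0) (q' := 0)
        (P := fun st => (∀ w ∈ W, inner ℝ st.2 (w - p) = 0) ∧ ∀ x ∈ X, inner ℝ st.2 (x - p) = 1)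
        ?_ fun st hst => ?_) ?_ le_rfl
  · obtain ⟨hus, hspan, hlen⟩ := hus
    rw [List.nil_append] at hspan
    rw [List.length_nil, zero_add] at hlen
    have hlen : us.length = W.length := hlen
    refine (Spec.foldC (q := 0) (s := d * 4 + ((W.length + X.length) * (d * 6 + 1) +
      (d * 2 + 1 + (d * 4 + 1 + (d * 2 + (1 + (1 + (d * 4 + (1 + 0)))))))))
      (fun pre (st : List (E d) × E d) => OrthonormalList st.1 ∧
        listSpan st.1 = dirSpan p (W ++ pre) ∧ st.1.length = W.length + pre.length ∧
        (∀ w ∈ W, inner ℝ st.2 (w - p) = 0) ∧ ∀ x ∈ pre, inner ℝ st.2 (x - p) = 1) ?_ ?_).mono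
        ?_ le_rfl (by simp)
    · exact ⟨hus, by simpa using hspan, by simpa using hlen, by simp, by simp⟩
    · rintro pre x suf ⟨us', t⟩ hl ⟨h1, h2, h3, h4, h5⟩
      dsimp only at h1 h2 h3 h4 h5
      have hle : us'.length ≤ W.length + X.length := by rw [h3, hl, List.length_append]; omega
      refine Spec.bind_eq (q := 0) (q' := 0) (spec_lincomb _ _ _ _)
        (Spec.bind (q := 0) (q' := 0) ((spec_residual h1 _).cost
          (Nat.mul_le_mul_right _ hle) le_rfl) fun r hr =>
        Spec.bind_eq (q := 0) (q' := 0) (spec_normC r) (Spec.bind_eq (q := 0) (q' := 0)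
          (spec_normalize r) (Spec.bind_eq (q := 0) (q' := 0) (spec_dot _ _)
            (Spec.bind_op (Spec.bind_op (Spec.bind_eq (q := 0) (q' := 0) (spec_lincomb _ _ _ _)
              (Spec.bind_op (Spec.pure ?_))))))))
      simp only [List.headD_cons, one_smul_add_neg_one_smul] at hr ⊢
      have hn : x - p ∉ listSpan us' := by
        rw [h2]
        exact h (W ++ pre) x suf (by simp [hl])
      have h0 := hr.ne_zero hn
      have hpos := norm_pos_iff.2 h0
      have key : ∀ z ∈ W ++ pre, inner ℝ r (z - p) = 0 := fun z hz => by
        rw [real_inner_comm]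
        refine inner_eq_zero_of_mem_listSpan hr.1 ?_
        rw [h2]
        exact mem_listSpan (List.mem_map.2 ⟨z, hz, rfl⟩)
      refine ⟨h1.cons hr hn, ?_, ?_, fun w hw => ?_, fun z hz => ?_⟩
      · rw [hr.listSpan_cons h0, h2, ← List.append_assoc, dirSpan_append p _ [x]]
        rfl
      · simp only [List.length_cons, List.length_append, h3, List.length_nil]; omega
      · rw [one_smul, inner_add_left, real_inner_smul_left, real_inner_smul_left, h4 w hw,
          key w (by simp [hw])]
        ring
      · rw [one_smul, inner_add_left, real_inner_smul_left, real_inner_smul_left]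
        rcases List.mem_append.1 hz with hz | hz
        · rw [h5 z hz, key z (by simp [hz])]
          ring
        · rw [List.mem_singleton.1 hz, hr.inner_self, real_inner_self_eq_norm_sq]
          field_simp
          ring
    · exact fun st hst => hst.2.2.2
  · refine (spec_normalize _).imp ?_
    rintro _ rfl
    have h0 : st.2 ≠ 0 := by
      obtain ⟨x, hx⟩ := List.exists_mem_of_ne_nil X hX
      intro h'
      have := hst.2 x hx
      rw [h', inner_zero_left] at this
      exact zero_ne_one this
    have hpos := inv_pos.2 (norm_pos_iff.2 h0)
    refine ⟨norm_inv_smul_self h0, fun w hw => ?_, fun x hx => ?_⟩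
    · have := hst.1 w hw
      rw [inner_sub_right, sub_eq_zero] at this
      rw [real_inner_smul_left, real_inner_smul_left, this]
    · have := hst.2 x hx
      rw [inner_sub_right] at this
      rw [real_inner_smul_left, real_inner_smul_left]
      exact mul_lt_mul_of_pos_left (by linarith) hpos
  · rw [liftCost, gramStep, List.length_nil, zero_add]
    nlinarith [Nat.zero_le (W.length * X.length), Nat.zero_le (W.length * X.length * d),
      Nat.zero_le (W.length * d), Nat.zero_le W.length]

end Orthonormal
/-! ### Reading the diagrams -/

section Diagrams

variable {d : ℕ} {F : Type*} [Field F] {K : Geometry.SimplicialComplex ℝ (E d)} {O : Oracle d}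

theorem height_singleton (s x : E d) : height s {x} = inner ℝ s x := by
  simp [height]

theorem vertices_finite (hK : K.faces.Finite) : K.vertices.Finite :=
  Set.Finite.of_finite_image (f := fun x => ({x} : Finset (E d)))
    (hK.subset (by rintro _ ⟨x, hx, rfl⟩; exact hx))
    (fun _ _ _ _ h => Finset.singleton_injective h)

theorem ncard_vertices_le (hK : K.faces.Finite) : K.vertices.ncard ≤ K.faces.ncard :=
  Set.ncard_le_ncard_of_injOn (fun x => ({x} : Finset (E d))) (fun _ hx => hx)
    (fun _ _ _ _ h => Finset.singleton_injective h) hK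

theorem face_nonempty {σ : Finset (E d)} (hσ : σ ∈ K.faces) : σ.Nonempty :=
  K.nonempty_of_mem_faces hσ

theorem face_subset {σ τ : Finset (E d)} (hσ : σ ∈ K.faces) (h : τ ⊆ σ) (hne : τ.Nonempty) :
    τ ∈ K.faces := K.down_closed hσ h hne

theorem mem_vertices_of_mem_face {σ : Finset (E d)} (hσ : σ ∈ K.faces) {x : E d} (hx : x ∈ σ) :
    x ∈ K.vertices :=
  K.down_closed hσ (Finset.singleton_subset_iff.2 hx) (Finset.singleton_nonempty x)

/-- The number of `k`-simplices at height `c` in direction `s`. -/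
def eventCount (K : Geometry.SimplicialComplex ℝ (E d)) (s : E d) (k : ℕ) (c : ℝ) : ℕ :=
  {ρ ∈ K.faces | ρ.card = k + 1 ∧ height s ρ = c}.ncard

/-- The counting identity without a condition on heights. It bounds the lengths of the diagrams and
lets the dimension of the complex be read off. -/
theorem ncard_simplices (hO : IsOracleFor F O K) {s : E d} (hs : ‖s‖ = 1) (k : ℕ) :
    (O s (k + 1)).length + (O s k).countP (fun x => decide (x.2 ≠ ⊤))
      = {ρ ∈ K.faces | ρ.card = k + 2}.ncard := by
  classical
  obtain ⟨l, hl, h⟩ := hO s hs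
  have := countP_apd_succ F hl k (fun _ => True)
  rw [← h, ← h, Multiset.coe_countP, Multiset.coe_countP] at this
  simp only [and_true] at this
  rw [← this]
  congr 1
  · simp
  · refine List.countP_congr fun x _ => ?_
    rcases x with ⟨a, _ | b⟩
    · simp only [decide_eq_true_eq]
      constructor
      · exact fun h => absurd rfl h
      · rintro ⟨y, hy⟩
        exact absurd hy (WithTop.top_ne_coe)
    · simp only [decide_eq_true_eq]
      constructor
      · exact fun _ => ⟨b, rfl⟩
      · exact fun _ => WithTop.coe_ne_top

theorem length_le_ncard_faces (hK : K.faces.Finite) (hO : IsOracleFor F O K) {s : E d}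
    (hs : ‖s‖ = 1) (k : ℕ) : (O s k).length ≤ K.faces.ncard := by
  classical
  obtain ⟨l, hl, h⟩ := hO s hs
  rcases k with _ | k
  · have := countP_apd_zero F hl (fun _ => True)
    rw [← h, Multiset.coe_countP] at this
    simp only [decide_true, List.countP_true, and_true] at this
    rw [this]
    exact Set.ncard_le_ncard (fun σ hσ => hσ.1) hK
  · have := ncard_simplices hO hs k
    have h2 : {σ ∈ K.faces | σ.card = k + 2}.ncard ≤ K.faces.ncard :=
      Set.ncard_le_ncard (fun σ hσ => hσ.1) hK
    omega

theorem spec_eventsAt (hK : K.faces.Finite) (hO : IsOracleFor F O K) {s : E d} (hs : ‖s‖ = 1)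
    {k : ℕ} (hk : 1 ≤ k) (c : ℝ) :
    Spec O (eventsAt (O s) k c) (· = (eventCount K s k c : ℤ)) (K.faces.ncard * 6 + 1) 0 := by
  classical
  obtain ⟨k, rfl⟩ : ∃ j, k = j + 1 := ⟨k - 1, by omega⟩
  have hle1 := length_le_ncard_faces hK hO hs k
  have hle2 := length_le_ncard_faces hK hO hs (k + 1)
  refine Spec.cost (q := 0) (s := (O s k).length * (1 + 2) + ((O s (k + 1)).length * (1 + 2) + 1))
    (Spec.bind_eq (q := 0) (q' := 0)
      (Spec.countC (q := 0) (s := 1) (fun x => decide (x.2 = (c : WithTop ℝ)))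
        fun a _ => Spec.op rfl)
      (Spec.bind_eq (q := 0) (q' := 0) (Spec.countC (q := 0) (s := 1) (fun x => decide (x.1 = c))
        fun a _ => Spec.op rfl) (Spec.op ?_))) (by omega) le_rfl
  obtain ⟨l, hl, h⟩ := hO s hs
  have := countP_apd_succ F hl k (fun y => y = c)
  rw [← h, ← h, Multiset.coe_countP, Multiset.coe_countP] at this
  rw [eventCount, ← this]
  push_cast
  rw [add_comm]
  congr 2
  refine List.countP_congr fun x _ => ?_
  simp

/-- Every value c occurs equally often in both lists, because in dimension 0 each vertex gives
exactly one birth, at its height. -/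
theorem births_perm (hO : IsOracleFor F O K) {s : E d} (hs : ‖s‖ = 1) {L : List (E d)}
    (hL : L.Nodup) (hmem : ∀ x, x ∈ L ↔ x ∈ K.vertices) :
    ((O s 0).map Prod.fst).Perm (L.map fun x => inner ℝ s x) := by
  classical
  rw [List.perm_iff_count]
  intro c
  obtain ⟨l, hl, h⟩ := hO s hs
  have h1 := countP_apd_zero F hl (fun y => y = c)
  rw [← h, Multiset.coe_countP] at h1
  rw [List.count_eq_countP, List.count_eq_countP, List.countP_map, List.countP_map]
  have h2 : {σ ∈ K.faces | σ.card = 1 ∧ height s σ = c}.ncard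
      = {x ∈ K.vertices | inner ℝ s x = c}.ncard := by
    rw [← Set.ncard_image_of_injective _ (Finset.singleton_injective (α := E d))]
    congr 1
    ext σ
    constructor
    · rintro ⟨h1, h2, h3⟩
      obtain ⟨x, rfl⟩ := Finset.card_eq_one.1 h2
      exact ⟨x, ⟨h1, by rw [← height_singleton]; exact h3⟩, rfl⟩
    · rintro ⟨x, ⟨h1, h2⟩, rfl⟩
      exact ⟨h1, Finset.card_singleton x, by rw [height_singleton]; exact h2⟩
  have h3 : L.countP ((fun x => x == c) ∘ fun x => inner ℝ s x)
      = {x ∈ K.vertices | inner ℝ s x = c}.ncard := by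
    rw [List.countP_eq_length_filter, ← List.toFinset_card_of_nodup (hL.filter _),
      ← Set.ncard_coe_finset]
    congr 1
    ext x
    simp [hmem]
  rw [h3, ← h2, ← h1]
  refine List.countP_congr fun x _ => ?_
  simp

end Diagrams

/-! ### Vertices -/

section Vertices

variable {d : ℕ} {F : Type*} [Field F] {K : Geometry.SimplicialComplex ℝ (E d)} {O : Oracle d}

/-- `V` lists the vertices of `K` in ascending order of the coordinate `i₁`, with ascending
names. -/
structure IsVertexList (K : Geometry.SimplicialComplex ℝ (E d)) (i₁ : Fin d)
    (V : List (Vertex d)) : Prop where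
  ids : V.Pairwise fun v w => v.id < w.id
  sorted : V.Pairwise fun v w => v.pos i₁ < w.pos i₁
  mem : ∀ x, x ∈ V.map Vertex.pos ↔ x ∈ K.vertices

theorem IsVertexList.nodup {i₁ : Fin d} {V : List (Vertex d)} (hV : IsVertexList K i₁ V) :
    (V.map Vertex.pos).Nodup := by
  rw [List.Nodup, List.pairwise_map]
  exact hV.sorted.imp fun h h' => by rw [h'] at h; exact lt_irrefl _ h

theorem IsVertexList.length {i₁ : Fin d} {V : List (Vertex d)} (hV : IsVertexList K i₁ V) :
    V.length = K.vertices.ncard := by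
  classical
  rw [← List.length_map (f := Vertex.pos), ← List.toFinset_card_of_nodup hV.nodup,
    ← Set.ncard_coe_finset]
  congr 1
  ext x
  simp only [List.coe_toFinset]
  exact hV.mem x

theorem exists_sorted_vertices (hK : K.faces.Finite) {i₁ : Fin d}
    (hinj : ∀ x ∈ K.vertices, ∀ y ∈ K.vertices, x i₁ = y i₁ → x = y) :
    ∃ L : List (E d), L.Pairwise (fun x y => x i₁ < y i₁) ∧ (∀ x, x ∈ L ↔ x ∈ K.vertices) ∧
      L.length = K.vertices.ncard := by
  classical
  have hfin := vertices_finite hK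
  let r : E d → E d → Prop := fun x y => x i₁ ≤ y i₁
  have : Std.Total r := ⟨fun x y => le_total _ _⟩
  have : IsTrans (E d) r := ⟨fun x y z => le_trans⟩
  have hp := List.perm_insertionSort r hfin.toFinset.toList
  have hmem : ∀ x, x ∈ hfin.toFinset.toList.insertionSort r ↔ x ∈ K.vertices := fun x => by
    rw [hp.mem_iff]; simp
  have hnd : (hfin.toFinset.toList.insertionSort r).Nodup :=
    hp.nodup_iff.2 (Finset.nodup_toList _)
  refine ⟨hfin.toFinset.toList.insertionSort r, ?_, hmem, ?_⟩
  · refine List.Pairwise.imp_of_mem ?_ ((List.pairwise_insertionSort r _).and hnd)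
    intro x y hx hy h
    exact lt_of_le_of_ne h.1 fun h' => h.2 (hinj x ((hmem x).1 hx) y ((hmem y).1 hy) h')
  · rw [hp.length_eq, Finset.length_toList, Set.ncard_eq_toFinset_card _ hfin]

/-- This matches births to vertices. Weak monotonicity suffices, since a multiset of reals has only
one sorted listing. -/
theorem sorted_eq_map {H : List ℝ} {L : List (E d)} {f : E d → ℝ} (hp : H.Perm (L.map f))
    (hs : L.Pairwise fun x y => f x ≤ f y) : H.insertionSort (· ≤ ·) = L.map f :=
  ((List.perm_insertionSort _ H).trans hp).eq_of_pairwise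
    (fun _ _ _ _ => le_antisymm) (List.pairwise_insertionSort _ H) (List.pairwise_map.2 hs)

theorem spec_births (D : List Point) :
    Spec O (births D) (· = D.map Prod.fst) (D.length * 2) 0 :=
  (Spec.mapC (s := 1) (q := 0) Prod.fst fun a _ => Spec.op rfl).cost (by simp) (by simp)

/-- The tilted direction is a positive multiple of (1 - ε) e₁ + ε e_i and lists the vertices in the
order of e₁. The birth b matched to a vertex x is thus s₁ x₁ + s_i x_i, and since s_i > 0 this gives
x_i = (s₁ x₁ - b) / (-s_i). -/
theorem spec_findCoord (hO : IsOracleFor F O K) {i₁ i : Fin d} (hi : i ≠ i₁) {L : List (E d)}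
    (hL : L.Pairwise fun x y => x i₁ < y i₁) (hmem : ∀ x, x ∈ L ↔ x ∈ K.vertices) :
    Spec O (findCoord i₁ (EuclideanSpace.single i₁ 1) i (L.map fun x => x i₁))
      (· = L.map fun x => x i)
      (tiltCost d L.length + L.length * (L.length * 2 + 9) + d * 2 + 3) 2 := by
  have hnd : L.Nodup := hL.imp fun h h' => by rw [h'] at h; exact lt_irrefl _ h
  have hu : ∀ j : Fin d, ‖EuclideanSpace.single j (1 : ℝ)‖ = 1 := fun j => by simp
  have hperm := births_perm hO (hu i) hnd hmem
  have hlen : ((O (EuclideanSpace.single i 1) 0).map Prod.fst).length = L.length := by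
    rw [hperm.length_eq, List.length_map]
  have hlen0 : (O (EuclideanSpace.single i 1) 0).length = L.length := by
    rw [← hlen, List.length_map]
  refine Spec.cost (s := d * 2 + (1 + (L.length * 2 + (tiltCost d L.length + (1 + (L.length * 2 +
    (L.length * (L.length * 2 + 1) + (1 + L.length * (1 + (1 + 1) + 1)))))))))
    (q := 0 + (1 + (0 + (0 + (1 + (0 + (0 + (0 + 0))))))))
    (Spec.bind_eq (spec_basisVec i) (Spec.bind_eq (Spec.query _) (Spec.bind_eq
      ((spec_births _).cost (by rw [hlen0]) le_rfl) (Spec.bind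
        ((spec_tilt _ _ _ _).cost (by rw [hlen, List.length_map, max_self]) le_rfl)
        fun s hs => Spec.bind_eq (Spec.query s) ?_)))) (by ring_nf; omega) (by omega)
  obtain ⟨ε, hε0, hε1, hord, -, rfl⟩ := hs
  set u := (1 - ε) • EuclideanSpace.single i₁ (1 : ℝ) + ε • EuclideanSpace.single i (1 : ℝ) with hu'
  have hui : u i = ε := by simp [u, hi]
  have hui₁ : u i₁ = 1 - ε := by simp [u, hi.symm]
  have hu0 : u ≠ 0 := fun h => by
    rw [h] at hui
    exact hε0.ne hui
  have hpos : 0 < ‖u‖⁻¹ := inv_pos.2 (norm_pos_iff.2 hu0)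
  have hinner : ∀ x : E d, inner ℝ (‖u‖⁻¹ • u) x = ‖u‖⁻¹ * ((1 - ε) * x i₁ + ε * x i) := fun x => by
    rw [real_inner_smul_left, hu', inner_add_left, real_inner_smul_left, real_inner_smul_left,
      EuclideanSpace.inner_single_left, EuclideanSpace.inner_single_left]
    simp
  have hperm' := births_perm hO (norm_inv_smul_self hu0) hnd hmem
  have hlen' : (O (‖u‖⁻¹ • u) 0).length = L.length := by
    rw [← List.length_map (f := Prod.fst), hperm'.length_eq, List.length_map]
  have hin : ∀ x ∈ L, x i ∈ (O (EuclideanSpace.single i 1) 0).map Prod.fst := fun x hx => by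
    rw [hperm.mem_iff]
    exact List.mem_map.2 ⟨x, hx, by simp [EuclideanSpace.inner_single_left]⟩
  have hsort := sorted_eq_map hperm' (hL.imp_of_mem fun {x y} hx hy hxy => by
    rw [hinner, hinner]
    exact mul_le_mul_of_nonneg_left (hord _ (List.mem_map.2 ⟨x, hx, rfl⟩) _
      (List.mem_map.2 ⟨y, hy, rfl⟩) hxy _ (hin x hx) _ (hin y hy)).le hpos.le)
  refine Spec.bind_eq ((spec_births _).cost (by rw [hlen']) le_rfl) (Spec.bind_eq
    ((spec_sortReals _).cost (by rw [List.length_map, hlen']) le_rfl) (Spec.bind_op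
      ((Spec.zipC (s := 1 + (1 + 1)) (q := 0)
        (fun a b => ((‖u‖⁻¹ • u) i₁ * a - b) / (-((‖u‖⁻¹ • u) i)))
        fun a b => Spec.bind_op (Spec.bind_op (Spec.op rfl))).mono ?_ (by simp) (by simp))))
  rintro _ rfl
  rw [hsort, List.zipWith_map, List.zipWith_self]
  refine List.map_congr_left fun x _ => ?_
  rw [hinner, PiLp.smul_apply, PiLp.smul_apply, hui, hui₁, smul_eq_mul, smul_eq_mul,
    div_eq_iff (neg_ne_zero.2 (mul_pos hpos hε0).ne')]
  ring

theorem spec_findVertices (hK : K.faces.Finite) (hO : IsOracleFor F O K) {i₁ : Fin d}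
    (hinj : ∀ x ∈ K.vertices, ∀ y ∈ K.vertices, x i₁ = y i₁ → x = y)
    (h0 : 1 ≤ K.vertices.ncard) :
    Spec O (findVertices i₁) (fun VD => IsVertexList K i₁ VD.1 ∧
      VD.2 = O (EuclideanSpace.single i₁ 1))
      (100 * (d * K.vertices.ncard ^ 2 + d ^ 2)) (1 + d * 2) := by
  obtain ⟨L, hL, hmem, hlen⟩ := exists_sorted_vertices hK hinj
  have hd : 1 ≤ d := i₁.pos
  rw [← hlen] at h0 ⊢
  have hnd : L.Nodup := hL.imp fun h h' => by rw [h'] at h; exact lt_irrefl _ h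
  have hu : ‖EuclideanSpace.single i₁ (1 : ℝ)‖ = 1 := by simp
  have hperm := births_perm hO hu hnd hmem
  have hlen0 : (O (EuclideanSpace.single i₁ 1) 0).length = L.length := by
    rw [← List.length_map (f := Prod.fst), hperm.length_eq, List.length_map]
  have hperm' : ((O (EuclideanSpace.single i₁ 1) 0).map Prod.fst).Perm (L.map fun x => x i₁) := by
    convert hperm using 3 with x
    simp [EuclideanSpace.inner_single_left]
  have hsort := sorted_eq_map hperm' (hL.imp fun h => h.le)
  have hfold : Spec O (foldC (fun X i => do
      let t ← op (decide (i = i₁))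
      if t then pure X
      else do
        let C ← findCoord i₁ (EuclideanSpace.single i₁ 1) i (L.map fun x => x i₁)
        zipC (fun x c => op (WithLp.toLp 2 (Function.update (WithLp.ofLp x) i c))) X C)
      (L.map fun x => WithLp.toLp 2 fun j => if j = i₁ then x i₁ else 0) (List.finRange d))
      (· = L) (d * (1 + (tiltCost d L.length + L.length * (L.length * 2 + 9) + d * 2 + 3 +
        L.length * 2) + 1)) (d * 2) := by
    -- Invariant: the coordinate i₁ and the coordinates in `pre` are correct, and all others are
    -- still 0.
    refine (Spec.foldC (q := 2) (s := 1 + (tiltCost d L.length + L.length * (L.length * 2 + 9) +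
        d * 2 + 3 + L.length * 2))
      (fun pre X => X = L.map fun x => WithLp.toLp 2 fun j =>
        if j = i₁ ∨ j ∈ pre then x j else 0) ?_ ?_).mono ?_ (by simp) (by simp)
    · refine List.map_congr_left fun x _ => ?_
      congr 1
      funext j
      by_cases h : j = i₁ <;> simp [h]
    · rintro pre i suf X hl rfl
      refine Spec.bind_op (Spec.ite (fun ht => Spec.pure' ?_) fun ht =>
        Spec.bind_eq (q := 2) (q' := 0) (spec_findCoord hO (by simpa using ht) hL hmem)
          ((Spec.zipC (s := 1) (q := 0)
            (fun x c => WithLp.toLp 2 (Function.update (WithLp.ofLp x) i c))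
            fun a b => Spec.op rfl).mono ?_ (by simp) (by simp)))
      · rw [decide_eq_true_eq] at ht
        refine List.map_congr_left fun x _ => ?_
        congr 1
        funext j
        refine if_congr ?_ rfl rfl
        rw [List.mem_append, List.mem_singleton, ht]
        tauto
      · rintro _ rfl
        rw [List.zipWith_map, List.zipWith_self]
        refine List.map_congr_left fun x _ => ?_
        congr 1
        funext j
        rw [Function.update_apply]
        by_cases hj : j = i
        · simp [hj]
        · simp [hj]
    · rintro _ rfl
      refine (List.map_congr_left fun x _ => ?_).trans (List.map_id L)
      ext j
      simp
  have hV : IsVertexList K i₁ (L.zipIdx.map fun p => Vertex.mk p.2 p.1) := by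
    have hpos : (L.zipIdx.map fun p => Vertex.mk p.2 p.1).map Vertex.pos = L := by
      rw [List.map_map]
      exact List.zipIdx_map_fst 0 L
    have hid : (L.zipIdx.map fun p => Vertex.mk p.2 p.1).map Vertex.id = List.range' 0 L.length := by
      rw [List.map_map]
      exact List.zipIdx_map_snd 0 L
    refine ⟨?_, ?_, fun x => by rw [hpos]; exact hmem x⟩
    · rw [← List.pairwise_map (f := Vertex.id) (R := (· < ·)), hid]
      exact List.pairwise_lt_range'
    · rw [← List.pairwise_map (f := Vertex.pos) (R := fun x y : E d => x i₁ < y i₁), hpos]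
      exact hL
  refine Spec.cost (s := d * 2 + (1 + (L.length * 2 + (L.length * (L.length * 2 + 1) +
    (L.length * (d * 2 + 1) + (d * (1 + (tiltCost d L.length + L.length * (L.length * 2 + 9) +
      d * 2 + 3 + L.length * 2) + 1) + (L.length * 2 + 0)))))))
    (q := 0 + (1 + (0 + (0 + (0 + (d * 2 + (0 + 0)))))))
    (Spec.bind_eq (spec_basisVec i₁) (Spec.bind_eq (Spec.query _) (Spec.bind_eq
      ((spec_births _).cost (by rw [hlen0]) le_rfl) (Spec.bind_eq
        ((spec_sortReals _).cost (by rw [List.length_map, hlen0]) le_rfl) ?_))))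
    ?_ (by omega)
  · rw [hsort]
    refine Spec.bind_eq ((Spec.mapC (s := d * 2) (q := 0)
      (fun h => WithLp.toLp 2 fun j => if j = i₁ then h else 0) fun a _ =>
        Spec.vecC (s := 1) _ fun j => Spec.op rfl).cost (by simp) (by simp)) (Spec.bind_eq (a := L) ?_
        (Spec.bind_eq ((Spec.mapC (s := 1) (q := 0) (fun p : E d × ℕ => Vertex.mk p.2 p.1)
          fun a _ => Spec.op rfl).cost (by simp) (by simp)) (Spec.pure ⟨hV, rfl⟩)))
    rw [List.map_map]
    exact hfold
  · rw [tiltCost]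
    generalize L.length = n at h0
    have h1 : d ≤ d * n ^ 2 := Nat.le_mul_of_pos_right d (by positivity)
    have h2 : d * n ≤ d * n ^ 2 := by nlinarith [Nat.mul_le_mul_left (d * n) h0]
    have h3 : n ≤ d * n ^ 2 := by nlinarith [Nat.mul_le_mul_right n hd]
    have h4 : n ^ 2 ≤ d * n ^ 2 := Nat.le_mul_of_pos_left _ hd
    nlinarith

end Vertices
/-! ### Lists of vertices and their faces -/

section Faces

variable {d : ℕ} {K : Geometry.SimplicialComplex ℝ (E d)} {i₁ : Fin d} {V : List (Vertex d)}

open scoped Classical in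
/-- The set of the positions of the vertices of a simplex. -/
def pts (σ : Simplex d) : Finset (E d) := (σ.map Vertex.pos).toFinset

theorem mem_pts {σ : Simplex d} {x : E d} : x ∈ pts σ ↔ ∃ v ∈ σ, v.pos = x := by
  simp [pts]

theorem pos_mem_pts {σ : Simplex d} {v : Vertex d} (h : v ∈ σ) : v.pos ∈ pts σ :=
  mem_pts.2 ⟨v, h, rfl⟩

theorem IsVertexList.pos_mem (hV : IsVertexList K i₁ V) {v : Vertex d} (h : v ∈ V) :
    v.pos ∈ K.vertices := (hV.mem _).1 (List.mem_map_of_mem h)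

theorem IsVertexList.exists_mem (hV : IsVertexList K i₁ V) {x : E d} (h : x ∈ K.vertices) :
    ∃ v ∈ V, v.pos = x := by simpa using (hV.mem x).2 h

theorem eq_of_pairwise_lt {α : Type*} {l : List α} {f : α → ℝ}
    (h : l.Pairwise fun v w => f v < f w) {v w : α} (hv : v ∈ l) (hw : w ∈ l) (e : f v = f w) :
    v = w := by
  by_contra hne
  have := List.Pairwise.forall_of_forall_of_flip (R := fun v w => f v = f w → v = w)
    (fun _ _ _ => rfl) (h.imp fun h e => absurd e h.ne)
    (h.imp fun h e => absurd e h.ne') hv hw e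
  exact hne this

theorem IsVertexList.pos_inj (hV : IsVertexList K i₁ V) {v w : Vertex d} (hv : v ∈ V) (hw : w ∈ V)
    (h : v.pos = w.pos) : v = w :=
  eq_of_pairwise_lt hV.sorted hv hw (by rw [h])

theorem IsVertexList.id_inj (hV : IsVertexList K i₁ V) {v w : Vertex d} (hv : v ∈ V) (hw : w ∈ V)
    (h : v.id = w.id) : v = w :=
  eq_of_pairwise_lt (f := fun v => (v.id : ℝ)) (hV.ids.imp fun h => Nat.cast_lt.2 h) hv hw
    (by rw [h])

/-- `σ` lists vertices from `V`, in ascending order of names. -/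
structure IsVertexSubset (V : List (Vertex d)) (σ : Simplex d) : Prop where
  ids : σ.Pairwise fun v w => v.id < w.id
  mem : ∀ v ∈ σ, v ∈ V

theorem IsVertexSubset.sublist {σ τ : Simplex d} (h : IsVertexSubset V σ) (hτ : τ.Sublist σ) :
    IsVertexSubset V τ := ⟨h.ids.sublist hτ, fun v hv => h.mem v (hτ.subset hv)⟩

theorem IsVertexSubset.nodup {σ : Simplex d} (h : IsVertexSubset V σ) : σ.Nodup :=
  h.ids.imp fun h h' => by rw [h'] at h; exact lt_irrefl _ h

theorem IsVertexSubset.nodup_pos (hV : IsVertexList K i₁ V) {σ : Simplex d}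
    (h : IsVertexSubset V σ) : (σ.map Vertex.pos).Nodup :=
  (List.nodup_map_iff_inj_on h.nodup).2 fun _ hx _ hy e => hV.pos_inj (h.mem _ hx) (h.mem _ hy) e

theorem IsVertexSubset.card_pts (hV : IsVertexList K i₁ V) {σ : Simplex d}
    (h : IsVertexSubset V σ) : (pts σ).card = σ.length := by
  classical
  rw [pts, List.toFinset_card_of_nodup (h.nodup_pos hV), List.length_map]

theorem IsVertexSubset.mem_iff (hV : IsVertexList K i₁ V) {σ : Simplex d}
    (h : IsVertexSubset V σ) {v : Vertex d} (hv : v ∈ V) : v.pos ∈ pts σ ↔ v ∈ σ := by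
  refine ⟨fun hx => ?_, pos_mem_pts⟩
  obtain ⟨w, hw, e⟩ := mem_pts.1 hx
  rwa [← hV.pos_inj (h.mem w hw) hv e]

theorem IsVertexSubset.ext {σ τ : Simplex d} (hσ : IsVertexSubset V σ) (hτ : IsVertexSubset V τ)
    (h : ∀ v, v ∈ σ ↔ v ∈ τ) : σ = τ :=
  ((List.perm_ext_iff_of_nodup hσ.nodup hτ.nodup).2 h).eq_of_pairwise
    (fun _ _ _ _ h1 h2 => absurd h1 h2.not_gt) hσ.ids hτ.ids

theorem IsVertexSubset.eq_of_pts (hV : IsVertexList K i₁ V) {σ τ : Simplex d}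
    (hσ : IsVertexSubset V σ) (hτ : IsVertexSubset V τ) (h : pts σ = pts τ) : σ = τ :=
  hσ.ext hτ fun v => ⟨fun hv => (hτ.mem_iff hV (hσ.mem v hv)).1 (h ▸ pos_mem_pts hv),
    fun hv => (hσ.mem_iff hV (hτ.mem v hv)).1 (h ▸ pos_mem_pts hv)⟩

theorem IsVertexSubset.eq_of_ids (hV : IsVertexList K i₁ V) {σ τ : Simplex d}
    (hσ : IsVertexSubset V σ) (hτ : IsVertexSubset V τ)
    (h : σ.map Vertex.id = τ.map Vertex.id) : σ = τ := by
  refine hσ.ext hτ fun v => ⟨fun hv => ?_, fun hv => ?_⟩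
  · have := List.mem_map_of_mem (f := Vertex.id) hv
    rw [h] at this
    obtain ⟨w, hw, e⟩ := List.mem_map.1 this
    rwa [← hV.id_inj (hτ.mem w hw) (hσ.mem v hv) e]
  · have := List.mem_map_of_mem (f := Vertex.id) hv
    rw [← h] at this
    obtain ⟨w, hw, e⟩ := List.mem_map.1 this
    rwa [← hV.id_inj (hσ.mem w hw) (hτ.mem v hv) e]

theorem pts_subset {σ τ : Simplex d} (h : τ.Sublist σ) : pts τ ⊆ pts σ := fun x hx => by
  obtain ⟨v, hv, e⟩ := mem_pts.1 hx
  exact mem_pts.2 ⟨v, h.subset hv, e⟩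

theorem mem_properFaces {σ τ : Simplex d} :
    τ ∈ properFaces σ ↔ τ.Sublist σ ∧ 1 ≤ τ.length ∧ τ.length < σ.length := by
  simp only [properFaces, List.mem_flatMap, List.mem_range'_1, List.mem_sublistsLen]
  constructor
  · rintro ⟨j, hj, h, rfl⟩
    exact ⟨h, hj.1, by omega⟩
  · rintro ⟨h, h1, h2⟩
    exact ⟨τ.length, ⟨h1, by omega⟩, h, rfl⟩

/-- This order makes the memoization complete: when a face is reached, all of its proper faces have
been entered in the table. -/
theorem pairwise_properFaces (σ : Simplex d) :
    (properFaces σ).Pairwise fun ρ τ => ρ.length ≤ τ.length := by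
  rw [properFaces, List.pairwise_flatMap]
  refine ⟨fun j _ => ?_, ?_⟩
  · refine List.pairwise_of_forall_mem_list fun ρ hρ τ hτ => ?_
    rw [(List.mem_sublistsLen.1 hρ).2, (List.mem_sublistsLen.1 hτ).2]
  · refine List.Pairwise.imp (fun {i j} hij ρ hρ τ hτ => ?_) List.pairwise_lt_range'
    rw [(List.mem_sublistsLen.1 hρ).2, (List.mem_sublistsLen.1 hτ).2]
    exact hij.le

theorem nodup_properFaces {σ : Simplex d} (h : σ.Nodup) : (properFaces σ).Nodup := by
  rw [properFaces, List.nodup_flatMap]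
  refine ⟨fun j _ => List.nodup_sublistsLen j h, ?_⟩
  refine List.Pairwise.imp (fun {i j} hij ρ hρ hρ' => ?_) List.pairwise_lt_range'
  have h1 := (List.mem_sublistsLen.1 hρ).2
  have h2 := (List.mem_sublistsLen.1 hρ').2
  omega

open scoped Classical in
-- Sublists of a repetition-free list correspond to subsets of its points. This turns the sums
-- accumulated by the loop over faces into sums over nonempty subsets.
theorem sum_properFaces (hV : IsVertexList K i₁ V) {σ : Simplex d} (hσ : IsVertexSubset V σ)
    (hne : σ ≠ []) (g : Finset (E d) → ℕ) :
    ((properFaces σ).map fun τ => g (pts τ)).sum + g (pts σ)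
      = ∑ ρ ∈ (pts σ).powerset.erase ∅, g ρ := by
  have hcard := hσ.card_pts hV
  have hpos := List.length_pos_of_ne_nil hne
  have hmem : pts σ ∈ (pts σ).powerset.erase ∅ := by
    refine Finset.mem_erase.2 ⟨fun h => ?_, Finset.mem_powerset_self _⟩
    rw [h, Finset.card_empty] at hcard
    omega
  rw [← Finset.sum_erase_add _ _ hmem, ← List.sum_toFinset _ (nodup_properFaces hσ.nodup)]
  congr 1
  refine Finset.sum_nbij pts ?_ ?_ ?_ fun _ _ => rfl
  · intro τ hτ
    obtain ⟨h1, h2, h3⟩ := mem_properFaces.1 (List.mem_toFinset.1 hτ)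
    have hc := (hσ.sublist h1).card_pts hV
    refine Finset.mem_erase.2 ⟨fun h => ?_, Finset.mem_erase.2 ⟨fun h => ?_,
      Finset.mem_powerset.2 (pts_subset h1)⟩⟩
    · rw [h] at hc; omega
    · rw [h, Finset.card_empty] at hc; omega
  · intro τ hτ ρ hρ h
    obtain ⟨h1, -, -⟩ := mem_properFaces.1 (List.mem_toFinset.1 hτ)
    obtain ⟨h1', -, -⟩ := mem_properFaces.1 (List.mem_toFinset.1 hρ)
    exact (hσ.sublist h1).eq_of_pts hV (hσ.sublist h1') h
  · intro ρ hρ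
    obtain ⟨h1, h2⟩ := Finset.mem_erase.1 hρ
    obtain ⟨h2, h3⟩ := Finset.mem_erase.1 h2
    rw [Finset.mem_powerset] at h3
    have hsub : (σ.filter fun v => decide (v.pos ∈ ρ)).Sublist σ := List.filter_sublist
    have hp : pts (σ.filter fun v => decide (v.pos ∈ ρ)) = ρ := by
      ext x
      rw [mem_pts]
      constructor
      · rintro ⟨v, hv, rfl⟩
        simpa using (List.mem_filter.1 hv).2
      · intro hx
        obtain ⟨v, hv, rfl⟩ := mem_pts.1 (h3 hx)
        exact ⟨v, List.mem_filter.2 ⟨hv, by simpa using hx⟩, rfl⟩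
    have hc := (hσ.sublist hsub).card_pts hV
    rw [hp] at hc
    refine ⟨_, List.mem_toFinset.2 (mem_properFaces.2 ⟨hsub, ?_, ?_⟩), hp⟩
    · rw [← hc]
      exact Finset.card_pos.2 (Finset.nonempty_iff_ne_empty.2 h2)
    · rw [← hc, ← hcard]
      exact Finset.card_lt_card (Finset.ssubset_iff_subset_ne.2 ⟨h3, h1⟩)

theorem length_properFaces_lt (hV : IsVertexList K i₁ V) {σ : Simplex d}
    (hσ : IsVertexSubset V σ) (hne : σ ≠ []) : (properFaces σ).length + 1 ≤ 2 ^ σ.length := by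
  classical
  have h := sum_properFaces hV hσ hne (fun _ => 1)
  simp only [List.map_const', List.sum_replicate, smul_eq_mul, mul_one, Finset.sum_const] at h
  rw [h, ← hσ.card_pts hV, ← Finset.card_powerset]
  exact Finset.card_le_card (Finset.erase_subset _ _)

/-- The binomial theorem for (2 + 1)^|σ|. The left side counts the table accesses of the nested
calls, one for each face of each face. -/
theorem sum_two_pow_properFaces_le (hV : IsVertexList K i₁ V) {σ : Simplex d}
    (hσ : IsVertexSubset V σ) (hne : σ ≠ []) :
    ((properFaces σ).map fun τ => 2 ^ τ.length).sum ≤ 3 ^ σ.length := by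
  classical
  have h := sum_properFaces hV hσ hne (fun ρ => 2 ^ ρ.card)
  have h1 : ((properFaces σ).map fun τ => 2 ^ (pts τ).card)
      = (properFaces σ).map fun τ => 2 ^ τ.length :=
    List.map_congr_left fun τ hτ => by
      rw [(hσ.sublist (mem_properFaces.1 hτ).1).card_pts hV]
  rw [h1] at h
  have h2 := Finset.sum_pow_mul_eq_add_pow 2 1 (pts σ)
  simp only [one_pow, mul_one, Nat.reduceAdd] at h2
  have h3 : ∑ ρ ∈ (pts σ).powerset.erase ∅, 2 ^ ρ.card ≤ ∑ ρ ∈ (pts σ).powerset, 2 ^ ρ.card :=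
    Finset.sum_le_sum_of_subset (Finset.erase_subset _ _)
  rw [h2, hσ.card_pts hV] at h3
  exact (Nat.le_add_right _ _).trans (h.le.trans h3)

end Faces

/-! ### Counting cofaces below a height -/

section Cofaces

variable {d : ℕ} {K : Geometry.SimplicialComplex ℝ (E d)}

/-- The number of `k`-simplices that have the face `τ` and all of whose other vertices are
in `B`. -/
def cofaceCount (K : Geometry.SimplicialComplex ℝ (E d)) (k : ℕ) (B : Set (E d))
    (τ : Finset (E d)) : ℕ :=
  {ρ ∈ K.faces | ρ.card = k + 1 ∧ τ ⊆ ρ ∧ ∀ x ∈ ρ, x ∉ τ → x ∈ B}.ncard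

/-- The vertices of `K` at height `c` in direction `s` are those of `τ`, and the vertices below
height `c` are those in `B`. -/
def LevelAt (K : Geometry.SimplicialComplex ℝ (E d)) (s : E d) (c : ℝ) (τ : Finset (E d))
    (B : Set (E d)) : Prop :=
  ∀ x ∈ K.vertices, (x ∈ τ ↔ inner ℝ s x = c) ∧ (x ∈ B ↔ inner ℝ s x < c)

theorem height_eq_iff {s : E d} {σ : Finset (E d)} (hσ : σ.Nonempty) (c : ℝ) :
    height s σ = c ↔ (∀ x ∈ σ, inner ℝ s x ≤ c) ∧ ∃ x ∈ σ, inner ℝ s x = c := by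
  rw [height, dif_pos hσ]
  constructor
  · rintro rfl
    refine ⟨fun x hx => Finset.le_sup' (fun v => inner ℝ s v) hx, ?_⟩
    obtain ⟨x, hx, h⟩ := Finset.exists_mem_eq_sup' hσ fun v => inner ℝ s v
    exact ⟨x, hx, h.symm⟩
  · rintro ⟨h, x, hx, rfl⟩
    exact le_antisymm (Finset.sup'_le _ _ h) (Finset.le_sup' (fun v => inner ℝ s v) hx)

open scoped Classical in
-- Simplices of height c are sorted by their intersection with τ. It is nonempty because a highest
-- vertex has height c and so lies in τ; every other vertex lies below c and so in B.
theorem eventCount_eq_sum (hK : K.faces.Finite) {s : E d} {c : ℝ} {τ : Finset (E d)}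
    {B : Set (E d)} (h : LevelAt K s c τ B) (k : ℕ) :
    eventCount K s k c = ∑ ρ ∈ τ.powerset.erase ∅, cofaceCount K k B ρ := by
  have h1 : eventCount K s k c
      = (hK.toFinset.filter fun ρ => ρ.card = k + 1 ∧ height s ρ = c).card := by
    rw [eventCount, ← Set.ncard_coe_finset]
    congr 1
    ext ρ
    simp
  rw [h1, Finset.card_eq_sum_card_fiberwise (f := fun ρ => ρ ∩ τ) (t := τ.powerset.erase ∅)]
  · refine Finset.sum_congr rfl fun ρ hρ => ?_
    obtain ⟨hne, hsub⟩ := Finset.mem_erase.1 hρ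
    rw [Finset.mem_powerset] at hsub
    rw [cofaceCount, ← Set.ncard_coe_finset]
    congr 1
    ext f
    simp only [Finset.coe_filter, Finset.mem_filter, Set.Finite.mem_toFinset, Set.mem_ofPred_eq]
    constructor
    · rintro ⟨⟨hf, hc, hh⟩, rfl⟩
      refine ⟨hf, hc, Finset.inter_subset_left, fun x hx hx' => ?_⟩
      have hxv := h x (mem_vertices_of_mem_face hf hx)
      refine hxv.2.2 (lt_of_le_of_ne (((height_eq_iff (face_nonempty hf) c).1 hh).1 x hx) ?_)
      exact fun e => hx' (Finset.mem_inter.2 ⟨hx, hxv.1.2 e⟩)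
    · rintro ⟨hf, hc, h2, h3⟩
      refine ⟨⟨hf, hc, (height_eq_iff (face_nonempty hf) c).2 ⟨fun x hx => ?_, ?_⟩⟩, ?_⟩
      · have hxv := h x (mem_vertices_of_mem_face hf hx)
        by_cases hx' : x ∈ ρ
        · exact (hxv.1.1 (hsub hx')).le
        · exact (hxv.2.1 (h3 x hx hx')).le
      · obtain ⟨x, hx⟩ := Finset.nonempty_iff_ne_empty.2 hne
        exact ⟨x, h2 hx, (h x (mem_vertices_of_mem_face hf (h2 hx))).1.1 (hsub hx)⟩
      · ext x
        rw [Finset.mem_inter]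
        refine ⟨fun hx => ?_, fun hx => ⟨h2 hx, hsub hx⟩⟩
        by_contra hx'
        have hxv := h x (mem_vertices_of_mem_face hf hx.1)
        exact (hxv.2.1 (h3 x hx.1 hx')).ne (hxv.1.1 hx.2)
  · intro f hf
    simp only [Finset.coe_filter, Set.Finite.mem_toFinset, Set.mem_ofPred_eq] at hf
    obtain ⟨hf, -, hh⟩ := hf
    obtain ⟨x, hx, hxc⟩ := ((height_eq_iff (face_nonempty hf) c).1 hh).2
    refine Finset.mem_coe.2 (Finset.mem_erase.2 ⟨?_, Finset.mem_powerset.2 Finset.inter_subset_right⟩)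
    exact Finset.ne_empty_of_mem (Finset.mem_inter.2
      ⟨hx, (h x (mem_vertices_of_mem_face hf hx)).1.2 hxc⟩)

/-- `u` is a small perturbation of `s` towards `s'`: the order of the vertices at different heights
in direction `s` is kept, and vertices at equal heights are ordered as in direction `s'`. -/
def IsTilt (K : Geometry.SimplicialComplex ℝ (E d)) (s s' u : E d) : Prop :=
  ∀ x ∈ K.vertices, ∀ y ∈ K.vertices, (inner ℝ s x < inner ℝ s y → inner ℝ u x < inner ℝ u y) ∧
    (inner ℝ s x = inner ℝ s y → (inner ℝ s' x < inner ℝ s' y → inner ℝ u x < inner ℝ u y) ∧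
      (inner ℝ s' x = inner ℝ s' y → inner ℝ u x = inner ℝ u y))

/-- Vertices off the level stay on their side, ρ keeps a common height, and the rest of τ moves
above it. The set below the new level is therefore again B, whatever lifting direction was used;
this is what makes table entries reusable. -/
theorem LevelAt.tilt {s s' u : E d} {c : ℝ} {τ ρ : Finset (E d)} {B : Set (E d)}
    (h : LevelAt K s c τ B) (hu : IsTilt K s s' u) {p : E d} (hp : p ∈ ρ) (hρ : ρ ⊆ τ)
    (hτ : ∀ x ∈ τ, x ∈ K.vertices) (h1 : ∀ x ∈ ρ, inner ℝ s' x = inner ℝ s' p)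
    (h2 : ∀ x ∈ τ, x ∉ ρ → inner ℝ s' p < inner ℝ s' x) :
    LevelAt K u (inner ℝ u p) ρ B := by
  intro x hx
  have hpK := hτ p (hρ hp)
  have hpc := (h p hpK).1.1 (hρ hp)
  have hxv := h x hx
  have hxp := hu x hx p hpK
  have hpx := hu p hpK x hx
  rw [hpc] at hxp hpx
  rcases lt_trichotomy (inner ℝ s x) c with hlt | heq | hgt
  · have hl := hxp.1 hlt
    exact ⟨⟨fun hxρ => absurd (hxv.1.1 (hρ hxρ)) hlt.ne, fun e => absurd e hl.ne⟩,
      ⟨fun _ => hl, fun _ => hxv.2.2 hlt⟩⟩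
  · have hxτ := hxv.1.2 heq
    have hB : x ∉ B := fun hB => (hxv.2.1 hB).ne heq
    by_cases hxρ : x ∈ ρ
    · have e := (hxp.2 heq).2 (h1 x hxρ)
      exact ⟨⟨fun _ => e, fun _ => hxρ⟩, ⟨fun h => absurd h hB, fun h => absurd e h.ne⟩⟩
    · have hl := (hpx.2 heq.symm).1 (h2 x hxτ hxρ)
      exact ⟨⟨fun h => absurd h hxρ, fun e => absurd e hl.ne'⟩,
        ⟨fun h => absurd h hB, fun h => absurd h hl.not_gt⟩⟩
  · have hl := hpx.1 hgt
    exact ⟨⟨fun hxρ => absurd (hxv.1.1 (hρ hxρ)) hgt.ne', fun e => absurd e hl.ne'⟩,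
      ⟨fun h => absurd (hxv.2.1 h) hgt.not_gt, fun h => absurd h hl.not_gt⟩⟩

end Cofaces

/-! ### Indegrees -/

section Indegree

variable {d : ℕ} {F : Type*} [Field F] {K : Geometry.SimplicialComplex ℝ (E d)} {O : Oracle d}
  {i₁ : Fin d} {V : List (Vertex d)}

theorem spec_memC (v : Vertex d) (τ : Simplex d) :
    Spec O (memC v τ) (· = decide (∃ w ∈ τ, w.id = v.id)) (τ.length * 2) 0 := by
  refine Spec.cost (s := τ.length * (1 + 1)) (q := τ.length * 0) (Spec.foldC
    (fun (pre : Simplex d) t => t = decide (∃ w ∈ pre, w.id = v.id)) (by simp) ?_) le_rfl (by simp)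
  rintro pre w suf _ hl rfl
  refine Spec.op ?_
  rw [Bool.eq_iff_iff]
  simp [or_and_right, exists_or]

theorem spec_heightsC (V : List (Vertex d)) (s : E d) :
    Spec O (heightsC V s) (· = V.map fun v => inner ℝ s v.pos) (V.length * (d * 2 + 1)) 0 :=
  (Spec.mapC (s := d * 2) (q := 0) _ fun a _ => spec_dot s a.pos).cost (by simp) (by simp)

/-- An upper bound for the number of steps of `tiltV` with `m` vertices. -/
def tiltVCost (d m : ℕ) : ℕ := m * (d * 4 + 2) + tiltCost d m

/-- The hypothesis `hne` keeps the tilt from being zero. For unit vectors (1 - ε) s + ε s' = 0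
forces ε = 1/2, which is impossible if s' = s, and also if s' separates two vertices, as then ε <
1/2. -/
theorem spec_tiltV (hV : IsVertexList K i₁ V) {s s' : E d} (hs : ‖s‖ = 1) (hs' : ‖s'‖ = 1)
    (hne : s' = s ∨ ∃ x ∈ K.vertices, ∃ y ∈ K.vertices, inner ℝ s' x < inner ℝ s' y) :
    Spec O (tiltV V s s') (fun u => ‖u‖ = 1 ∧ IsTilt K s s' u)
      (tiltVCost d K.vertices.ncard) 0 := by
  rw [← hV.length]
  refine Spec.cost (q := 0) (s := V.length * (d * 2 + 1) + (V.length * (d * 2 + 1) +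
    tiltCost d V.length)) (Spec.bind_eq (q := 0) (q' := 0) (spec_heightsC V s)
    (Spec.bind_eq (q := 0) (q' := 0) (spec_heightsC V s') ((spec_tilt _ _ s s').mono ?_ ?_ le_rfl)))
    ?_ le_rfl
  · rintro _ ⟨ε, hε0, hε1, hord, hlt, rfl⟩
    have hmem : ∀ t : E d, ∀ x ∈ K.vertices, inner ℝ t x ∈ V.map fun v => inner ℝ t v.pos := by
      intro t x hx
      obtain ⟨v, hv, rfl⟩ := hV.exists_mem hx
      exact List.mem_map.2 ⟨v, hv, rfl⟩
    have hu0 : (1 - ε) • s + ε • s' ≠ 0 := by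
      intro h0
      rcases hne with rfl | ⟨x, hx, y, hy, hxy⟩
      · rw [← add_smul, sub_add_cancel, one_smul] at h0
        rw [h0, norm_zero] at hs
        exact zero_ne_one hs
      · have hε2 := hlt _ (hmem s' x hx) _ (hmem s' y hy) hxy
        have h1 : (1 - ε) • s = -(ε • s') := eq_neg_of_add_eq_zero_left h0
        have h2 := congrArg norm h1
        rw [norm_neg, norm_smul, norm_smul, hs, hs', Real.norm_of_nonneg (by linarith),
          Real.norm_of_nonneg hε0.le] at h2
        linarith
    refine ⟨norm_inv_smul_self hu0, fun x hx y hy => ?_⟩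
    have hpos : 0 < ‖(1 - ε) • s + ε • s'‖⁻¹ := inv_pos.2 (norm_pos_iff.2 hu0)
    have hin : ∀ z : E d, inner ℝ (‖(1 - ε) • s + ε • s'‖⁻¹ • ((1 - ε) • s + ε • s')) z
        = ‖(1 - ε) • s + ε • s'‖⁻¹ * ((1 - ε) * inner ℝ s z + ε * inner ℝ s' z) := fun z => by
      rw [real_inner_smul_left, inner_add_left, real_inner_smul_left, real_inner_smul_left]
    rw [hin, hin]
    refine ⟨fun h => mul_lt_mul_of_pos_left (hord _ (hmem s x hx) _ (hmem s y hy) h _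
      (hmem s' x hx) _ (hmem s' y hy)) hpos, fun h => ⟨fun h' => ?_, fun h' => by rw [h, h']⟩⟩
    rw [h]
    exact mul_lt_mul_of_pos_left (by linarith [mul_lt_mul_of_pos_left h' hε0]) hpos
  · rw [List.length_map, List.length_map, max_self]
  · rw [tiltVCost]
    exact le_of_eq (by ring)

/-- An upper bound for the number of steps of an indegree computation for which all proper faces of
the simplex with `m` vertices are in the table. -/
def memoCost (d N k m : ℕ) : ℕ := d * 2 + N * 6 + 3 + 2 ^ m * (k * 2 + 4)

theorem headD_pos {v : Vertex d} {σ : Simplex d} :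
    (((v :: σ : Simplex d)).map Vertex.pos).headD 0 = v.pos := rfl

/-- With all proper faces in the table there is no further recursion: one query gives the total, and
the decomposition by faces is solved for the term of σ. -/
theorem spec_computeIndegree_of_memo (hK : K.faces.Finite) (hO : IsOracleFor F O K)
    (hV : IsVertexList K i₁ V) {σ : Simplex d} (hσ : IsVertexSubset V σ) (hne : σ ≠ []) {s : E d}
    (hs : ‖s‖ = 1) {c : ℝ} {B : Set (E d)} (hlev : LevelAt K s c (pts σ) B) {k : ℕ}
    (hk : 1 ≤ k) (hσk : σ.length ≤ k) {T : Table}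
    (hT : ∀ τ ∈ properFaces σ, T (τ.map Vertex.id) = some (cofaceCount K k B (pts τ) : ℤ))
    (fuel : ℕ) :
    Spec O (computeIndegree V (fuel + 1) σ s k T)
      (· = ((cofaceCount K k B (pts σ) : ℤ), T)) (memoCost d K.faces.ncard k σ.length) 1 := by
  classical
  obtain ⟨v, σ', rfl⟩ := List.exists_cons_of_ne_nil hne
  have hc : inner ℝ s v.pos = c :=
    (hlev _ (hV.pos_mem (hσ.mem v (by simp)))).1.1 (pos_mem_pts (by simp))
  have hlen := length_properFaces_lt hV hσ hne
  refine Spec.cost (q := 1 + (0 + (0 + (0 + 0)))) (s := 1 + (d * 2 + ((K.faces.ncard * 6 + 1) +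
    ((properFaces (v :: σ')).length * ((v :: σ').length + 1 + (k + 1 + (1 + 0)) + 1)
      + (1 + 0))))) (Spec.bind_eq (Spec.query s) (Spec.bind_eq (spec_dot s _) ?_)) ?_ le_rfl
  · rw [headD_pos, hc]
    refine Spec.bind_eq (spec_eventsAt hK hO hs hk c) (Spec.bind_eq
      (a := (((properFaces (v :: σ')).map fun τ => (cofaceCount K k B (pts τ) : ℤ)).sum, T)) ?_
      (Spec.bind_op (Spec.pure ?_)))
    · refine (Spec.foldC (q := 0) (s := (v :: σ').length + 1 + (k + 1 + (1 + 0)))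
        (fun pre (r : ℤ × Table) =>
          r = ((pre.map fun τ => (cofaceCount K k B (pts τ) : ℤ)).sum, T)) rfl ?_).cost
          le_rfl (by simp)
      rintro pre τ suf _ hl rfl
      refine Spec.bind_charge (Spec.bind_charge ?_)
      dsimp only
      rw [hT τ (by simp [hl])]
      refine Spec.bind_op (Spec.pure ?_)
      simp
    · have h1 := eventCount_eq_sum hK hlev k
      rw [← sum_properFaces hV hσ hne] at h1
      rw [h1]
      push_cast
      simp [Function.comp_def]
  · rw [memoCost]
    have : (properFaces (v :: σ')).length * ((v :: σ').length + 1 + (k + 1 + (1 + 0)) + 1)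
        ≤ 2 ^ (v :: σ').length * (k * 2 + 4) :=
      Nat.mul_le_mul (by omega) (by omega)
    omega

/-- An upper bound for the number of steps that an indegree computation for a simplex with `m`
vertices spends on one proper face, apart from reading the table for its faces. -/
def faceCost (d N n k m : ℕ) : ℕ :=
  m * (m * 2 + 8) + k * 2 + liftCost d m + tiltVCost d n + d * 2 + N * 6 + 8

/-- An upper bound for the number of steps of an indegree computation for a simplex with `m`
vertices. -/
def indegreeCost (d N n k m : ℕ) : ℕ := 2 ^ m * faceCost d N n k m + 3 ^ m * (k * 2 + 4)

theorem liftCost_mono {d m m' : ℕ} (h : m ≤ m') : liftCost d m ≤ liftCost d m' := by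
  unfold liftCost
  gcongr

/-- A direction that is constant on `τ` and larger on the other vertices of `σ`. -/
def IsLifting (τ σ : Simplex d) (s : E d) : Prop :=
  (∀ v ∈ τ, ∀ w ∈ τ, inner ℝ s v.pos = inner ℝ s w.pos) ∧
    ∀ v ∈ τ, ∀ w ∈ σ, w ∉ τ → inner ℝ s v.pos < inner ℝ s w.pos

theorem spec_liftingDir_faces (hV : IsVertexList K i₁ V) {σ τ X : Simplex d} {A : Set (E d)}
    (hA : AffineIndependent ℝ ((↑) : A → E d)) (hAσ : ∀ v ∈ τ ++ X, v ∈ V ∧ v.pos ∈ A)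
    (hnd : (τ ++ X).Nodup) (hτ : τ ≠ []) (hX : X ≠ []) (hσ : ∀ w ∈ σ, w ∉ τ → w ∈ X) {m : ℕ}
    (hm : τ.length + X.length ≤ m) :
    Spec O (liftingDir (τ.map Vertex.pos) (X.map Vertex.pos))
      (fun s => ‖s‖ = 1 ∧ IsLifting τ σ s) (liftCost d m) 0 := by
  obtain ⟨v, τ', rfl⟩ := List.exists_cons_of_ne_nil hτ
  have hind : IndepFrom v.pos (τ'.map Vertex.pos ++ X.map Vertex.pos) := by
    refine indepFrom_of_affineIndependent hA ?_ ?_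
    · intro x hx
      rw [← List.map_append, ← List.map_cons] at hx
      obtain ⟨w, hw, rfl⟩ := List.mem_map.1 hx
      exact (hAσ w hw).2
    · rw [← List.map_append, ← List.map_cons]
      exact (List.nodup_map_iff_inj_on hnd).2 fun x hx y hy e =>
        hV.pos_inj (hAσ x hx).1 (hAσ y hy).1 e
  refine (spec_liftingDir hind (by simpa using hX)).mono ?_ (liftCost_mono ?_) le_rfl
  · rintro s ⟨h1, h2, h3⟩
    have h2' : ∀ w ∈ v :: τ', inner ℝ s w.pos = inner ℝ s v.pos := by
      intro w hw
      rcases List.mem_cons.1 hw with rfl | hw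
      · rfl
      · exact h2 _ (List.mem_map_of_mem hw)
    refine ⟨h1, fun x hx y hy => (h2' x hx).trans (h2' y hy).symm, fun x hx w hw hwτ => ?_⟩
    rw [h2' x hx]
    exact h3 _ (List.mem_map_of_mem (hσ w hw hwτ))
  · simp only [List.length_map, List.length_cons] at hm ⊢
    omega

/-- Loop invariant: the processed faces are in the table, and every entry for a face of σ is the
coface count with respect to the one fixed set B. Since faces come in order of dimension, each
nested call meets a complete table and makes a single query. -/
theorem spec_indegree (hK : K.faces.Finite) (hO : IsOracleFor F O K)
    (hV : IsVertexList K i₁ V) {σ : Simplex d} (hσ : IsVertexSubset V σ) (hface : pts σ ∈ K.faces)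
    {s : E d} (hs : ‖s‖ = 1) {c : ℝ} {B : Set (E d)} (hlev : LevelAt K s c (pts σ) B) {k : ℕ}
    (hk : 1 ≤ k) (hσk : σ.length ≤ k) :
    Spec O (indegree V σ s k) (· = (cofaceCount K k B (pts σ) : ℤ))
      (indegreeCost d K.faces.ncard K.vertices.ncard k σ.length) (2 ^ σ.length) := by
  classical
  have hne : σ ≠ [] := by
    rintro rfl
    exact (face_nonempty hface).ne_empty rfl
  have hlen := length_properFaces_lt hV hσ hne
  have hsum := sum_two_pow_properFaces_le hV hσ hne
  set m := σ.length with hm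
  have hm1 : 1 ≤ m := List.length_pos_of_ne_nil hne
  have hc : inner ℝ s ((σ.map Vertex.pos).headD 0) = c := by
    obtain ⟨v, σ', rfl⟩ := List.exists_cons_of_ne_nil hne
    exact (hlev _ (hV.pos_mem (hσ.mem v (by simp)))).1.1 (pos_mem_pts (by simp))
  have hverts : ∀ x ∈ pts σ, x ∈ K.vertices := fun x hx => mem_vertices_of_mem_face hface hx
  set N := K.faces.ncard
  set n := K.vertices.ncard
  let stepCost : Simplex d → ℕ := fun τ => m + 1 + (k + 1 + (m * (m * 2 + 1 + 2) + (m * 2 + (m * 2 +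
    (liftCost d m + (tiltVCost d n + (memoCost d N k τ.length + (k + 1 + (1 + 0)))))))))
  suffices h : Spec O (computeIndegree V (m - 1 + 1) σ s k (fun _ => none))
      (fun r => r.1 = (cofaceCount K k B (pts σ) : ℤ))
      (1 + (d * 2 + ((N * 6 + 1) + (((properFaces σ).map fun τ => stepCost τ + 1).sum + (1 + 0)))))
      (1 + (0 + (0 + (((properFaces σ).map fun _ => 1).sum + 0)))) by
    rw [Nat.sub_add_cancel hm1] at h
    refine (h.bind (s' := 0) (q' := 0) fun r hr => Spec.pure hr).cost ?_ ?_
    -- A face τ costs `faceCost` plus 2^|τ| table accesses, which sum to the powers of 2 and 3 in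
    -- `indegreeCost`. The steps for σ itself fit into the share left over because σ has at most 2^m
    -- - 1 proper faces.
    · have e : (fun τ : Simplex d => stepCost τ + 1)
          = fun τ => (faceCost d N n k m) + 2 ^ τ.length * (k * 2 + 4) := by
        funext τ
        simp only [stepCost, faceCost, memoCost]
        ring
      rw [e, List.sum_map_add, List.sum_map_mul_right, List.map_const', List.sum_replicate,
        smul_eq_mul, indegreeCost]
      have h1 : d * 2 + N * 6 + 3 ≤ faceCost d N n k m := by rw [faceCost]; omega
      have h2 := Nat.mul_le_mul_right (faceCost d N n k m) hlen
      have h3 := Nat.mul_le_mul_right (k * 2 + 4) hsum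
      rw [add_mul, one_mul] at h2
      omega
    · simp only [List.map_const', List.sum_replicate, smul_eq_mul, mul_one]
      omega
  refine Spec.bind_eq (Spec.query s) (Spec.bind_eq (spec_dot s _) ?_)
  rw [hc]
  refine Spec.bind_eq (spec_eventsAt hK hO hs hk c) (Spec.bind
    (P := fun r => r.1 = ((properFaces σ).map fun τ => (cofaceCount K k B (pts τ) : ℤ)).sum) ?_
    fun r hr => Spec.bind_op (Spec.pure ?_))
  · refine (Spec.foldC_sum (fun pre (r : ℤ × Table) =>
        r.1 = (pre.map fun τ => (cofaceCount K k B (pts τ) : ℤ)).sum ∧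
        (∀ τ ∈ pre, r.2 (τ.map Vertex.id) = some (cofaceCount K k B (pts τ) : ℤ)) ∧
        ∀ τ ∈ properFaces σ, ∀ x, r.2 (τ.map Vertex.id) = some x →
          x = (cofaceCount K k B (pts τ) : ℤ))
        stepCost (fun _ => 1) ⟨rfl, by simp, by simp⟩ ?_).imp fun r hr => hr.1
    rintro pre τ suf ⟨z, T⟩ hl ⟨hz, hpre, hval⟩
    dsimp only at hz hpre hval
    have hτ : τ ∈ properFaces σ := by simp [hl]
    obtain ⟨hτσ, hτ1, hτm⟩ := mem_properFaces.1 hτ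
    have hτsub := hσ.sublist hτσ
    have hτne : τ ≠ [] := List.ne_nil_of_length_pos hτ1
    refine Spec.bind_charge (Spec.bind_charge ?_)
    dsimp only
    cases hTτ : T (τ.map Vertex.id) with
    | some x =>
      have hx := hval τ hτ x hTτ
      dsimp only
      refine Spec.cost (s := 1 + 0) (q := 0) (Spec.bind_op (Spec.pure ?_)) (by omega) (by omega)
      refine ⟨by simp [hz, hx], fun ρ hρ => ?_, hval⟩
      rcases List.mem_append.1 hρ with hρ | hρ
      · exact hpre ρ hρ
      · rw [List.mem_singleton.1 hρ, ← hx]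
        exact hTτ
    | none =>
      dsimp only
      set X := σ.filter fun v => !decide (∃ w ∈ τ, w.id = v.id) with hX
      have hmemX : ∀ v ∈ σ, v ∈ X ↔ v ∉ τ := by
        intro v hv
        rw [hX, List.mem_filter]
        simp only [hv, true_and, Bool.not_eq_true', decide_eq_false_iff_not, not_exists, not_and]
        constructor
        · exact fun h hvτ => h v hvτ rfl
        · intro h w hw e
          rw [hV.id_inj (hτsub.mem w hw) (hσ.mem v hv) e] at hw
          exact h hw
      have hXσ : ∀ v ∈ X, v ∈ σ := fun v hv => (List.mem_filter.1 hv).1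
      have hndX : (τ ++ X).Nodup := by
        refine List.nodup_append.2 ⟨hτsub.nodup, hσ.nodup.filter _, ?_⟩
        rintro v hv w hw rfl
        exact (hmemX v (hXσ v hw)).1 hw hv
      have hperm : (τ ++ X).length = m := by
        rw [hm]
        refine ((List.perm_ext_iff_of_nodup hndX hσ.nodup).2 fun v => ?_).length_eq
        rw [List.mem_append]
        constructor
        · rintro (h | h)
          exacts [hτσ.subset h, hXσ v h]
        · intro h
          by_cases hvτ : v ∈ τ
          exacts [Or.inl hvτ, Or.inr ((hmemX v h).2 hvτ)]
      rw [List.length_append] at hperm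
      have hXne : X ≠ [] := by
        intro h
        rw [h, List.length_nil] at hperm
        omega
      refine Spec.bind_eq (a := X) (q := 0) (q' := 1)
        (Spec.cost (s := σ.length * (m * 2 + 1 + 2)) (q := σ.length * 0) (Spec.filterC _
        fun v hv => Spec.bind_eq (q := 0) (q' := 0) ((spec_memC v τ).cost
          (Nat.mul_le_mul_right 2 hτm.le) le_rfl)
          (Spec.op rfl)) le_rfl (by simp)) (Spec.bind_eq (q := 0) (q' := 1)
        (Spec.cost (s := τ.length * (1 + 1)) (q := τ.length * 0)
          (Spec.mapC Vertex.pos fun v _ => Spec.op rfl) (by omega) (by simp))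
        (Spec.bind_eq (q := 0) (q' := 1)
        (Spec.cost (s := X.length * (1 + 1)) (q := X.length * 0)
          (Spec.mapC Vertex.pos fun v _ => Spec.op rfl) (by omega) (by simp))
        (Spec.bind (q := 0) (q' := 1) (spec_liftingDir_faces (σ := σ) hV (K.indep hface) ?_ hndX hτne
          hXne (fun w hw hwτ => (hmemX w hw).2 hwτ) hperm.le) fun s' hs' => ?_)))
      · intro v hv
        have hvσ : v ∈ σ := by
          rcases List.mem_append.1 hv with h | h
          exacts [hτσ.subset h, hXσ v h]
        exact ⟨hσ.mem v hvσ, pos_mem_pts hvσ⟩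
      obtain ⟨v₀, hv₀⟩ := List.exists_mem_of_ne_nil τ hτne
      obtain ⟨w₀, hw₀⟩ := List.exists_mem_of_ne_nil X hXne
      refine Spec.bind (q := 0) (q' := 1) (spec_tiltV hV hs hs'.1 (Or.inr ⟨v₀.pos,
        hV.pos_mem (hτsub.mem _ hv₀), w₀.pos, hV.pos_mem (hσ.mem _ (hXσ _ hw₀)),
        hs'.2.2 v₀ hv₀ w₀ (hXσ _ hw₀) ((hmemX _ (hXσ _ hw₀)).1 hw₀)⟩)) fun st hst => ?_
      have hlev' : LevelAt K st (inner ℝ st v₀.pos) (pts τ) B := by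
        refine hlev.tilt hst.2 (pos_mem_pts hv₀) (pts_subset hτσ) hverts ?_ ?_
        · intro x hx
          obtain ⟨v, hv, rfl⟩ := mem_pts.1 hx
          exact hs'.2.1 v hv v₀ hv₀
        · intro x hx hx'
          obtain ⟨w, hw, rfl⟩ := mem_pts.1 hx
          exact hs'.2.2 v₀ hv₀ w hw fun h => hx' (pos_mem_pts h)
      have hmemo : ∀ ρ ∈ properFaces τ, T (ρ.map Vertex.id)
          = some (cofaceCount K k B (pts ρ) : ℤ) := by
        intro ρ hρ
        obtain ⟨h1, h2, h3⟩ := mem_properFaces.1 hρ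
        have hρσ : ρ ∈ properFaces σ := mem_properFaces.2 ⟨h1.trans hτσ, h2, by omega⟩
        have hpw := pairwise_properFaces σ
        rw [hl] at hρσ hpw
        refine hpre ρ ((List.mem_append.1 hρσ).resolve_right fun h => ?_)
        rcases List.mem_cons.1 h with rfl | h
        · exact lt_irrefl _ h3
        · have := (List.pairwise_cons.1 (List.pairwise_append.1 hpw).2.1).1 ρ h
          omega
      -- A nonempty proper face exists, so m ≥ 2 and fuel is left for the nested call, the only
      -- level of recursion that is reached.
      obtain ⟨fuel, hfuel⟩ : ∃ j, m - 1 = j + 1 := ⟨m - 2, by omega⟩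
      rw [hfuel]
      refine Spec.bind_eq (q := 1) (q' := 0) (spec_computeIndegree_of_memo hK hO hV hτsub hτne hst.1
        hlev' hk (by omega) hmemo fuel) (Spec.bind_charge (Spec.bind_op (Spec.pure ?_)))
      have hupd : ∀ ρ ∈ properFaces σ, ρ ≠ τ → ρ.map Vertex.id ≠ τ.map Vertex.id :=
        fun ρ hρ hne e => hne
          ((hσ.sublist (mem_properFaces.1 hρ).1).eq_of_ids hV hτsub e)
      refine ⟨by simp [hz], fun ρ hρ => ?_, fun ρ hρ x hx => ?_⟩
      · by_cases hρτ : ρ = τ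
        · rw [hρτ]; simp
        · dsimp only
          rw [Function.update_of_ne]
          · rcases List.mem_append.1 hρ with h | h
            · exact hpre ρ h
            · exact absurd (List.mem_singleton.1 h) hρτ
          · refine hupd ρ ?_ hρτ
            rw [hl]
            rcases List.mem_append.1 hρ with h | h
            · exact List.mem_append_left _ h
            · exact absurd (List.mem_singleton.1 h) hρτ
      · by_cases hρτ : ρ = τ
        · rw [hρτ] at hx ⊢
          simpa using hx.symm
        · dsimp only at hx
          rw [Function.update_of_ne (hupd ρ hρ hρτ)] at hx
          exact hval ρ hρ x hx
  · have h1 := eventCount_eq_sum hK hlev k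
    rw [← sum_properFaces hV hσ hne] at h1
    dsimp only
    rw [hr, h1]
    push_cast
    simp [Function.comp_def]

end Indegree
/-! ### Rays and angles -/

section Rays

variable {d : ℕ} {O : Oracle d} {i₁ i₂ : Fin d}

/-- `r` describes the vertex `w` as seen from `v` in the plane of the coordinates `i₁`
and `i₂`. -/
structure IsRay (i₁ i₂ : Fin d) (v w : Vertex d) (r : Ray d) : Prop where
  vert : r.vert = w
  up : r.up = decide (v.pos i₁ < w.pos i₁)
  pos : 0 < r.angle
  lt_pi : r.angle < Real.pi
  polar : ∃ ρ : ℝ, w.pos i₁ - v.pos i₁ = ρ * Real.sin r.angle ∧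
    w.pos i₂ - v.pos i₂ = ρ * Real.cos r.angle

theorem polar_arccos {x y : ℝ} (hy : 0 < y) :
    0 < Real.arccos (x / √(x * x + y * y)) ∧ Real.arccos (x / √(x * x + y * y)) < Real.pi ∧
    y = √(x * x + y * y) * Real.sin (Real.arccos (x / √(x * x + y * y))) ∧
    x = √(x * x + y * y) * Real.cos (Real.arccos (x / √(x * x + y * y))) := by
  have hq : 0 < x * x + y * y := by nlinarith [mul_self_nonneg x]
  have hr : 0 < √(x * x + y * y) := Real.sqrt_pos.2 hq
  have hsq : √(x * x + y * y) ^ 2 = x * x + y * y := Real.sq_sqrt hq.le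
  set r := √(x * x + y * y)
  have hlt : |x / r| < 1 := by
    rw [abs_div, abs_of_pos hr, div_lt_one hr]
    exact abs_lt_of_sq_lt_sq (by nlinarith) hr.le
  rw [abs_lt] at hlt
  refine ⟨Real.arccos_pos.2 hlt.2, Real.arccos_lt_pi.2 hlt.1, ?_, ?_⟩
  · have h1 : 1 - (x / r) ^ 2 = (y / r) ^ 2 := by
      field_simp
      linarith
    rw [Real.sin_arccos, h1, Real.sqrt_sq (by positivity)]
    field_simp
  · rw [Real.cos_arccos hlt.1.le hlt.2.le]
    field_simp

theorem spec_rayC {v w : Vertex d} (h : v.pos i₁ ≠ w.pos i₁) :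
    Spec O (rayC i₁ i₂ v w) (IsRay i₁ i₂ v w) 11 0 := by
  refine Spec.cost (s := 1 + (1 + (1 + (1 + (1 + (1 + (1 + (1 + (1 + 2))))))))) (q := 0)
    (Spec.bind_op (Spec.bind_op (Spec.bind_op (Spec.bind_op (Spec.bind_op (Spec.bind_op
    (Spec.bind_op (Spec.bind_op (Spec.bind_op (Spec.ite (fun ht => Spec.op' ?_) fun ht =>
      Spec.cost (s := 1 + 1) (q := 0) (Spec.bind_op (Spec.op ?_)) le_rfl le_rfl)))))))))) le_rfl le_rfl
  · rw [decide_eq_true_eq] at ht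
    obtain ⟨h1, h2, h3, h4⟩ := polar_arccos (x := w.pos i₂ - v.pos i₂) ht
    exact ⟨rfl, by simpa using ht, h1, h2, _, h3, h4⟩
  · rw [decide_eq_true_eq] at ht
    have hy : 0 < -(w.pos i₁ - v.pos i₁) := by
      rcases lt_or_gt_of_ne h with h' | h'
      · exact absurd (sub_pos.2 h') ht
      · linarith
    obtain ⟨h1, h2, h3, h4⟩ := polar_arccos (x := w.pos i₂ - v.pos i₂) hy
    rw [neg_mul_neg] at h1 h2 h3 h4
    -- A vertex below v is described by the opposite ray, with angle π - a and negative radius, so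
    -- that the angle belongs to the line through v.
    refine ⟨rfl, ?_, by linarith, by linarith,
      -√((w.pos i₂ - v.pos i₂) * (w.pos i₂ - v.pos i₂)
        + (w.pos i₁ - v.pos i₁) * (w.pos i₁ - v.pos i₁)), ?_, ?_⟩
    · symm
      rw [decide_eq_false_iff_not]
      exact fun h' => ht (sub_pos.2 h')
    · rw [Real.sin_pi_sub]
      linarith
    · rw [Real.cos_pi_sub]
      linarith

/-- Angles of lines are taken modulo π; hence θ has to bound both the difference and its complement
to π. -/
theorem spec_minAngle (l : List (Ray d)) (hpos : ∀ r ∈ l, 0 < r.angle ∧ r.angle < Real.pi)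
    (hne : l.Pairwise fun a b => a.angle ≠ b.angle) :
    Spec O (minAngle l) (fun θ => (0 < θ ∧ θ ≤ Real.pi) ∧ l.Pairwise fun a b =>
      θ ≤ |a.angle - b.angle| ∧ θ ≤ Real.pi - |a.angle - b.angle|)
      (l.length * (l.length * 6)) 0 := by
  induction l with
  | nil => exact Spec.pure' ⟨⟨Real.pi_pos, le_rfl⟩, List.Pairwise.nil⟩
  | cons a l ih =>
    rw [List.pairwise_cons] at hne
    have ha := hpos a (by simp)
    refine Spec.cost (s := l.length * (l.length * 6) + l.length * (5 + 1)) (q := 0 + l.length * 0)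
      (Spec.bind (ih (fun r hr => hpos r (by simp [hr])) hne.2) fun m hm =>
        (Spec.foldC (fun (pre : List (Ray d)) θ => (0 < θ ∧ θ ≤ m) ∧ ∀ b ∈ pre,
          θ ≤ |a.angle - b.angle| ∧ θ ≤ Real.pi - |a.angle - b.angle|) ?_ ?_).imp ?_) ?_ (by simp)
    · exact ⟨⟨hm.1.1, le_rfl⟩, by simp⟩
    · rintro pre b suf θ hl ⟨⟨h1, h2⟩, h3⟩
      refine Spec.cost (s := 1 + (1 + (1 + (1 + 1)))) (q := 0) (Spec.bind_op (Spec.bind_op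
        (Spec.bind_op (Spec.bind_op (Spec.op ?_))))) le_rfl le_rfl
      have hb := hpos b (by simp [hl])
      have hab : |a.angle - b.angle| < Real.pi := by
        rw [abs_lt]; constructor <;> linarith
      refine ⟨⟨lt_min h1 (lt_min (abs_pos.2 (sub_ne_zero.2 (hne.1 b (by simp [hl]))))
        (by linarith)), (min_le_left _ _).trans h2⟩, fun c hc => ?_⟩
      rcases List.mem_append.1 hc with hc | hc
      · exact ⟨(min_le_left _ _).trans (h3 c hc).1, (min_le_left _ _).trans (h3 c hc).2⟩
      · rw [List.mem_singleton.1 hc]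
        exact ⟨(min_le_right _ _).trans (min_le_left _ _),
          (min_le_right _ _).trans (min_le_right _ _)⟩
    · rintro θ ⟨⟨h1, h2⟩, h3⟩
      exact ⟨⟨h1, h2.trans hm.1.2⟩, List.pairwise_cons.2 ⟨h3, hm.2.imp fun h =>
        ⟨h2.trans h.1, h2.trans h.2⟩⟩⟩
    · simp only [List.length_cons]
      nlinarith [Nat.zero_le l.length]

/-- The direction `sin ω e₁ + cos ω e₂` in the plane of the coordinates `i₁` and `i₂`. -/
def splitDir (i₁ i₂ : Fin d) (ω : ℝ) : E d :=
  WithLp.toLp 2 fun j => if j = i₁ then Real.sin ω else if j = i₂ then Real.cos ω else 0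

theorem inner_splitDir (h : i₁ ≠ i₂) (ω : ℝ) (x : E d) :
    inner ℝ (splitDir i₁ i₂ ω) x = Real.sin ω * x i₁ + Real.cos ω * x i₂ := by
  have e : splitDir i₁ i₂ ω = Real.sin ω • EuclideanSpace.single i₁ (1 : ℝ)
      + Real.cos ω • EuclideanSpace.single i₂ (1 : ℝ) := by
    ext j
    simp only [splitDir, PiLp.add_apply, PiLp.smul_apply, PiLp.single_apply,
      smul_eq_mul]
    by_cases h1 : j = i₁
    · subst h1; simp [h]
    · simp [h1]
  rw [e, inner_add_left, real_inner_smul_left, real_inner_smul_left,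
    EuclideanSpace.inner_single_left, EuclideanSpace.inner_single_left]
  simp

theorem norm_splitDir (h : i₁ ≠ i₂) (ω : ℝ) : ‖splitDir i₁ i₂ ω‖ = 1 := by
  have h1 : ‖splitDir i₁ i₂ ω‖ ^ 2 = 1 := by
    rw [← real_inner_self_eq_norm_sq, inner_splitDir h]
    simp only [splitDir, if_true, if_neg h.symm]
    linarith [Real.sin_sq_add_cos_sq ω, sq (Real.sin ω), sq (Real.cos ω)]
  nlinarith [norm_nonneg (splitDir i₁ i₂ ω)]

/-- If the angle of a ray differs from `α` by at least `θ` modulo `π`, or is equal to `α`, then the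
sign of the height difference in the splitting direction is known. -/
theorem inner_splitDir_sub (h : i₁ ≠ i₂) {v w : Vertex d} {r : Ray d} (hr : IsRay i₁ i₂ v w r)
    {α θ : ℝ} (hθ : 0 < θ) (hθπ : θ ≤ Real.pi)
    (hsep : r.angle ≠ α → θ ≤ |r.angle - α| ∧ θ ≤ Real.pi - |r.angle - α|) :
    ∃ t : ℝ, inner ℝ (splitDir i₁ i₂ (α - Real.pi / 2 - θ / 2)) w.pos
        - inner ℝ (splitDir i₁ i₂ (α - Real.pi / 2 - θ / 2)) v.pos
        = -(w.pos i₁ - v.pos i₁) * t ∧ (α ≤ r.angle → 0 < t) ∧ (r.angle < α → t < 0) := by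
  obtain ⟨ρ, h1, h2⟩ := hr.polar
  have hs : 0 < Real.sin r.angle := Real.sin_pos_of_pos_of_lt_pi hr.pos hr.lt_pi
  -- In polar form, with φ the angle of the ray and ω that of the direction, the height difference
  -- is ρ cos (φ - ω) = -ρ sin (φ - α + θ/2). The shift by θ/2 puts the argument strictly between 0
  -- and π if α ≤ φ, and strictly between -π and 0 if φ < α.
  refine ⟨Real.sin (r.angle - α + θ / 2) / Real.sin r.angle, ?_, fun hα => ?_, fun hα => ?_⟩
  · rw [inner_splitDir h, inner_splitDir h]
    have e : Real.sin (r.angle - α + θ / 2)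
        = -Real.cos (r.angle - (α - Real.pi / 2 - θ / 2)) := by
      rw [show r.angle - (α - Real.pi / 2 - θ / 2) = (r.angle - α + θ / 2) + Real.pi / 2 by ring,
        Real.cos_add_pi_div_two, neg_neg]
    rw [e]
    generalize α - Real.pi / 2 - θ / 2 = ω
    rw [Real.cos_sub]
    have e2 : (w.pos i₁ - v.pos i₁) / Real.sin r.angle = ρ := by rw [h1]; field_simp
    have e3 : -(w.pos i₁ - v.pos i₁) * (-(Real.cos r.angle * Real.cos ω
        + Real.sin r.angle * Real.sin ω) / Real.sin r.angle)
        = (w.pos i₁ - v.pos i₁) / Real.sin r.angle * (Real.cos r.angle * Real.cos ω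
        + Real.sin r.angle * Real.sin ω) := by ring
    rw [e3, e2]
    linear_combination Real.sin ω * h1 + Real.cos ω * h2
  · refine div_pos (Real.sin_pos_of_pos_of_lt_pi (by linarith) ?_) hs
    rcases eq_or_ne r.angle α with e | e
    · rw [e]; linarith
    · have := (hsep e).2
      rw [abs_of_nonneg (by linarith)] at this
      linarith
  · refine div_neg_of_neg_of_pos ?_ hs
    have := hsep hα.ne
    rw [abs_of_neg (by linarith)] at this
    exact Real.sin_neg_of_neg_of_neg_pi_lt (by linarith) (by linarith)

end Rays
/-! ### Edges -/

section Adjacency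

variable {d : ℕ} {K : Geometry.SimplicialComplex ℝ (E d)} {i₁ i₂ : Fin d} {V : List (Vertex d)}

/-- The vertices `v` and `w` are joined by an edge. -/
def Adj (K : Geometry.SimplicialComplex ℝ (E d)) (v w : Vertex d) : Prop :=
  v.pos ≠ w.pos ∧ pts [v, w] ∈ K.faces

theorem mem_pts_pair {v w : Vertex d} {x : E d} : x ∈ pts [v, w] ↔ x = v.pos ∨ x = w.pos := by
  simp [pts]

theorem mem_pts_singleton {v : Vertex d} {x : E d} : x ∈ pts [v] ↔ x = v.pos := by
  simp [pts]

theorem pts_pair_comm (v w : Vertex d) : pts [v, w] = pts [w, v] := by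
  ext x
  rw [mem_pts_pair, mem_pts_pair, or_comm]

theorem Adj.symm {v w : Vertex d} (h : Adj K v w) : Adj K w v :=
  ⟨h.1.symm, pts_pair_comm v w ▸ h.2⟩

theorem card_pts_pair {v w : Vertex d} (h : v.pos ≠ w.pos) : (pts [v, w]).card = 2 := by
  classical
  rw [pts, List.toFinset_card_of_nodup (by simpa using h)]
  rfl

open scoped Classical in
/-- The vertices in `V` that are adjacent to `v` and lie in `B`. -/
def neighbours (K : Geometry.SimplicialComplex ℝ (E d)) (V : List (Vertex d)) (v : Vertex d)
    (B : Set (E d)) : List (Vertex d) := V.filter fun w => decide (Adj K v w ∧ w.pos ∈ B)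

theorem mem_neighbours {v w : Vertex d} {B : Set (E d)} :
    w ∈ neighbours K V v B ↔ w ∈ V ∧ Adj K v w ∧ w.pos ∈ B := by
  simp [neighbours]

theorem IsVertexList.nodup' (hV : IsVertexList K i₁ V) : V.Nodup := hV.nodup.of_map

theorem nodup_neighbours (hV : IsVertexList K i₁ V) (v : Vertex d) (B : Set (E d)) :
    (neighbours K V v B).Nodup := hV.nodup'.filter _

theorem cofaceCount_one (hV : IsVertexList K i₁ V) (v : Vertex d) (B : Set (E d)) :
    cofaceCount K 1 B (pts [v]) = (neighbours K V v B).length := by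
  classical
  have hinj : Set.InjOn (fun w => pts [v, w]) ((neighbours K V v B).toFinset : Set (Vertex d)) := by
    intro w hw w' hw' h
    rw [List.coe_toFinset] at hw hw'
    obtain ⟨h1, h2, -⟩ := mem_neighbours.1 hw
    obtain ⟨h1', h2', -⟩ := mem_neighbours.1 hw'
    have h : pts [v, w] = pts [v, w'] := h
    have : w.pos ∈ pts [v, w'] := h ▸ mem_pts_pair.2 (Or.inr rfl)
    rcases mem_pts_pair.1 this with e | e
    · exact absurd e.symm h2.1
    · exact hV.pos_inj h1 h1' e
  rw [cofaceCount, ← List.toFinset_card_of_nodup (nodup_neighbours hV v B),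
    ← Finset.card_image_of_injOn hinj, ← Set.ncard_coe_finset]
  congr 1
  ext ρ
  simp only [Set.mem_ofPred_eq, Finset.coe_image, List.coe_toFinset, Set.mem_image]
  constructor
  · rintro ⟨hρ, hc, hv, hB⟩
    obtain ⟨x, y, hxy, rfl⟩ := Finset.card_eq_two.1 hc
    have hv' := hv (mem_pts_singleton.2 rfl)
    obtain ⟨z, hz, hzv⟩ : ∃ z, ({x, y} : Finset (E d)) = {v.pos, z} ∧ v.pos ≠ z := by
      rcases Finset.mem_insert.1 hv' with e | e
      · exact ⟨y, by rw [e], e ▸ hxy⟩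
      · rw [Finset.mem_singleton] at e
        exact ⟨x, by rw [e, Finset.pair_comm], e ▸ hxy.symm⟩
    rw [hz] at hρ hB ⊢
    have hz1 : z ∈ ({v.pos, z} : Finset (E d)) := by simp
    obtain ⟨w, hw, rfl⟩ := hV.exists_mem (mem_vertices_of_mem_face hρ hz1)
    have e : pts [v, w] = {v.pos, w.pos} := by
      ext u
      rw [mem_pts_pair]
      simp
    refine ⟨w, mem_neighbours.2 ⟨hw, ⟨hzv, e ▸ hρ⟩, hB _ hz1 fun h => ?_⟩, e⟩
    exact hzv (mem_pts_singleton.1 h).symm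
  · rintro ⟨w, hw, rfl⟩
    obtain ⟨h1, h2, h3⟩ := mem_neighbours.1 hw
    refine ⟨h2.2, card_pts_pair h2.1, fun x hx => ?_, fun x hx hx' => ?_⟩
    · exact mem_pts_pair.2 (Or.inl (mem_pts_singleton.1 hx))
    · rcases mem_pts_pair.1 hx with e | e
      · exact absurd (mem_pts_singleton.2 e) hx'
      · exact e ▸ h3

theorem pts_singleton_mem_faces (hV : IsVertexList K i₁ V) {v : Vertex d} (hv : v ∈ V) :
    pts [v] ∈ K.faces := by
  have h : ({v.pos} : Finset (E d)) ∈ K.faces := hV.pos_mem hv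
  convert h
  ext x
  rw [mem_pts_singleton, Finset.mem_singleton]

theorem isVertexSubset_singleton {v : Vertex d} (hv : v ∈ V) : IsVertexSubset V [v] :=
  ⟨List.pairwise_singleton _ _, fun w hw => by rwa [List.mem_singleton.1 hw]⟩

theorem levelAt_vertex (hV : IsVertexList K i₁ V) {v : Vertex d} {s : E d}
    (h : ∀ w ∈ V, w ≠ v → inner ℝ s w.pos ≠ inner ℝ s v.pos) :
    LevelAt K s (inner ℝ s v.pos) (pts [v]) {x | inner ℝ s x < inner ℝ s v.pos} := by
  intro x hx
  obtain ⟨w, hw, rfl⟩ := hV.exists_mem hx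
  rw [mem_pts_singleton]
  refine ⟨⟨fun e => by rw [e], fun e => ?_⟩, Iff.rfl⟩
  by_contra hne
  exact h w hw (fun h' => hne (by rw [h'])) e

end Adjacency

/-! ### Splitting edge intervals and the edges above a vertex -/

section Splitting

variable {d : ℕ} {F : Type*} [Field F] {K : Geometry.SimplicialComplex ℝ (E d)} {O : Oracle d}
  {i₁ i₂ : Fin d} {V : List (Vertex d)} {v : Vertex d} {θ : ℝ} {above : List (Ray d)}

/-- The rays from `v` to the vertices above `v`, in clockwise order, and a lower bound for
the angles between them and the lines to other vertices. -/
structure IsFan (i₁ i₂ : Fin d) (V : List (Vertex d)) (v : Vertex d) (θ : ℝ)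
    (above : List (Ray d)) : Prop where
  mem : ∀ r ∈ above, r.vert ∈ V ∧ v.pos i₁ < r.vert.pos i₁
  sorted : above.Pairwise fun a b => b.angle < a.angle
  nodup : (above.map Ray.vert).Nodup
  pos : 0 < θ
  le_pi : θ ≤ Real.pi
  sep : ∀ w ∈ V, w ≠ v → w.pos i₁ ≠ v.pos i₁ ∧ ∃ r, IsRay i₁ i₂ v w r ∧
    (v.pos i₁ < w.pos i₁ → r ∈ above) ∧
    ∀ r' ∈ above, r.angle ≠ r'.angle → θ ≤ |r.angle - r'.angle| ∧ θ ≤ Real.pi - |r.angle - r'.angle|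

theorem IsFan.vert_inj (h : IsFan i₁ i₂ V v θ above) {r r' : Ray d} (hr : r ∈ above)
    (hr' : r' ∈ above) (e : r.vert = r'.vert) : r = r' :=
  List.inj_on_of_nodup_map h.nodup hr hr' e

theorem IsFan.exists_ray (h : IsFan i₁ i₂ V v θ above) {w : Vertex d} (hw : w ∈ V)
    (hlt : v.pos i₁ < w.pos i₁) : ∃ r ∈ above, r.vert = w := by
  obtain ⟨-, r, h1, h2, -⟩ := h.sep w hw (fun e => by rw [e] at hlt; exact lt_irrefl _ hlt)
  exact ⟨r, h2 hlt, h1.vert⟩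

theorem IsFan.length_le (hV : IsVertexList K i₁ V) (h : IsFan i₁ i₂ V v θ above) :
    above.length ≤ K.vertices.ncard := by
  rw [← hV.length, ← List.length_map (f := Ray.vert)]
  refine (h.nodup.subperm fun w hw => ?_).length_le
  obtain ⟨r, hr, rfl⟩ := List.mem_map.1 hw
  exact (h.mem r hr).1

/-- The vertices below `v` in the splitting direction at the ray `r₀`. -/
theorem IsFan.split (h : IsFan i₁ i₂ V v θ above) (hi : i₁ ≠ i₂) {init rest : List (Ray d)}
    {r₀ : Ray d} (ha : above = init ++ r₀ :: rest) {s : E d}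
    (hs : s = splitDir i₁ i₂ (r₀.angle - Real.pi / 2 - θ / 2)) {w : Vertex d} (hw : w ∈ V)
    (hwv : w ≠ v) : inner ℝ s w.pos ≠ inner ℝ s v.pos ∧ (v.pos i₁ < w.pos i₁ →
      (inner ℝ s w.pos < inner ℝ s v.pos ↔ ∃ r ∈ init ++ [r₀], r.vert = w)) := by
  obtain ⟨h1, r, h2, h3, h4⟩ := h.sep w hw hwv
  have hr₀ : r₀ ∈ above := by simp [ha]
  obtain ⟨t, ht, hpos, hneg⟩ := inner_splitDir_sub hi h2 h.pos h.le_pi (h4 r₀ hr₀)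
  rw [← hs] at ht
  have ht0 : t ≠ 0 := by
    rcases le_or_gt r₀.angle r.angle with h' | h'
    · exact (hpos h').ne'
    · exact (hneg h').ne
  refine ⟨fun e => ?_, fun hlt => ?_⟩
  · rw [e, sub_self, eq_comm, mul_eq_zero, neg_eq_zero, sub_eq_zero] at ht
    exact ht.elim h1 ht0
  · have hra := h3 hlt
    have hy : 0 < w.pos i₁ - v.pos i₁ := sub_pos.2 hlt
    have e1 : inner ℝ s w.pos < inner ℝ s v.pos ↔ r₀.angle ≤ r.angle := by
      rw [← sub_neg, ht, neg_mul, neg_lt_zero, mul_pos_iff_of_pos_left hy]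
      refine ⟨fun h' => ?_, hpos⟩
      by_contra hc
      exact lt_asymm h' (hneg (not_le.1 hc))
    rw [e1]
    have hsort := h.sorted
    rw [ha, List.pairwise_append, List.pairwise_cons] at hsort
    constructor
    · intro hle
      refine ⟨r, ?_, h2.vert⟩
      rw [ha] at hra
      simp only [List.mem_append, List.mem_cons, List.not_mem_nil, or_false] at hra ⊢
      rcases hra with hra | hra | hra
      · exact Or.inl hra
      · exact Or.inr hra
      · exact absurd hle (hsort.2.1.1 r hra).not_ge
    · rintro ⟨r', hr', e⟩
      have : r = r' := h.vert_inj hra (by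
        rw [ha]
        simp only [List.mem_append, List.mem_cons, List.not_mem_nil, or_false] at hr' ⊢
        tauto) (h2.vert.trans e.symm)
      subst this
      rcases List.mem_append.1 hr' with hr' | hr'
      · exact (hsort.2.2 r hr' r₀ (by simp)).le
      · rw [List.mem_singleton.1 hr']

/-- The vertices adjacent to `v` that lie below `v` or on a ray in `done`. -/
structure IsKnown (K : Geometry.SimplicialComplex ℝ (E d)) (i₁ : Fin d) (V : List (Vertex d))
    (v : Vertex d) (done : List (Ray d)) (known : List (Vertex d)) : Prop where
  nodup : known.Nodup
  mem : ∀ w, w ∈ known ↔ w ∈ V ∧ Adj K v w ∧ (w.pos i₁ < v.pos i₁ ∨ ∃ r ∈ done, r.vert = w)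

theorem IsKnown.length_le (hV : IsVertexList K i₁ V) {done : List (Ray d)} {known : List (Vertex d)}
    (h : IsKnown K i₁ V v done known) : known.length ≤ K.vertices.ncard := by
  rw [← hV.length]
  exact (h.nodup.subperm fun w hw => ((h.mem w).1 hw).1).length_le

open scoped Classical in
/-- Counting the adjacent vertices below a height: the known ones and those on new rays. -/
theorem IsKnown.length_neighbours (hV : IsVertexList K i₁ V) (h : IsFan i₁ i₂ V v θ above)
    {done new : List (Ray d)} {known : List (Vertex d)} (hk : IsKnown K i₁ V v done known)
    (hsub : (done ++ new).Sublist above) {B : Set (E d)}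
    (hB : ∀ w ∈ V, v.pos i₁ < w.pos i₁ → (w.pos ∈ B ↔ ∃ r ∈ done ++ new, r.vert = w)) :
    (neighbours K V v B).length = known.countP (fun w => decide (w.pos ∈ B))
      + new.countP fun r => decide (Adj K v r.vert) := by
  have hnd := h.nodup.sublist (hsub.map Ray.vert)
  rw [List.map_append, List.nodup_append] at hnd
  have hmem : ∀ r ∈ done ++ new, r ∈ above := fun r hr => hsub.subset hr
  have e : new.countP (fun r => decide (Adj K v r.vert))
      = ((new.map Ray.vert).filter fun w => decide (Adj K v w)).length := by
    rw [← List.countP_eq_length_filter, List.countP_map]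
    rfl
  rw [e, List.countP_eq_length_filter, ← List.length_append]
  refine List.Perm.length_eq ((List.perm_ext_iff_of_nodup (nodup_neighbours hV v B)
    (List.nodup_append.2 ⟨hk.nodup.filter _, hnd.2.1.filter _, ?_⟩)).2 fun w => ?_)
  · rintro w hw w' hw' rfl
    obtain ⟨h1, -, h2⟩ := (hk.mem w).1 (List.mem_of_mem_filter hw)
    obtain ⟨r, hr, rfl⟩ := List.mem_map.1 (List.mem_of_mem_filter hw')
    rcases h2 with h2 | ⟨r', hr', e'⟩
    · exact lt_asymm h2 (h.mem r (hmem r (by simp [hr]))).2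
    · exact hnd.2.2 _ (List.mem_map_of_mem hr') _ (List.mem_map_of_mem hr) e'
  · simp only [mem_neighbours, List.mem_append, List.mem_filter, decide_eq_true_eq, hk.mem,
      List.mem_map]
    constructor
    · rintro ⟨hw, hadj, hwB⟩
      rcases lt_trichotomy (w.pos i₁) (v.pos i₁) with hlt | heq | hgt
      · exact Or.inl ⟨⟨hw, hadj, Or.inl hlt⟩, hwB⟩
      · exact absurd heq (h.sep w hw fun e => hadj.1 (by rw [e])).1
      · obtain ⟨r, hr, rfl⟩ := (hB w hw hgt).1 hwB
        rcases List.mem_append.1 hr with hr | hr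
        · exact Or.inl ⟨⟨hw, hadj, Or.inr ⟨r, hr, rfl⟩⟩, hwB⟩
        · exact Or.inr ⟨⟨r, hr, rfl⟩, hadj⟩
    · rintro (⟨⟨hw, hadj, -⟩, hwB⟩ | ⟨⟨r, hr, rfl⟩, hadj⟩)
      · exact ⟨hw, hadj, hwB⟩
      · obtain ⟨h1, h2⟩ := h.mem r (hmem r (by simp [hr]))
        exact ⟨h1, hadj, (hB _ h1 h2).2 ⟨r, by simp [hr], rfl⟩⟩

/-- An upper bound for the number of steps of `splitInterval`. -/
def splitCost (d N n : ℕ) : ℕ := indegreeCost d N n 1 1 + n * (d * 2 + 5) + d * 4 + 9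

open scoped Classical in
/-- The number of rays in `l` to vertices adjacent to `v`. -/
def adjCount (K : Geometry.SimplicialComplex ℝ (E d)) (v : Vertex d) (l : List (Ray d)) : ℤ :=
  l.countP fun r => decide (Adj K v r.vert)

/-- Among the vertices above v in direction e₁, exactly those on the rays in `done` and in the first
half are below v in the splitting direction. A vertex lower than v in direction e₁ may be on either
side, but its adjacency is known. So the indegree of v minus the known neighbours below is the count
for the first half. -/
theorem spec_splitInterval (hK : K.faces.Finite) (hO : IsOracleFor F O K)
    (hV : IsVertexList K i₁ V) (hi : i₁ ≠ i₂) (hv : v ∈ V) (h : IsFan i₁ i₂ V v θ above)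
    {done rest : List (Ray d)} {known : List (Vertex d)} (hk : IsKnown K i₁ V v done known)
    {I : EdgeInterval d} (ha : above = done ++ (I.rays ++ rest)) (hI : I.count = adjCount K v I.rays)
    (hlen : 2 ≤ I.rays.length) :
    Spec O (splitInterval i₁ i₂ V v θ known I) (fun J => J.1.rays ++ J.2.rays = I.rays ∧
      0 < J.1.rays.length ∧ 0 < J.2.rays.length ∧
      J.1.count = adjCount K v J.1.rays ∧ J.2.count = adjCount K v J.2.rays)
      (splitCost d K.faces.ncard K.vertices.ncard) 2 := by
  classical
  set m := I.rays.length / 2 with hm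
  -- The first half is not empty; its last ray r₀ has the smallest angle of that half and determines
  -- the splitting direction.
  obtain ⟨init, r₀, hr₀⟩ : ∃ init r₀, I.rays.take m = init ++ [r₀] := by
    rcases List.eq_nil_or_concat (I.rays.take m) with h' | ⟨init, r₀, h'⟩
    · have := congrArg List.length h'
      rw [List.length_take, List.length_nil] at this
      omega
    · exact ⟨init, r₀, by rw [h', List.concat_eq_append]⟩
  have hα : ((I.rays.map Ray.angle)[m - 1]?).getD 0 = r₀.angle := by
    have h1 : (I.rays.take m)[m - 1]? = some r₀ := by
      have := congrArg List.length hr₀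
      rw [List.length_take, List.length_append, List.length_singleton] at this
      rw [hr₀, List.getElem?_append_right (by omega), show m - 1 - init.length = 0 by omega]
      rfl
    rw [List.getElem?_take_of_lt (by omega)] at h1
    rw [List.getElem?_map, h1]
    rfl
  set s := splitDir i₁ i₂ (r₀.angle - Real.pi / 2 - θ / 2) with hs
  have hab : above = (done ++ init) ++ r₀ :: (I.rays.drop m ++ rest) := by
    rw [ha]
    conv_lhs => rw [← List.take_append_drop m I.rays, hr₀]
    simp
  have hsplit := fun w hw hwv => h.split hi hab hs (w := w) hw hwv
  have hlev := levelAt_vertex (s := s) hV (fun w hw hwv => (hsplit w hw hwv).1)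
  have hcount := hk.length_neighbours hV h (new := I.rays.take m)
    (B := {x | inner ℝ s x < inner ℝ s v.pos})
    (by rw [ha, ← List.append_assoc]
        exact ((List.Sublist.refl done).append (List.take_sublist m I.rays)).trans
          (List.sublist_append_left _ _))
    (fun w hw hlt => by
      rw [hr₀, ← List.append_assoc]
      exact (hsplit w hw fun e => by rw [e] at hlt; exact lt_irrefl _ hlt).2 hlt)
  have hind := spec_indegree hK hO hV (isVertexSubset_singleton hv)
    (pts_singleton_mem_faces hV hv) (norm_splitDir hi _) hlev le_rfl (by simp)
  rw [cofaceCount_one hV] at hind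
  have hl1 := hk.length_le hV
  have hl2 : I.rays.length ≤ K.vertices.ncard := by
    have := h.length_le hV
    rw [ha, List.length_append, List.length_append] at this
    omega
  refine Spec.cost (s := I.rays.length + (1 + (1 + (1 + (1 + (1 + (1 + (1 + (d * (1 + 1) +
      (indegreeCost d K.faces.ncard K.vertices.ncard 1 1 + (d * 2 + (known.length * (d * 2 + 1 + 2)
      + (1 + (1 + (I.rays.length + 0))))))))))))))) (q := 0 + (2 + (0 + (known.length * 0 + 0))))
    (Spec.bind_charge (Spec.bind_op ?_)) ?_ (by simp)
  · dsimp only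
    rw [← hm, hα]
    refine Spec.bind_op (Spec.bind_op (Spec.bind_op (Spec.bind_op (Spec.bind_op (Spec.bind_op
      (Spec.bind_eq (a := s) (Spec.vecC _ fun i => Spec.op rfl) (Spec.bind_eq hind
      (Spec.bind_eq (spec_dot s _) (Spec.bind_eq (Spec.countC _ fun w _ => Spec.cost
        (s := d * 2 + 1) (q := 0 + 0) (Spec.bind_eq (spec_dot s _) Spec.op_rfl) le_rfl le_rfl)
        (Spec.bind_op (Spec.bind_op (Spec.bind_charge (Spec.pure ?_)))))))))))))
    have e1 : (List.countP (fun w => decide (w.pos ∈ {x | inner ℝ s x < inner ℝ s v.pos})) known)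
        = List.countP (fun w => decide (inner ℝ s w.pos < inner ℝ s v.pos)) known := rfl
    have e2 := List.countP_append (p := fun r => decide (Adj K v r.vert)) (l₁ := I.rays.take m)
      (l₂ := I.rays.drop m)
    rw [List.take_append_drop] at e2
    rw [e1] at hcount
    refine ⟨List.take_append_drop _ _, ?_, ?_, ?_, ?_⟩
    · dsimp only
      rw [List.length_take]
      omega
    · dsimp only
      rw [List.length_drop]
      omega
    · dsimp only [adjCount]
      rw [hcount]
      push_cast
      ring
    · dsimp only [adjCount]
      rw [hI, adjCount, hcount, e2]
      push_cast
      ring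
  · rw [splitCost]
    nlinarith

/-- Justifies dropping an interval without edges: its rays may be regarded as done. -/
theorem IsKnown.append {done new : List (Ray d)} {known : List (Vertex d)}
    (hk : IsKnown K i₁ V v done known) (h : ∀ r ∈ new, ¬ Adj K v r.vert) :
    IsKnown K i₁ V v (done ++ new) known := by
  refine ⟨hk.nodup, fun w => ?_⟩
  rw [hk.mem]
  constructor
  · rintro ⟨h1, h2, h3 | ⟨r, hr, h3⟩⟩
    · exact ⟨h1, h2, Or.inl h3⟩
    · exact ⟨h1, h2, Or.inr ⟨r, by simp [hr], h3⟩⟩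
  · rintro ⟨h1, h2, h3 | ⟨r, hr, rfl⟩⟩
    · exact ⟨h1, h2, Or.inl h3⟩
    · rcases List.mem_append.1 hr with hr | hr
      · exact ⟨h1, h2, Or.inr ⟨r, hr, rfl⟩⟩
      · exact absurd h2 (h r hr)

theorem IsKnown.cons (h : IsFan i₁ i₂ V v θ above) {done rest : List (Ray d)} {r : Ray d}
    (ha : above = done ++ r :: rest) {known : List (Vertex d)} (hk : IsKnown K i₁ V v done known)
    (hadj : Adj K v r.vert) : IsKnown K i₁ V v (done ++ [r]) (r.vert :: known) := by
  have hr : r ∈ above := by simp [ha]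
  have hnd := h.nodup
  rw [ha, List.map_append, List.map_cons, List.nodup_append] at hnd
  refine ⟨List.nodup_cons.2 ⟨fun hmem => ?_, hk.nodup⟩, fun w => ?_⟩
  · rcases ((hk.mem _).1 hmem).2.2 with h3 | ⟨r', hr', e⟩
    · exact lt_asymm h3 (h.mem r hr).2
    · exact hnd.2.2 _ (List.mem_map_of_mem hr') _ (List.mem_cons_self) e
  · rw [List.mem_cons, hk.mem]
    constructor
    · rintro (rfl | ⟨h1, h2, h3 | ⟨r', hr', h3⟩⟩)
      · exact ⟨(h.mem r hr).1, hadj, Or.inr ⟨r, by simp, rfl⟩⟩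
      · exact ⟨h1, h2, Or.inl h3⟩
      · exact ⟨h1, h2, Or.inr ⟨r', by simp [hr'], h3⟩⟩
    · rintro ⟨h1, h2, h3 | ⟨r', hr', rfl⟩⟩
      · exact Or.inr ⟨h1, h2, Or.inl h3⟩
      · rcases List.mem_append.1 hr' with hr' | hr'
        · exact Or.inr ⟨h1, h2, Or.inr ⟨r', hr', rfl⟩⟩
        · exact Or.inl (by rw [List.mem_singleton.1 hr'])

theorem adjCount_eq_zero {l : List (Ray d)} :
    adjCount K v l = 0 ↔ ∀ r ∈ l, ¬ Adj K v r.vert := by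
  classical
  simp [adjCount, List.countP_eq_zero]

/-- Invariant: `done` followed by the intervals on the stack is the whole fan in clockwise order.
The potential is the sum of 2 max(m, 1) - 1 over the intervals, m being the number of rays. A split
into nonempty parts of sizes a and b replaces 2 (a + b) - 1 by 2 (a + b) - 2, and any other
iteration removes an interval of potential at least 1. The bound needs only that both parts are
nonempty, not that they are halves. -/
theorem spec_upEdgesLoop (hK : K.faces.Finite) (hO : IsOracleFor F O K)
    (hV : IsVertexList K i₁ V) (hi : i₁ ≠ i₂) (hv : v ∈ V) (h : IsFan i₁ i₂ V v θ above)
    (fuel : ℕ) (stack : List (EdgeInterval d)) (known : List (Vertex d)) (done : List (Ray d))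
    (hk : IsKnown K i₁ V v done known)
    (ha : above = done ++ (stack.map EdgeInterval.rays).flatten)
    (hcount : ∀ I ∈ stack, I.count = adjCount K v I.rays)
    (hfuel : (stack.map fun I => 2 * max I.rays.length 1 - 1).sum ≤ fuel) :
    Spec O (upEdgesLoop i₁ i₂ V v θ fuel stack known) (IsKnown K i₁ V v above)
      (fuel * (splitCost d K.faces.ncard K.vertices.ncard + 2)) (fuel * 2) := by
  induction fuel generalizing stack known done with
  | zero =>
    cases stack with
    | nil =>
      rw [List.map_nil, List.flatten_nil, List.append_nil] at ha
      exact Spec.pure' (ha ▸ hk)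
    | cons I stack =>
      rw [List.map_cons, List.sum_cons] at hfuel
      omega
  | succ fuel ih =>
    cases stack with
    | nil =>
      rw [List.map_nil, List.flatten_nil, List.append_nil] at ha
      exact Spec.pure' (ha ▸ hk)
    | cons I stack =>
      rw [List.map_cons, List.sum_cons] at hfuel
      rw [List.map_cons, List.flatten_cons] at ha
      have hI := hcount I (by simp)
      set c := splitCost d K.faces.ncard K.vertices.ncard
      have hskip : (∀ r ∈ I.rays, ¬ Adj K v r.vert) →
          Spec O (upEdgesLoop i₁ i₂ V v θ fuel stack known) (IsKnown K i₁ V v above)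
          (fuel * (c + 2) + (c + 1)) (fuel * 2 + 2) := fun hI' =>
        (ih stack known (done ++ I.rays) (hk.append hI') (by rw [ha, List.append_assoc])
          (fun J hJ => hcount J (by simp [hJ])) (by omega)).cost (by omega) (by omega)
      refine Spec.cost (s := 1 + (fuel * (c + 2) + (c + 1))) (q := fuel * 2 + 2)
        (Spec.bind_op (Spec.ite (fun hz => ?_) fun hz => ?_)) (by ring_nf; omega) (by omega)
      · rw [decide_eq_true_eq, hI, adjCount_eq_zero] at hz
        exact hskip hz
      · rw [decide_eq_true_eq, hI, adjCount_eq_zero] at hz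
        obtain ⟨rays, count⟩ := I
        match rays with
        | [] => exact hskip (by simp)
        | [r] =>
          dsimp only at *
          refine Spec.cost (s := 1 + fuel * (c + 2)) (q := fuel * 2) (Spec.bind_op
            (ih stack _ (done ++ [r]) (hk.cons h ha (by simpa using hz))
            (by rw [ha, List.append_assoc]) (fun J hJ => hcount J (by simp [hJ])) ?_))
            (by omega) (by omega)
          omega
        | r :: r' :: l =>
          dsimp only at *
          refine Spec.cost (s := c + (1 + fuel * (c + 2))) (q := 2 + fuel * 2) (Spec.bind
            (spec_splitInterval hK hO hV hi hv h hk ha hI (by simp)) fun J hJ => Spec.bind_op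
            (ih _ known done hk ?_ ?_ ?_)) (by omega) (by omega)
          · rw [ha]
            simp only [List.map_cons, List.flatten_cons]
            rw [← List.append_assoc J.1.rays, hJ.1]
          · intro I' hI'
            rcases List.mem_cons.1 hI' with rfl | hI'
            · exact hJ.2.2.2.1
            · rcases List.mem_cons.1 hI' with rfl | hI'
              · exact hJ.2.2.2.2
              · exact hcount I' (by simp [hI'])
          · obtain ⟨h1, h2, h3, -⟩ := hJ
            have h4 := congrArg List.length h1
            simp only [List.length_append, List.length_cons] at h4 hfuel
            simp only [List.map_cons, List.sum_cons]
            omega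

/-- An upper bound for the number of steps of `findUpEdges`. -/
def upEdgesCost (d N n : ℕ) : ℕ := (n * 2 + 1) * (splitCost d N n + 2) + N * 6 + n * 3 + 2

theorem spec_findUpEdges (hK : K.faces.Finite) (hO : IsOracleFor F O K)
    (hV : IsVertexList K i₁ V) (hi : i₁ ≠ i₂) (hv : v ∈ V) (h : IsFan i₁ i₂ V v θ above)
    {known : List (Vertex d)} (hk : IsKnown K i₁ V v [] known) :
    Spec O (findUpEdges i₁ i₂ V v known above θ (O (-EuclideanSpace.single i₁ 1)))
      (fun l => l.Nodup ∧ l.length ≤ K.vertices.ncard ∧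
        ∀ w, w ∈ l ↔ w ∈ V ∧ Adj K v w ∧ v.pos i₁ < w.pos i₁)
      (upEdgesCost d K.faces.ncard K.vertices.ncard) ((K.vertices.ncard * 2 + 1) * 2) := by
  classical
  set s : E d := -EuclideanSpace.single i₁ 1 with hs
  have hinner : ∀ x : E d, inner ℝ s x = -x i₁ := fun x => by
    rw [hs, inner_neg_left, EuclideanSpace.inner_single_left]
    simp
  have hlev := levelAt_vertex (s := s) hV (v := v) (fun w hw hwv => by
    rw [hinner, hinner, Ne, neg_inj]
    exact (h.sep w hw hwv).1)
  have hle := h.length_le hV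
  -- In direction -e₁ the vertices below v are those above it in direction e₁, so one diagram gives
  -- the edge count of the initial interval of every vertex.
  have hdeg : eventCount K s 1 (-(v.pos i₁)) = adjCount K v above := by
    rw [← hinner, eventCount_eq_sum hK hlev 1]
    have e1 : (pts [v]).powerset.erase ∅ = {pts [v]} := by
      ext ρ
      have e : pts [v] = {v.pos} := by
        ext x
        rw [mem_pts_singleton, Finset.mem_singleton]
      rw [Finset.mem_erase, Finset.mem_powerset, Finset.mem_singleton, e,
        Finset.subset_singleton_iff]
      constructor
      · tauto
      · rintro rfl
        exact ⟨Finset.singleton_ne_empty _, Or.inr rfl⟩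
    rw [e1, Finset.sum_singleton, cofaceCount_one hV, hk.length_neighbours hV h (new := above)
      (by simp) fun w hw hlt => ?_]
    · have e2 : known.countP
          (fun w => decide (w.pos ∈ {x | inner ℝ s x < inner ℝ s v.pos})) = 0 := by
        rw [List.countP_eq_zero]
        intro w hw hw'
        rw [decide_eq_true_eq, Set.mem_ofPred_eq, hinner, hinner, neg_lt_neg_iff] at hw'
        rcases ((hk.mem w).1 hw).2.2 with h3 | ⟨r, hr, -⟩
        · exact lt_asymm hw' h3
        · simp at hr
      rw [e2, zero_add, adjCount]
    · rw [Set.mem_ofPred_eq, hinner, hinner, neg_lt_neg_iff, List.nil_append]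
      exact ⟨fun _ => h.exists_ray hw hlt, fun _ => hlt⟩
  refine Spec.cost (s := 1 + ((K.faces.ncard * 6 + 1) + ((2 * above.length + 1) *
    (splitCost d K.faces.ncard K.vertices.ncard + 2) + K.vertices.ncard * 3)))
    (q := 0 + ((2 * above.length + 1) * 2 + 0)) (Spec.bind_op (Spec.bind_eq
    (spec_eventsAt hK hO (by simp [hs]) le_rfl _) (Spec.bind (spec_upEdgesLoop hK hO hV hi hv h
    (2 * above.length + 1) [⟨above, _⟩] known [] hk (by simp) (by simpa using hdeg) ?_)
    fun all hall => Spec.mono (Spec.filterC (s := 1) (q := 0) _ fun w _ => Spec.op rfl) ?_ ?_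
      (by simp)))) ?_ ?_
  · simp only [List.map_cons, List.map_nil, List.sum_cons, List.sum_nil]
    omega
  · rintro l rfl
    refine ⟨hall.nodup.filter _, (List.length_filter_le _ _).trans (hall.length_le hV),
      fun w => ?_⟩
    rw [List.mem_filter, hall.mem, decide_eq_true_eq]
    constructor
    · rintro ⟨⟨h1, h2, -⟩, h3⟩
      exact ⟨h1, h2, h3⟩
    · rintro ⟨h1, h2, h3⟩
      exact ⟨⟨h1, h2, Or.inr (h.exists_ray h1 h3)⟩, h3⟩
  · exact Nat.mul_le_mul_right _ (hall.length_le hV)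
  · rw [upEdgesCost]
    have := Nat.mul_le_mul_right (splitCost d K.faces.ncard K.vertices.ncard + 2)
      (show 2 * above.length + 1 ≤ K.vertices.ncard * 2 + 1 by omega)
    omega
  · omega

end Splitting
/-! ### The list of all edges -/

section FindEdges

variable {d : ℕ} {F : Type*} [Field F] {K : Geometry.SimplicialComplex ℝ (E d)} {O : Oracle d}
  {i₁ i₂ : Fin d} {V : List (Vertex d)}

/-- No three points of `S` have collinear projections to the plane of the coordinates `i₁`
and `i₂`. -/
def PlaneGeneral (i₁ i₂ : Fin d) (S : Set (E d)) : Prop :=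
  ∀ x ∈ S, ∀ y ∈ S, ∀ z ∈ S, x ≠ y → x ≠ z → y ≠ z →
    (y i₁ - x i₁) * (z i₂ - x i₂) ≠ (z i₁ - x i₁) * (y i₂ - x i₂)

theorem IsVertexList.ne_of_ne (hV : IsVertexList K i₁ V) {v w : Vertex d} (hv : v ∈ V)
    (hw : w ∈ V) (h : w ≠ v) : w.pos i₁ ≠ v.pos i₁ := fun e =>
  h (eq_of_pairwise_lt hV.sorted hw hv e)

/-- Vertices seen from v under equal angles lie with v on one line of the plane. -/
theorem angle_ne (hV : IsVertexList K i₁ V) (hcol : PlaneGeneral i₁ i₂ K.vertices)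
    {v w w' : Vertex d} (hv : v ∈ V) (hw : w ∈ V) (hw' : w' ∈ V) (h : v ≠ w) (h' : v ≠ w')
    (hww' : w ≠ w') {r r' : Ray d} (hr : IsRay i₁ i₂ v w r) (hr' : IsRay i₁ i₂ v w' r') :
    r.angle ≠ r'.angle := by
  intro e
  obtain ⟨ρ, h1, h2⟩ := hr.polar
  obtain ⟨ρ', h1', h2'⟩ := hr'.polar
  refine hcol _ (hV.pos_mem hv) _ (hV.pos_mem hw) _ (hV.pos_mem hw') (fun e => h ?_)
    (fun e => h' ?_) (fun e => hww' ?_) ?_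
  · exact hV.pos_inj hv hw e
  · exact hV.pos_inj hv hw' e
  · exact hV.pos_inj hw hw' e
  · rw [h1, h2, h1', h2', e]
    ring

theorem pairwise_angle_ne (hV : IsVertexList K i₁ V) (hcol : PlaneGeneral i₁ i₂ K.vertices)
    {v : Vertex d} (hv : v ∈ V) {rays : List (Ray d)} (hnd : (rays.map Ray.vert).Nodup)
    (hrays : ∀ r ∈ rays, IsRay i₁ i₂ v r.vert r ∧ r.vert ∈ V ∧ r.vert ≠ v) :
    rays.Pairwise fun a b => a.angle ≠ b.angle := by
  rw [List.Nodup, List.pairwise_map] at hnd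
  refine hnd.imp_of_mem fun {a b} ha hb hab => ?_
  obtain ⟨h1, h2, h3⟩ := hrays a ha
  obtain ⟨h1', h2', h3'⟩ := hrays b hb
  exact angle_ne hV hcol hv h2 h2' h3.symm h3'.symm hab h1 h1'

theorem isFan_insertionSort (hV : IsVertexList K i₁ V) {v : Vertex d} (hv : v ∈ V)
    {rays : List (Ray d)} (hmap : rays.map Ray.vert = V.filter fun w => decide (w.id ≠ v.id))
    (hrays : ∀ r ∈ rays, IsRay i₁ i₂ v r.vert r) {θ : ℝ} (h0 : 0 < θ) (hπ : θ ≤ Real.pi)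
    (hne : rays.Pairwise fun a b => a.angle ≠ b.angle)
    (hθ : rays.Pairwise fun a b => θ ≤ |a.angle - b.angle| ∧ θ ≤ Real.pi - |a.angle - b.angle|) :
    IsFan i₁ i₂ V v θ ((rays.filter fun r => r.up).insertionSort fun a b => b.angle ≤ a.angle) := by
  have : Std.Total fun a b : Ray d => b.angle ≤ a.angle := ⟨fun a b => le_total _ _⟩
  have : IsTrans (Ray d) fun a b => b.angle ≤ a.angle := ⟨fun a b c h1 h2 => h2.trans h1⟩
  have hp := List.perm_insertionSort (fun a b : Ray d => b.angle ≤ a.angle)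
    (rays.filter fun r => r.up)
  have hmem : ∀ r, r ∈ (rays.filter fun r => r.up).insertionSort (fun a b => b.angle ≤ a.angle) ↔
      r ∈ rays ∧ r.up = true := fun r => by rw [hp.mem_iff, List.mem_filter]
  have hnd : (rays.map Ray.vert).Nodup := hmap ▸ hV.nodup'.filter _
  have hup : ∀ r ∈ rays, (r.up = true ↔ v.pos i₁ < r.vert.pos i₁) := fun r hr => by
    rw [(hrays r hr).up, decide_eq_true_eq]
  have hvert : ∀ w, w ∈ rays.map Ray.vert ↔ w ∈ V ∧ w ≠ v := fun w => by
    rw [hmap, List.mem_filter, decide_eq_true_eq]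
    exact ⟨fun h => ⟨h.1, fun e => h.2 (by rw [e])⟩, fun h => ⟨h.1, fun e => h.2 (hV.id_inj h.1 hv e)⟩⟩
  refine ⟨fun r hr => ?_, ?_, ?_, h0, hπ, fun w hw hwv => ⟨hV.ne_of_ne hv hw hwv, ?_⟩⟩
  · obtain ⟨h1, h2⟩ := (hmem r).1 hr
    exact ⟨((hvert _).1 (List.mem_map_of_mem h1)).1, (hup r h1).1 h2⟩
  · have h1 := (hp.pairwise_iff (R := fun a b : Ray d => a.angle ≠ b.angle)
      fun h => h.symm).2 (hne.sublist List.filter_sublist)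
    exact ((List.pairwise_insertionSort (fun a b : Ray d => b.angle ≤ a.angle) _).and h1).imp
      fun h => lt_of_le_of_ne h.1 h.2.symm
  · exact ((hp.map Ray.vert).nodup_iff).2 (hnd.sublist (List.filter_sublist.map _))
  · obtain ⟨r, hr, rfl⟩ := List.mem_map.1 ((hvert w).2 ⟨hw, hwv⟩)
    refine ⟨r, hrays r hr, fun hlt => (hmem r).2 ⟨hr, (hup r hr).2 hlt⟩, fun r' hr' hrr' => ?_⟩
    have h1 : rays.Pairwise fun a b : Ray d => a.angle ≠ b.angle →
        θ ≤ |a.angle - b.angle| ∧ θ ≤ Real.pi - |a.angle - b.angle| :=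
      hθ.imp (S := fun a b : Ray d => a.angle ≠ b.angle → _ ∧ _) fun h _ => h
    exact List.Pairwise.forall_of_forall_of_flip (fun _ _ h => absurd rfl h) h1
      (h1.imp fun h hab => by rw [abs_sub_comm]; exact h hab.symm) hr ((hmem r').1 hr').1 hrr'

/-- The list consists of the edges whose lower vertex is in `pre`. -/
structure IsEdgeList (K : Geometry.SimplicialComplex ℝ (E d)) (i₁ : Fin d) (V pre : List (Vertex d))
    (edges : List (Vertex d × Vertex d)) : Prop where
  nodup : edges.Nodup
  mem : ∀ v w, (v, w) ∈ edges ↔ v ∈ pre ∧ w ∈ V ∧ Adj K v w ∧ v.pos i₁ < w.pos i₁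

theorem IsEdgeList.length_le (hV : IsVertexList K i₁ V) {pre : List (Vertex d)}
    (hpre : ∀ v ∈ pre, v ∈ V) {edges : List (Vertex d × Vertex d)}
    (h : IsEdgeList K i₁ V pre edges) : edges.length ≤ K.vertices.ncard ^ 2 := by
  rw [← hV.length, sq, ← List.length_product]
  refine (h.nodup.subperm fun e he => ?_).length_le
  obtain ⟨h1, h2, -⟩ := (h.mem e.1 e.2).1 he
  exact List.mem_product.2 ⟨hpre _ h1, h2⟩

/-- Vertices are processed in ascending order, so the edges from all lower neighbours of v are
already in the list when v is reached. -/
theorem IsEdgeList.isKnown (hV : IsVertexList K i₁ V) {v : Vertex d} {pre suf : List (Vertex d)}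
    (hl : V = pre ++ v :: suf) {edges : List (Vertex d × Vertex d)}
    (h : IsEdgeList K i₁ V pre edges) :
    IsKnown K i₁ V v [] ((edges.filter fun e => decide (e.2.id = v.id)).map Prod.fst) := by
  have hv : v ∈ V := by simp [hl]
  have he : ∀ e ∈ edges.filter fun e => decide (e.2.id = v.id), e ∈ edges ∧ e.2 = v := by
    intro e he
    rw [List.mem_filter, decide_eq_true_eq] at he
    exact ⟨he.1, hV.id_inj ((h.mem e.1 e.2).1 he.1).2.1 hv he.2⟩
  refine ⟨(List.nodup_map_iff_inj_on (h.nodup.filter _)).2 fun e h1 e' h1' hee' =>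
    Prod.ext hee' ((he e h1).2.trans (he e' h1').2.symm), fun w => ?_⟩
  have hsorted := hV.sorted
  rw [hl, List.pairwise_append, List.pairwise_cons] at hsorted
  rw [List.mem_map]
  constructor
  · rintro ⟨e, h1, rfl⟩
    obtain ⟨h2, rfl⟩ := he e h1
    obtain ⟨h3, h4, h5, h6⟩ := (h.mem e.1 e.2).1 h2
    exact ⟨by rw [hl]; simp [h3], h5.symm, Or.inl h6⟩
  · rintro ⟨h1, h2, h3 | ⟨r, hr, -⟩⟩
    · refine ⟨(w, v), List.mem_filter.2 ⟨(h.mem w v).2 ⟨?_, hv, h2.symm, h3⟩, by simp⟩, rfl⟩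
      rw [hl, List.mem_append, List.mem_cons] at h1
      rcases h1 with h1 | rfl | h1
      · exact h1
      · exact absurd h3 (lt_irrefl _)
      · exact absurd h3 (hsorted.2.1.1 w h1).not_gt
    · simp at hr

/-- An upper bound for the number of steps of `findEdges`. -/
def edgesCost (d N n : ℕ) : ℕ := n * (upEdgesCost d N n + n * (n * 15) + n * 25 + 3) + d * 2 + 1

theorem spec_findEdges (hK : K.faces.Finite) (hO : IsOracleFor F O K) (hV : IsVertexList K i₁ V)
    (hi : i₁ ≠ i₂) (hcol : PlaneGeneral i₁ i₂ K.vertices) :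
    Spec O (findEdges i₁ i₂ V) (IsEdgeList K i₁ V V)
      (edgesCost d K.faces.ncard K.vertices.ncard)
      (1 + K.vertices.ncard * ((K.vertices.ncard * 2 + 1) * 2)) := by
  classical
  have hs : (WithLp.toLp 2 fun j => if j = i₁ then -1 else 0 : E d) = -EuclideanSpace.single i₁ 1 := by
    ext j
    by_cases h : j = i₁ <;> simp [h]
  set n := K.vertices.ncard with hn
  set c := upEdgesCost d K.faces.ncard n with hc
  have hVl := hV.length
  refine Spec.cost (s := d * (1 + 1) + (1 + V.length * (n * 3 + (n * 12 + (n * (n * 6) +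
    (n * 3 + (n * (n * 2 + 1) + (n ^ 2 * 3 + (n * 2 + (c + (n * 2 + (n + 1))))))))) + 1)))
    (q := 0 + (1 + V.length * ((n * 2 + 1) * 2)))
    (Spec.bind_eq (a := -EuclideanSpace.single i₁ 1) ((Spec.vecC _ fun i => Spec.op rfl).imp
      fun a ha => ha.trans hs)
    (Spec.bind_eq (Spec.query _) (Spec.foldC (fun pre edges => IsEdgeList K i₁ V pre edges) ?_ ?_)))
    ?_ ?_
  · exact ⟨List.nodup_nil, by simp⟩
  · intro pre v suf edges hl hedges
    have hv : v ∈ V := by simp [hl]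
    have hVlen := hV.length
    have hothers : (V.filter fun w => decide (w.id ≠ v.id)).length ≤ n :=
      (List.length_filter_le _ _).trans_eq hVl
    refine Spec.cost (q := 0 + (0 + (0 + (0 + (0 + (0 + (0 + ((n * 2 + 1) * 2 + (0 + 0)))))))))
      (Spec.bind_eq (s := n * 3) (q := 0) ((Spec.filterC (s := 1) (q := 0)
        (fun w : Vertex d => decide (w.id ≠ v.id)) fun w _ => Spec.op rfl).cost
        (Nat.mul_le_mul_right _ hVl.le) (by simp))
      (Spec.bind (s := n * 12) (q := 0) ((Spec.mapC_forall (s := 11) (q := 0)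
        (fun w r => IsRay i₁ i₂ v w r) fun w hw => ?_).cost (Nat.mul_le_mul_right _ hothers)
        (by simp)) fun rays hrays => ?_)) le_rfl (by omega)
    · rw [List.mem_filter, decide_eq_true_eq] at hw
      refine spec_rayC (Ne.symm (hV.ne_of_ne hv hw.1 fun e => hw.2 (by rw [e])))
    · have hrlen : rays.length ≤ n := hrays.length_eq ▸ hothers
      have hmap : rays.map Ray.vert = V.filter fun w => decide (w.id ≠ v.id) := by
        clear hrlen
        generalize (V.filter fun w => decide (w.id ≠ v.id)) = others at hrays
        induction hrays with
        | nil => rfl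
        | cons h1 _ ih => rw [List.map_cons, h1.vert, ih]
      have hray : ∀ r ∈ rays, IsRay i₁ i₂ v r.vert r := by
        intro r hr
        clear hmap hrlen
        generalize (V.filter fun w => decide (w.id ≠ v.id)) = others at hrays
        induction hrays with
        | nil => simp at hr
        | cons h1 _ ih =>
          rcases List.mem_cons.1 hr with rfl | hr
          · rwa [h1.vert]
          · exact ih hr
      have hmem : ∀ r ∈ rays, IsRay i₁ i₂ v r.vert r ∧ r.vert ∈ V ∧ r.vert ≠ v := by
        intro r hr
        have h1 := List.mem_map_of_mem (f := Ray.vert) hr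
        rw [hmap, List.mem_filter, decide_eq_true_eq] at h1
        exact ⟨hray r hr, h1.1, fun e => h1.2 (by rw [e])⟩
      have hne := pairwise_angle_ne hV hcol hv (hmap ▸ hV.nodup'.filter _) hmem
      have hklen := (hedges.isKnown hV hl).length_le hV
      have helen := hedges.length_le hV (fun w hw => by rw [hl]; simp [hw])
      refine Spec.bind (s := n * (n * 6)) ((spec_minAngle rays (fun r hr =>
        ⟨(hray r hr).pos, (hray r hr).lt_pi⟩) hne).cost (by gcongr) le_rfl) fun θ hθ => ?_
      have hfan := isFan_insertionSort hV hv hmap hray hθ.1.1 hθ.1.2 hne hθ.2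
      have hulen : (rays.filter fun r => r.up).length ≤ n :=
        (List.length_filter_le _ _).trans hrlen
      refine Spec.bind_eq (s := n * 3) ((Spec.filterC (s := 1) (q := 0) (fun r : Ray d => r.up)
        fun r _ => Spec.op rfl).cost (by gcongr) (by simp)) (Spec.bind_eq (s := n * (n * 2 + 1))
        ((Spec.sortC (s := 1) (fun a b : Ray d => b.angle ≤ a.angle)
        (fun a b => Spec.op rfl) _).cost (by gcongr) le_rfl) (Spec.bind_eq (s := n ^ 2 * 3)
        ((Spec.filterC (s := 1) (q := 0) (fun e : Vertex d × Vertex d => decide (e.2.id = v.id))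
        fun r _ => Spec.op rfl).cost (by gcongr) (by simp)) (Spec.bind_eq (s := n * 2)
        ((Spec.mapC (s := 1) (q := 0) (Prod.fst : Vertex d × Vertex d → Vertex d)
        fun e _ => Spec.op rfl).cost ?_ (by simp)) (Spec.bind
        (spec_findUpEdges hK hO hV hi hv hfan (hedges.isKnown hV hl)) fun new hnew =>
        Spec.bind_eq (s := n * 2) ((Spec.mapC (s := 1) (q := 0) (fun w => (v, w))
        fun w _ => Spec.op rfl).cost (Nat.mul_le_mul_right _ hnew.2.1) (by simp))
        ((spec_appendC _ _).mono ?_ ?_ le_rfl)))))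
      · rw [List.length_map] at hklen
        exact Nat.mul_le_mul_right _ hklen
      · rintro _ rfl
        refine ⟨List.nodup_append.2 ⟨hnew.1.map fun a b h => congrArg Prod.snd h, hedges.nodup,
          ?_⟩, fun a b => ?_⟩
        · rintro e he e' he' rfl
          obtain ⟨w, hw, rfl⟩ := List.mem_map.1 he
          have h1 := ((hedges.mem v w).1 he').1
          have hnd := hV.nodup'
          rw [hl, List.nodup_append] at hnd
          exact hnd.2.2 v h1 v (by simp) rfl
        · rw [List.mem_append, hedges.mem, List.mem_map, List.mem_append, List.mem_singleton]
          constructor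
          · rintro (⟨w, hw, e⟩ | ⟨h1, h2⟩)
            · obtain ⟨rfl, rfl⟩ := Prod.mk.inj e
              obtain ⟨h1, h2, h3⟩ := (hnew.2.2 w).1 hw
              exact ⟨Or.inr rfl, h1, h2, h3⟩
            · exact ⟨Or.inl h1, h2⟩
          · rintro ⟨h1 | rfl, h2⟩
            · exact Or.inr ⟨h1, h2⟩
            · exact Or.inl ⟨b, (hnew.2.2 b).2 ⟨h2.1, h2.2.1, h2.2.2⟩, rfl⟩
      · rw [List.length_map]
        exact Nat.succ_le_succ hnew.2.1
  · rw [edgesCost, hVl, ← hn, ← hc]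
    have : n * (n * 3 + (n * 12 + (n * (n * 6) + (n * 3 + (n * (n * 2 + 1) + (n ^ 2 * 3 +
      (n * 2 + (c + (n * 2 + (n + 1))))))))) + 1) ≤ n * (c + n * (n * 15) + n * 25 + 3) := by
      refine Nat.mul_le_mul_left _ ?_
      rw [sq]
      nlinarith
    omega
  · rw [hVl, ← hn]
    omega

end FindEdges
/-! ### Testing for a simplex -/

section IsSimplex

variable {d : ℕ} {F : Type*} [Field F] {K : Geometry.SimplicialComplex ℝ (E d)} {O : Oracle d}
  {i₁ : Fin d} {V : List (Vertex d)}

open scoped Classical in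
-- A simplex with |τ| + 1 vertices that contains τ has a single further vertex. Admitting x
-- therefore adds at most the simplex on τ and x.
theorem cofaceCount_insert (hK : K.faces.Finite) {τ ρ₀ : Finset (E d)} {x : E d} {B : Set (E d)}
    (hx : x ∉ τ) (hxB : x ∉ B) (hρ₀ : ∀ y, y ∈ ρ₀ ↔ y = x ∨ y ∈ τ) :
    cofaceCount K τ.card (insert x B) τ
      = cofaceCount K τ.card B τ + if ρ₀ ∈ K.faces then 1 else 0 := by
  have hcard : ρ₀.card = τ.card + 1 := by
    rw [← Finset.card_insert_of_notMem hx]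
    congr 1
    ext y
    rw [hρ₀, Finset.mem_insert]
  have key : ∀ ρ : Finset (E d), ρ.card = τ.card + 1 → τ ⊆ ρ → x ∈ ρ → ρ = ρ₀ := by
    intro ρ hc hτ hxρ
    refine (Finset.eq_of_subset_of_card_le (fun y hy => ?_) (by omega)).symm
    rcases (hρ₀ y).1 hy with rfl | h
    exacts [hxρ, hτ h]
  have hmem : ∀ ρ, (ρ ∈ K.faces ∧ ρ.card = τ.card + 1 ∧ τ ⊆ ρ ∧ ∀ y ∈ ρ, y ∉ τ → y ∈ insert x B) ↔
      (ρ = ρ₀ ∧ ρ₀ ∈ K.faces) ∨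
        (ρ ∈ K.faces ∧ ρ.card = τ.card + 1 ∧ τ ⊆ ρ ∧ ∀ y ∈ ρ, y ∉ τ → y ∈ B) := by
    intro ρ
    constructor
    · rintro ⟨h1, h2, h3, h4⟩
      by_cases hxρ : x ∈ ρ
      · have := key ρ h2 h3 hxρ
        exact Or.inl ⟨this, this ▸ h1⟩
      · refine Or.inr ⟨h1, h2, h3, fun y hy hyτ => ?_⟩
        rcases h4 y hy hyτ with rfl | h
        exacts [absurd hy hxρ, h]
    · rintro (⟨rfl, h1⟩ | ⟨h1, h2, h3, h4⟩)
      · refine ⟨h1, hcard, fun y hy => (hρ₀ y).2 (Or.inr hy), fun y hy hyτ => ?_⟩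
        exact Or.inl (((hρ₀ y).1 hy).resolve_right hyτ)
      · exact ⟨h1, h2, h3, fun y hy hyτ => Or.inr (h4 y hy hyτ)⟩
  have hfin : {ρ ∈ K.faces | ρ.card = τ.card + 1 ∧ τ ⊆ ρ ∧ ∀ y ∈ ρ, y ∉ τ → y ∈ B}.Finite :=
    hK.subset fun ρ h => h.1
  rw [cofaceCount, cofaceCount]
  split_ifs with h
  · rw [← Set.ncard_insert_of_notMem (a := ρ₀) _ hfin]
    · congr 1
      ext ρ
      rw [Set.mem_insert_iff]
      exact (hmem ρ).trans (or_congr (and_iff_left h) Iff.rfl)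
    · rintro ⟨-, -, -, h4⟩
      exact hxB (h4 x ((hρ₀ x).2 (Or.inl rfl)) hx)
  · rw [add_zero]
    congr 1
    ext ρ
    exact (hmem ρ).trans (or_iff_right fun h' => h h'.2)

/-- If `s₁` and `s₂` are constant on `τ`, and `s₂` separates it from the other vertices, then the
vertices at the height of `τ` in the tilt of `s₁` towards `s₂` are those of `τ`. -/
theorem levelAt_of_isTilt {τ : Finset (E d)} {p s₁ s₂ s : E d} (hu : IsTilt K s₁ s₂ s)
    (hp : p ∈ K.vertices) (h1 : ∀ x ∈ τ, inner ℝ s₁ x = inner ℝ s₁ p)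
    (h2 : ∀ x ∈ τ, inner ℝ s₂ x = inner ℝ s₂ p)
    (h3 : ∀ x ∈ K.vertices, x ∉ τ → inner ℝ s₂ x ≠ inner ℝ s₂ p) :
    LevelAt K s (inner ℝ s p) τ {x | inner ℝ s x < inner ℝ s p} := by
  intro x hx
  refine ⟨⟨fun hxτ => ((hu x hx p hp).2 (h1 x hxτ)).2 (h2 x hxτ), fun e => ?_⟩, Iff.rfl⟩
  by_contra hxτ
  rcases lt_trichotomy (inner ℝ s₁ x) (inner ℝ s₁ p) with h | h | h
  · exact ((hu x hx p hp).1 h).ne e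
  · rcases lt_or_gt_of_ne (h3 x hx hxτ) with h' | h'
    · exact (((hu x hx p hp).2 h).1 h').ne e
    · exact (((hu p hp x hx).2 h.symm).1 h').ne' e
  · exact ((hu p hp x hx).1 h).ne' e

theorem LevelAt.neg {s : E d} {c : ℝ} {τ : Finset (E d)} {B B' : Set (E d)}
    (h : LevelAt K s c τ B) (hB : ∀ x ∈ K.vertices, x ∈ B' ↔ x ∉ τ ∧ x ∉ B) :
    LevelAt K (-s) (-c) τ B' := by
  intro x hx
  rw [inner_neg_left, neg_inj, neg_lt_neg_iff, hB x hx, (h x hx).1, (h x hx).2]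
  refine ⟨Iff.rfl, ?_⟩
  rw [not_lt]
  exact ⟨fun h' => lt_of_le_of_ne h'.2 (Ne.symm h'.1), fun h' => ⟨h'.ne', h'.le⟩⟩

open scoped Classical in
-- The tilt of s lifts x above τ, which leaves B below. The tilt of -s also lifts x above τ, so
-- after negation x lies below τ and joins B. In both cases τ alone remains on the level.
theorem cofaceCount_of_tilts (hK : K.faces.Finite) {τ ρ₀ : Finset (E d)} {x p s s₃ sL sU : E d}
    {c : ℝ} {B : Set (E d)} (hx : x ∉ τ) (hρ₀ : ∀ y, y ∈ ρ₀ ↔ y = x ∨ y ∈ τ)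
    (hρK : ∀ y ∈ ρ₀, y ∈ K.vertices) (hp : p ∈ τ) (hlev : LevelAt K s c ρ₀ B)
    (hcon : ∀ y ∈ τ, inner ℝ s₃ y = inner ℝ s₃ p) (hxp : inner ℝ s₃ p < inner ℝ s₃ x)
    (hL : IsTilt K s s₃ sL) (hU : IsTilt K (-s) s₃ sU) :
    LevelAt K sL (inner ℝ sL p) τ B ∧ LevelAt K (-sU) (-inner ℝ sU p) τ (insert x B) ∧
      cofaceCount K τ.card (insert x B) τ
        = cofaceCount K τ.card B τ + if ρ₀ ∈ K.faces then 1 else 0 := by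
  have hneg : LevelAt K (-s) (-c) ρ₀ {y | y ∉ ρ₀ ∧ y ∉ B} := hlev.neg fun y _ => Iff.rfl
  have hsub : τ ⊆ ρ₀ := fun y hy => (hρ₀ y).2 (Or.inr hy)
  have hup : ∀ y ∈ ρ₀, y ∉ τ → inner ℝ s₃ p < inner ℝ s₃ y := by
    intro y hy hy'
    rwa [((hρ₀ y).1 hy).resolve_right hy']
  have hB : ∀ y ∈ ρ₀, y ∉ B := fun y hy h =>
    ((hlev y (hρK y hy)).2.1 h).ne ((hlev y (hρK y hy)).1.1 hy)
  refine ⟨hlev.tilt hL hp hsub hρK hcon hup, (hneg.tilt hU hp hsub hρK hcon hup).neg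
    fun y hy => ?_, cofaceCount_insert hK hx (hB x ((hρ₀ x).2 (Or.inl rfl))) hρ₀⟩
  rw [Set.mem_insert_iff, Set.mem_ofPred_eq, not_and_or, not_not, not_not]
  constructor
  · rintro (rfl | h)
    · exact ⟨hx, Or.inl ((hρ₀ y).2 (Or.inl rfl))⟩
    · exact ⟨fun h' => hB y (hsub h') h, Or.inr h⟩
  · rintro ⟨h1, h2 | h2⟩
    · exact Or.inl (((hρ₀ y).1 h2).resolve_right h1)
    · exact Or.inr h2

/-- An upper bound for the number of steps of `isSimplex`, for a simplex with `k` vertices. -/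
def simplexCost (d N n k : ℕ) : ℕ :=
  k * 3 + (k + 1) * gramStep d k + (d * (k * (d * 6 + 1) + d * 8 + 5)) + n * (k * 2 + 7)
    + sepCost d k n + tiltVCost d n * 3 + liftCost d (k + 1) + indegreeCost d N n k k * 2 + 4

theorem exists_spec_others (hV : IsVertexList K i₁ V) {τ : Simplex d} (hτ : ∀ w ∈ τ, w ∈ V) :
    ∃ Q : List (Vertex d), Q.length ≤ K.vertices.ncard ∧
      (∀ x, x ∈ Q.map Vertex.pos ↔ x ∈ K.vertices ∧ x ∉ pts τ) ∧
      Spec O (filterC (fun q => do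
        let t ← memC q τ
        op (!t)) V) (· = Q) (K.vertices.ncard * (τ.length * 2 + 1 + 2)) 0 := by
  have hVl := hV.length
  refine ⟨_, (List.length_filter_le _ _).trans hVl.le, fun x => ?_, (Spec.filterC
    (s := τ.length * 2 + 1) (q := 0) (fun q => !decide (∃ w ∈ τ, w.id = q.id))
    fun q _ => Spec.cost (s := τ.length * 2 + 1) (q := 0 + 0) (Spec.bind_eq
    (spec_memC q τ) Spec.op_rfl) le_rfl le_rfl).cost (Nat.mul_le_mul_right _ hVl.le) (by simp)⟩
  simp only [List.mem_map, List.mem_filter, Bool.not_eq_true', decide_eq_false_iff_not]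
  constructor
  · rintro ⟨q, ⟨hq, hq'⟩, rfl⟩
    refine ⟨hV.pos_mem hq, fun h => hq' ?_⟩
    obtain ⟨w, hw, e⟩ := mem_pts.1 h
    exact ⟨w, hw, by rw [hV.pos_inj (hτ w hw) hq e]⟩
  · rintro ⟨hx, hx'⟩
    obtain ⟨q, hq, rfl⟩ := hV.exists_mem hx
    refine ⟨q, ⟨hq, ?_⟩, rfl⟩
    rintro ⟨w, hw, e⟩
    exact hx' (hV.id_inj (hτ w hw) hq e ▸ pos_mem_pts hw)

theorem simplexCost_bound (d N n m : ℕ) :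
    (m + 1) + ((m + 1) * (1 + 1) + (m * gramStep d (0 + m) +
    (1 * gramStep d (m + 1) + ((d * ((m + 1) * (d * 6 + 1) + d * 4 + 1) + d * 4 + 1) +
    (n * ((m + 1 + 1) * 2 + 1 + 2) + (n * (1 + 1) + (sepCost d (m + 1) n + (tiltVCost d n +
    (liftCost d (m + 1 + 1) + (tiltVCost d n + (d * (1 + 1) + (tiltVCost d n + (d * (1 + 1) +
    (indegreeCost d N n (m + 1) (m + 1) + (indegreeCost d N n (m + 1) (m + 1) +
    (1 + (1 + 1))))))))))))))))) ≤ simplexCost d N n (m + 1) := by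
  have e1 : m * gramStep d (0 + m) ≤ m * gramStep d (m + 1) := by
    rw [zero_add]
    unfold gramStep
    gcongr
    omega
  have e2 : (m + 1 + 1) * gramStep d (m + 1)
      = m * gramStep d (m + 1) + gramStep d (m + 1) * 2 := by ring
  have e3 : d * ((m + 1) * (d * 6 + 1) + d * 8 + 5) = d * ((m + 1) * (d * 6 + 1) + d * 4 + 1)
      + d * (d * 4) + d * 4 := by ring
  have e4 : d * 4 ≤ d * (d * 4) := by
    rw [← mul_assoc]
    exact Nat.mul_le_mul_right _ (Nat.le_mul_self d)
  have e5 : n * ((m + 1) * 2 + 7) = n * ((m + 1 + 1) * 2 + 1 + 2) + n * (1 + 1) := by ring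
  rw [simplexCost, e2, e3, e5]
  omega

/-- General position enters twice. The vertices of σ and v span fewer than d dimensions, so a
direction constant on them exists; and any further vertex is affinely independent of them, so its
difference from p is outside the span and it can be moved off the level. -/
theorem spec_isSimplex (hK : K.faces.Finite) (hO : IsOracleFor F O K) (hV : IsVertexList K i₁ V)
    (hA : ∀ S : Finset (E d), (S : Set (E d)) ⊆ K.vertices → S.card ≤ d + 1 →
      AffineIndependent ℝ ((↑) : S → E d))
    {σ : Simplex d} (hσ : IsVertexSubset V σ) (hface : pts σ ∈ K.faces) (hσd : σ.length < d)
    {v : Vertex d} (hv : v ∈ V) (hvσ : v ∉ σ) :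
    Spec O (isSimplex V σ v) (fun t => t = true ↔ pts (v :: σ) ∈ K.faces)
      (simplexCost d K.faces.ncard K.vertices.ncard σ.length) (2 ^ σ.length * 2) := by
  classical
  have hne : σ ≠ [] := by
    rintro rfl
    exact (face_nonempty hface).ne_empty rfl
  obtain ⟨w₀, σ', hσ'⟩ := List.exists_cons_of_ne_nil hne
  set p := w₀.pos with hp
  have hw₀ : w₀ ∈ σ := by simp [hσ']
  have hpK : p ∈ K.vertices := hV.pos_mem (hσ.mem _ hw₀)
  have hσmap : σ.map Vertex.pos = p :: σ'.map Vertex.pos := by rw [hσ', List.map_cons]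
  have hlen : σ.length = σ'.length + 1 := by rw [hσ', List.length_cons]
  -- Used for X = [v] and for X = [v, w] with a further vertex w; the latter is where as many as d +
  -- 1 points may occur.
  have hindep : ∀ X : List (Vertex d), (∀ x ∈ X, x ∈ V) → (σ ++ X).Nodup →
      σ.length + X.length ≤ d + 1 → IndepFrom p (σ'.map Vertex.pos ++ X.map Vertex.pos) := by
    intro X hX hnd hle
    have hall : ∀ x ∈ σ ++ X, x ∈ V := fun x hx => (List.mem_append.1 hx).elim (hσ.mem x) (hX x)
    have hnd' : ((σ ++ X).map Vertex.pos).Nodup := (List.nodup_map_iff_inj_on hnd).2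
      fun x hx y hy e => hV.pos_inj (hall x hx) (hall y hy) e
    refine indepFrom_of_affineIndependent (A := ((pts (σ ++ X) : Finset (E d)) : Set (E d)))
      (hA _ ?_ ?_) ?_ ?_
    · intro x hx
      obtain ⟨w, hw, rfl⟩ := mem_pts.1 hx
      exact hV.pos_mem (hall w hw)
    · refine (List.toFinset_card_le _).trans ?_
      rwa [List.length_map, List.length_append]
    · intro x hx
      rw [← List.cons_append, ← hσmap, ← List.map_append] at hx
      obtain ⟨w, hw, rfl⟩ := List.mem_map.1 hx
      exact pos_mem_pts hw
    · rwa [← List.cons_append, ← hσmap, ← List.map_append]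
  have hnd1 : (σ ++ [v]).Nodup := List.nodup_append.2 ⟨hσ.nodup, by simp, by
    rintro a ha b hb rfl
    exact hvσ (List.mem_singleton.1 hb ▸ ha)⟩
  have hind1 := hindep [v] (by simpa using hv) hnd1 (by simp; omega)
  set n := K.vertices.ncard with hn
  have hVl := hV.length
  have hvσ' : v.pos ∉ pts σ := fun h => hvσ ((hσ.mem_iff hV hv).1 h)
  have hmemτ : ∀ {x : E d}, x ∈ pts (v :: σ) ↔ x = v.pos ∨ x ∈ pts σ := by
    intro x
    rw [mem_pts, mem_pts]
    simp [eq_comm]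
  have hτK : ∀ x ∈ pts (v :: σ), x ∈ K.vertices := by
    intro x hx
    rcases hmemτ.1 hx with rfl | hx
    exacts [hV.pos_mem hv, mem_vertices_of_mem_face hface hx]
  have hpσ : p ∈ pts σ := pos_mem_pts hw₀
  have hlift : Spec O (liftingDir (p :: σ'.map Vertex.pos) [v.pos])
      (fun s => ‖s‖ = 1 ∧ IsLifting σ (v :: σ) s) (liftCost d (σ.length + 1)) 0 := by
    rw [← hσmap]
    refine spec_liftingDir_faces (X := [v]) hV (A := ((pts (σ ++ [v]) : Finset (E d)) : Set (E d)))
      (hA _ ?_ ?_) (fun w hw => ⟨?_, pos_mem_pts hw⟩) hnd1 hne (by simp) ?_ (by simp)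
    · intro x hx
      obtain ⟨w, hw, rfl⟩ := mem_pts.1 hx
      rcases List.mem_append.1 hw with hw | hw
      · exact hV.pos_mem (hσ.mem w hw)
      · exact hV.pos_mem (List.mem_singleton.1 hw ▸ hv)
    · refine (List.toFinset_card_le _).trans ?_
      rw [List.length_map, List.length_append, List.length_singleton]
      omega
    · rcases List.mem_append.1 hw with hw | hw
      · exact hσ.mem w hw
      · exact List.mem_singleton.1 hw ▸ hv
    · intro w hw hwσ
      rcases List.mem_cons.1 hw with rfl | hw
      · simp
      · exact absurd hw hwσ
  have hcard : (pts σ).card = σ.length := hσ.card_pts hV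
  have hpos : 1 ≤ σ.length := by omega
  refine Spec.cost (s := σ.length + (σ.length * (1 + 1) + (σ'.length * gramStep d (0 + σ'.length) +
    (1 * gramStep d σ.length + ((d * (σ.length * (d * 6 + 1) + d * 4 + 1) + d * 4 + 1) +
    (n * ((σ.length + 1) * 2 + 1 + 2) + (n * (1 + 1) + (sepCost d σ.length n + (tiltVCost d n +
    (liftCost d (σ.length + 1) + (tiltVCost d n + (d * (1 + 1) + (tiltVCost d n + (d * (1 + 1) +
    (indegreeCost d K.faces.ncard n σ.length σ.length +
    (indegreeCost d K.faces.ncard n σ.length σ.length + (1 + (1 + 1))))))))))))))))))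
    (q := σ.length * 0 + (0 + (0 + (0 + (0 + (0 + (0 + (0 + (0 + (0 + (0 + (0 + (0 +
      (2 ^ σ.length + (2 ^ σ.length + 0)))))))))))))))
    (Spec.bind_charge (Spec.bind_eq (Spec.mapC (s := 1) (q := 0) Vertex.pos
      fun w _ => Spec.op rfl) ?_)) ?_ ?_
  · dsimp only
    rw [hσmap]
    dsimp only [List.headD_cons, List.tail_cons]
    refine Spec.bind ((spec_gramSchmidt (base := []) (xs := σ'.map Vertex.pos) orthonormalList_nil
      (by simp [dirSpan]) hind1.append_left).cost (by simp) le_rfl) fun us₀ hus₀ =>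
      Spec.bind ((spec_gramSchmidt (base := σ'.map Vertex.pos) (xs := [v.pos]) hus₀.1 hus₀.2.1
      hind1).cost (by rw [hus₀.2.2, hlen]; simp) le_rfl) fun us hus => ?_
    have huslen : us.length = σ.length := by
      rw [hus.2.2, hus₀.2.2, hlen]
      simp
    have hspan : ∀ x ∈ pts (v :: σ), x - p ∈ listSpan us := by
      intro x hx
      rw [hus.2.1, dirSpan]
      have hx' : x = p ∨ x ∈ σ'.map Vertex.pos ++ [v.pos] := by
        rcases hmemτ.1 hx with rfl | hx
        · simp
        · obtain ⟨w, hw, rfl⟩ := mem_pts.1 hx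
          rw [hσ', List.mem_cons] at hw
          rcases hw with rfl | hw
          · exact Or.inl rfl
          · exact Or.inr (by simp; exact Or.inl ⟨w, hw, rfl⟩)
      rcases hx' with rfl | hx'
      · rw [sub_self]
        exact Submodule.zero_mem _
      · exact mem_listSpan (List.mem_map_of_mem hx')
    have hperp : ∀ t : E d, (∀ u ∈ us, inner ℝ u t = 0) → ∀ x ∈ pts (v :: σ),
        inner ℝ t x = inner ℝ t p := by
      intro t ht x hx
      have := inner_eq_zero_of_mem_listSpan ht (hspan x hx)
      rw [real_inner_comm, inner_sub_right] at this
      linarith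
    obtain ⟨Q, hQlen, hQmem, hQ⟩ := exists_spec_others (O := O) hV (τ := v :: σ) fun w hw =>
      (List.mem_cons.1 hw).elim (fun e => e ▸ hv) (hσ.mem w)
    have hQspan : ∀ q ∈ Q.map Vertex.pos,
        q - p ∉ listSpan us := by
      intro q hq
      obtain ⟨hqK, hqτ⟩ := (hQmem q).1 hq
      obtain ⟨w, hw, rfl⟩ := hV.exists_mem hqK
      rw [hus.2.1]
      refine hindep [v, w] (by simp [hv, hw]) ?_ (by simp; omega) _ w.pos [] (by simp)
      have hwτ : w ≠ v ∧ w ∉ σ := by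
        constructor
        · rintro rfl
          exact hqτ (hmemτ.2 (Or.inl rfl))
        · exact fun h => hqτ (hmemτ.2 (Or.inr (pos_mem_pts h)))
      rw [show σ ++ [v, w] = σ ++ [v] ++ [w] by simp]
      refine List.nodup_append.2 ⟨hnd1, by simp, ?_⟩
      rintro a ha b hb rfl
      rw [List.mem_singleton.1 hb, List.mem_append, List.mem_singleton] at ha
      exact ha.elim hwτ.2 hwτ.1
    refine Spec.bind ((spec_perpDir hus.1 (huslen ▸ hσd)).cost (by rw [huslen]) le_rfl)
      fun s₁ hs₁ => Spec.bind_eq hQ (Spec.bind_eq ((Spec.mapC (s := 1) (q := 0) Vertex.pos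
      fun w _ => Spec.op rfl).cost (Nat.mul_le_mul_right _ hQlen) (by simp)) (Spec.bind
      ((spec_separatingDir hus.1 hs₁.1 hs₁.2 hQspan).cost ?_ le_rfl) fun s₂ hs₂ => ?_))
    · rw [huslen, List.length_map]
      unfold sepCost
      gcongr
    obtain ⟨hs₂n, hs₂p, hs₂Q, hs₂e⟩ := hs₂
    -- Without further vertices s₂ is s₁ itself; otherwise s₂ separates one of them from p. Either
    -- way the tilt of s₁ towards s₂ is not zero.
    have h12 : s₂ = s₁ ∨ ∃ x ∈ K.vertices, ∃ y ∈ K.vertices, inner ℝ s₂ x < inner ℝ s₂ y := by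
      rcases List.eq_nil_or_concat
        (Q.map Vertex.pos) with h | ⟨l, q, h⟩
      · exact Or.inl (hs₂e h)
      · have hq : q ∈ Q.map Vertex.pos := by
          rw [h]; simp
        have h1 := hs₂Q q hq
        rw [inner_sub_right, Ne, sub_eq_zero] at h1
        have hqK := ((hQmem q).1 hq).1
        rcases lt_or_gt_of_ne h1 with h1 | h1
        · exact Or.inr ⟨q, hqK, p, hpK, h1⟩
        · exact Or.inr ⟨p, hpK, q, hqK, h1⟩
    refine Spec.bind (spec_tiltV hV hs₁.1 hs₂n h12) fun s hs => Spec.bind hlift fun s₃ hs₃ => ?_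
    have hlev : LevelAt K s (inner ℝ s p) (pts (v :: σ)) {x | inner ℝ s x < inner ℝ s p} :=
      levelAt_of_isTilt hs.2 hpK (hperp s₁ hs₁.2) (hperp s₂ hs₂p) fun x hx hxτ e => by
        refine hs₂Q x ((hQmem x).2 ⟨hx, hxτ⟩) ?_
        rw [inner_sub_right, e, sub_self]
    have hcon : ∀ x ∈ pts σ, inner ℝ s₃ x = inner ℝ s₃ p := by
      intro x hx
      obtain ⟨w, hw, rfl⟩ := mem_pts.1 hx
      exact hs₃.2.1 w hw w₀ hw₀
    have hvp : inner ℝ s₃ p < inner ℝ s₃ v.pos := hs₃.2.2 w₀ hw₀ v (by simp) hvσ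
    have hs3t : ∀ t, s₃ = t ∨ ∃ x ∈ K.vertices, ∃ y ∈ K.vertices, inner ℝ s₃ x < inner ℝ s₃ y :=
      fun t => Or.inr ⟨p, hpK, v.pos, hV.pos_mem hv, hvp⟩
    refine Spec.bind (spec_tiltV hV hs.1 hs₃.1 (hs3t s)) fun sL hsL => Spec.bind_eq (a := -s)
      (Spec.vecC _ fun i => Spec.op rfl) (Spec.bind (spec_tiltV hV (by rw [norm_neg]; exact hs.1)
      hs₃.1 (hs3t (-s))) fun sU' hsU' => Spec.bind_eq (a := -sU')
      (Spec.vecC _ fun i => Spec.op rfl) ?_)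
    obtain ⟨hlevL, hlevU, hcount⟩ := cofaceCount_of_tilts hK hvσ' (fun y => hmemτ) hτK hpσ hlev hcon
      hvp hsL.2 hsU'.2
    rw [hcard] at hcount
    refine Spec.bind_eq (spec_indegree hK hO hV hσ hface (by rw [norm_neg]; exact hsU'.1) hlevU
      hpos le_rfl) (Spec.bind_eq (spec_indegree hK hO hV hσ hface hsL.1 hlevL hpos le_rfl)
      (Spec.bind_op (Spec.bind_op (Spec.op ?_))))
    rw [hcount, decide_eq_true_eq]
    split_ifs with h <;> simp [h]
  · have h := simplexCost_bound d K.faces.ncard n σ'.length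
    rw [← hlen] at h
    exact h
  · omega

end IsSimplex
/-! ### The lists of simplices -/

section NextSimplices

variable {d : ℕ} {F : Type*} [Field F] {K : Geometry.SimplicialComplex ℝ (E d)} {O : Oracle d}
  {i₁ : Fin d} {V : List (Vertex d)}

theorem spec_sameSimplex (σ τ : Simplex d) :
    Spec O (sameSimplex σ τ) (· = decide (σ.map Vertex.id = τ.map Vertex.id))
      (σ.length + τ.length + 1) 0 :=
  Spec.cost (s := σ.length + τ.length + 1 + 0) (q := 0) (Spec.bind_charge (Spec.pure rfl))
    le_rfl le_rfl

/-- The list has no repetitions, and consists of the simplices of `K` that arise by adding a vertex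
to a simplex, for the pairs in `P`. -/
structure IsCollected (K : Geometry.SimplicialComplex ℝ (E d)) (V : List (Vertex d))
    (P : Simplex d → Vertex d → Prop) (L : List (Simplex d)) : Prop where
  nodup : L.Nodup
  mem : ∀ ρ, ρ ∈ L ↔ IsVertexSubset V ρ ∧ pts ρ ∈ K.faces ∧
    ∃ σ v, P σ v ∧ v ∉ σ ∧ ∀ w, w ∈ ρ ↔ w = v ∨ w ∈ σ

theorem length_le_ncard_of_faces (hK : K.faces.Finite) (hV : IsVertexList K i₁ V)
    {L : List (Simplex d)} (hnd : L.Nodup)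
    (h : ∀ ρ ∈ L, IsVertexSubset V ρ ∧ pts ρ ∈ K.faces) : L.length ≤ K.faces.ncard := by
  classical
  have hnd' : (L.map pts).Nodup := (List.nodup_map_iff_inj_on hnd).2 fun ρ hρ τ hτ e =>
    (h ρ hρ).1.eq_of_pts hV (h τ hτ).1 e
  rw [← List.length_map (f := pts), ← List.toFinset_card_of_nodup hnd', ← Set.ncard_coe_finset]
  refine Set.ncard_le_ncard (fun ρ hρ => ?_) hK
  rw [List.coe_toFinset] at hρ
  obtain ⟨σ, hσ, rfl⟩ := List.mem_map.1 hρ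
  exact (h σ hσ).2

theorem spec_addSimplex (hV : IsVertexList K i₁ V) {m N : ℕ} {L : List (Simplex d)}
    {τ : Simplex d} (hτ : IsVertexSubset V τ) (hm : τ.length = m)
    (hL : ∀ ρ ∈ L, IsVertexSubset V ρ ∧ ρ.length = m) (hN : L.length ≤ N) (hnd : L.Nodup) :
    Spec O (addSimplex τ L) (fun L' => L'.Nodup ∧ ∀ ρ, ρ ∈ L' ↔ ρ = τ ∨ ρ ∈ L)
      (N * (m * 2 + 3) + 1) 0 := by
  classical
  refine Spec.cost (s := L.length * (m + m + 1 + 1 + 1) + 1) (q := L.length * 0 + 0)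
    (Spec.bind (Spec.foldC (s := m + m + 1 + 1) (q := 0)
    (fun pre (t : Bool) => t = decide (τ ∈ pre)) (by simp) ?_) ?_) ?_ (by simp)
  · rintro pre ρ suf t hl rfl
    have hρ := hL ρ (by simp [hl])
    refine Spec.cost (q := 0 + 0) (Spec.bind_eq ((spec_sameSimplex ρ τ).cost
      (by rw [hρ.2, hm]) le_rfl) (Spec.op ?_)) le_rfl le_rfl
    rw [Bool.eq_iff_iff]
    simp only [Bool.or_eq_true, decide_eq_true_eq, List.mem_append, List.mem_singleton]
    refine or_congr Iff.rfl ⟨fun h => (hρ.1.eq_of_ids hV hτ h).symm, fun h => by rw [h]⟩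
  · rintro t rfl
    refine Spec.ite (fun h => Spec.pure' ⟨hnd, fun ρ => ?_⟩) fun h => Spec.op' (s := 0)
      ⟨List.nodup_cons.2 ⟨by simpa using h, hnd⟩, fun ρ => List.mem_cons⟩
    rw [decide_eq_true_eq] at h
    exact ⟨Or.inr, fun h' => h'.elim (fun e => e ▸ h) id⟩
  · have := Nat.mul_le_mul_right (m * 2 + 3) hN
    rw [show m + m + 1 + 1 + 1 = m * 2 + 3 by ring]
    omega

theorem orderedInsert_isVertexSubset (hV : IsVertexList K i₁ V) {σ : Simplex d}
    (hσ : IsVertexSubset V σ) {v : Vertex d} (hv : v ∈ V) (hvσ : v ∉ σ) :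
    IsVertexSubset V (σ.orderedInsert (fun a b => a.id ≤ b.id) v) := by
  have : Std.Total fun a b : Vertex d => a.id ≤ b.id := ⟨fun a b => le_total _ _⟩
  have : IsTrans (Vertex d) fun a b => a.id ≤ b.id := ⟨fun a b c h1 h2 => h1.trans h2⟩
  have hp := List.perm_orderedInsert (fun a b : Vertex d => a.id ≤ b.id) v σ
  have hmem : ∀ w ∈ σ.orderedInsert (fun a b : Vertex d => a.id ≤ b.id) v, w ∈ V := by
    intro w hw
    rcases List.mem_cons.1 (hp.mem_iff.1 hw) with rfl | hw
    exacts [hv, hσ.mem w hw]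
  refine ⟨?_, hmem⟩
  have h1 : (σ.orderedInsert (fun a b : Vertex d => a.id ≤ b.id) v).Pairwise
      fun a b => a.id ≤ b.id := (hσ.ids.imp fun h => h.le).orderedInsert v σ
  have h2 : (σ.orderedInsert (fun a b : Vertex d => a.id ≤ b.id) v).Nodup :=
    hp.nodup_iff.2 (List.nodup_cons.2 ⟨hvσ, hσ.nodup⟩)
  exact (h1.and h2).imp_of_mem fun ha hb h =>
    lt_of_le_of_ne h.1 fun e => h.2 (hV.id_inj (hmem _ ha) (hmem _ hb) e)

/-- The list of all simplices of `K` with `k` vertices. -/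
structure IsSimplexList (K : Geometry.SimplicialComplex ℝ (E d)) (V : List (Vertex d)) (k : ℕ)
    (L : List (Simplex d)) : Prop where
  nodup : L.Nodup
  mem : ∀ ρ, ρ ∈ L ↔ IsVertexSubset V ρ ∧ ρ.length = k ∧ pts ρ ∈ K.faces

theorem length_of_mem_iff {σ ρ : Simplex d} {v : Vertex d} (hσ : IsVertexSubset V σ)
    (hρ : IsVertexSubset V ρ) (hv : v ∉ σ) (h : ∀ w, w ∈ ρ ↔ w = v ∨ w ∈ σ) :
    ρ.length = σ.length + 1 := by
  rw [← List.length_cons (a := v)]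
  refine ((List.perm_ext_iff_of_nodup hρ.nodup (List.nodup_cons.2 ⟨hv, hσ.nodup⟩)).2
    fun w => ?_).length_eq
  rw [h, List.mem_cons]

theorem pts_eq_of_mem_iff {σ ρ : Simplex d} {v : Vertex d}
    (h : ∀ w, w ∈ ρ ↔ w = v ∨ w ∈ σ) : pts ρ = pts (v :: σ) := by
  ext x
  rw [mem_pts, mem_pts]
  simp only [h, List.mem_cons]

/-- Pairs that do not give a simplex of K may be added to the description without effect; this
accounts for iterations that leave the list unchanged. -/
theorem IsCollected.congr {P P' : Simplex d → Vertex d → Prop} {L : List (Simplex d)}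
    (h : IsCollected K V P L) (h1 : ∀ σ v, P σ v → P' σ v)
    (h2 : ∀ σ v, P' σ v → v ∉ σ → pts (v :: σ) ∈ K.faces → P σ v) : IsCollected K V P' L := by
  refine ⟨h.nodup, fun ρ => (h.mem ρ).trans (and_congr_right fun _ => and_congr_right fun hf => ?_)⟩
  constructor
  · rintro ⟨σ, v, hP, hv, hw⟩
    exact ⟨σ, v, h1 σ v hP, hv, hw⟩
  · rintro ⟨σ, v, hP, hv, hw⟩
    exact ⟨σ, v, h2 σ v hP hv (pts_eq_of_mem_iff hw ▸ hf), hv, hw⟩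

/-- Nothing is missed: a simplex with k + 1 vertices arises from its first vertex and the opposite
facet, which is in K and, as k ≥ 1, not empty. -/
theorem IsCollected.isSimplexList {k : ℕ} (hk : 1 ≤ k) {L L' : List (Simplex d)}
    (hL : IsSimplexList K V k L) (h : IsCollected K V (fun σ v => σ ∈ L ∧ v ∈ V) L') :
    IsSimplexList K V (k + 1) L' := by
  refine ⟨h.nodup, fun ρ => (h.mem ρ).trans (and_congr_right fun hρ => ?_)⟩
  constructor
  · rintro ⟨hf, σ, v, ⟨hσ, -⟩, hv, hw⟩
    obtain ⟨h1, h2, -⟩ := (hL.mem σ).1 hσ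
    exact ⟨h2 ▸ length_of_mem_iff h1 hρ hv hw, hf⟩
  · rintro ⟨hlen, hf⟩
    refine ⟨hf, ?_⟩
    obtain ⟨v, σ, rfl⟩ := List.exists_cons_of_length_eq_add_one hlen
    have hσ := hρ.sublist (List.sublist_cons_self v σ)
    rw [List.length_cons, Nat.add_right_cancel_iff] at hlen
    refine ⟨σ, v, ⟨(hL.mem σ).2 ⟨hσ, hlen, face_subset hf (pts_subset (List.sublist_cons_self v σ))
      ?_⟩, hρ.mem v (by simp)⟩, (List.nodup_cons.1 hρ.nodup).1, fun w => List.mem_cons⟩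
    obtain ⟨w, hw⟩ := List.exists_mem_of_length_pos (hlen ▸ hk : 0 < σ.length)
    exact ⟨_, pos_mem_pts hw⟩

/-- An upper bound for the number of steps of `nextSimplices` for a simplex with `k` vertices and
a further vertex. -/
def nextCost (d N n k : ℕ) : ℕ := simplexCost d N n k + N * (k * 2 + 5) + k * 4 + 2

theorem spec_nextSimplices (hK : K.faces.Finite) (hO : IsOracleFor F O K)
    (hV : IsVertexList K i₁ V)
    (hA : ∀ S : Finset (E d), (S : Set (E d)) ⊆ K.vertices → S.card ≤ d + 1 →
      AffineIndependent ℝ ((↑) : S → E d))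
    {k : ℕ} (hk : 1 ≤ k) (hkd : k < d) {L : List (Simplex d)} (hL : IsSimplexList K V k L) :
    Spec O (nextSimplices V L) (IsSimplexList K V (k + 1))
      (L.length * (K.vertices.ncard * (nextCost d K.faces.ncard K.vertices.ncard k + 1) + 1))
      (L.length * (K.vertices.ncard * (2 ^ k * 2))) := by
  classical
  set N := K.faces.ncard with hN
  set n := K.vertices.ncard with hn
  have hVl := hV.length
  refine (Spec.foldC (s := n * (nextCost d N n k + 1)) (q := n * (2 ^ k * 2))
    (fun pre => IsCollected K V fun σ v => σ ∈ pre ∧ v ∈ V) ?_ ?_).imp ?_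
  · exact ⟨List.nodup_nil, by simp⟩
  · intro pre σ suf L₀ hl hL₀
    have hσL : σ ∈ L := by simp [hl]
    obtain ⟨hσ, hσk, hface⟩ := (hL.mem σ).1 hσL
    rw [hn, ← hVl]
    -- Inner invariant: all pairs with an earlier simplex have been treated, and the pairs of σ with
    -- the vertices in `pre'`.
    refine (Spec.foldC (s := nextCost d N V.length k) (q := 2 ^ k * 2) (fun pre' => IsCollected K V
      fun σ' v => (σ' ∈ pre ∧ v ∈ V) ∨ (σ' = σ ∧ v ∈ pre')) (by simpa using hL₀) ?_).imp ?_
    · intro pre' v suf' L₁ hl' hL₁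
      have hv : v ∈ V := by simp [hl']
      have hP : ∀ σ' w, (σ' ∈ pre ∧ w ∈ V) ∨ (σ' = σ ∧ w ∈ pre') →
          (σ' ∈ pre ∧ w ∈ V) ∨ (σ' = σ ∧ w ∈ pre' ++ [v]) := fun σ' w h =>
        h.imp id fun h => ⟨h.1, by simp [h.2]⟩
      have hskip : (v ∉ σ → pts (v :: σ) ∉ K.faces) → IsCollected K V
          (fun σ' w => (σ' ∈ pre ∧ w ∈ V) ∨ (σ' = σ ∧ w ∈ pre' ++ [v])) L₁ := by
        refine fun h => hL₁.congr hP ?_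
        rintro σ' w (h1 | ⟨rfl, h1⟩) hw hf
        · exact Or.inl h1
        · rcases List.mem_append.1 h1 with h1 | h1
          · exact Or.inr ⟨rfl, h1⟩
          · rw [List.mem_singleton.1 h1] at hw hf
            exact absurd hf (h hw)
      have hL₁mem : ∀ ρ ∈ L₁, IsVertexSubset V ρ ∧ ρ.length = k + 1 := by
        intro ρ hρ
        obtain ⟨h1, -, σ', w, h2, h3, h4⟩ := (hL₁.mem ρ).1 hρ
        have hσ' : σ' ∈ L := by
          rcases h2 with h2 | h2
          · simp [hl, h2.1]
          · exact h2.1 ▸ hσL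
        obtain ⟨h5, h6, -⟩ := (hL.mem σ').1 hσ'
        exact ⟨h1, h6 ▸ length_of_mem_iff h5 h1 h3 h4⟩
      -- The list under construction consists of distinct simplices of K, so the search for a
      -- duplicate makes at most N comparisons.
      have hL₁len : L₁.length ≤ N := length_le_ncard_of_faces hK hV hL₁.nodup fun ρ hρ =>
        ⟨((hL₁.mem ρ).1 hρ).1, ((hL₁.mem ρ).1 hρ).2.1⟩
      refine Spec.cost (s := k * 2 + (simplexCost d N V.length k + (k * (1 + 1) + 1 +
        (N * ((k + 1) * 2 + 3) + 1)))) (q := 0 + 2 ^ k * 2) (Spec.bind_eq (q := 0)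
        ((spec_memC v σ).cost (by rw [hσk]) le_rfl) (Spec.ite (fun ht => ?_) fun ht => ?_)) ?_
        (by omega)
      · rw [decide_eq_true_eq] at ht
        obtain ⟨w, hw, e⟩ := ht
        exact Spec.pure' (hskip fun h => absurd (hV.id_inj (hσ.mem w hw) hv e ▸ hw) h)
      · have hvσ : v ∉ σ := fun h => ht (decide_eq_true ⟨v, h, rfl⟩)
        have hsimp := spec_isSimplex hK hO hV hA hσ hface (hσk ▸ hkd) hv hvσ
        rw [hσk, ← hVl] at hsimp
        refine Spec.cost (q := 2 ^ k * 2 + 0) (Spec.bind hsimp fun t ht' => Spec.ite (fun h => ?_)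
          fun h => Spec.pure' (hskip fun _ h' => h (ht'.2 h'))) le_rfl le_rfl
        have hτ := orderedInsert_isVertexSubset hV hσ hv hvσ
        have hτmem : ∀ w, w ∈ σ.orderedInsert (fun a b => a.id ≤ b.id) v ↔ w = v ∨ w ∈ σ :=
          fun w => by rw [(List.perm_orderedInsert _ v σ).mem_iff, List.mem_cons]
        have hτlen := length_of_mem_iff hσ hτ hvσ hτmem
        rw [hσk] at hτlen
        refine Spec.cost (q := 0 + 0) (Spec.bind_eq ((Spec.insertC (s := 1) (q := 0)
          (fun a b : Vertex d => a.id ≤ b.id) (fun a b => Spec.op rfl) v σ).cost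
          (by rw [hσk]) (by simp)) ((spec_addSimplex hV hτ hτlen hL₁mem hL₁len hL₁.nodup).imp
          fun L' hL' => ⟨hL'.1, fun ρ => ?_⟩)) le_rfl le_rfl
        rw [hL'.2, hL₁.mem]
        constructor
        · rintro (rfl | ⟨h1, h2, σ', w, h3, h4⟩)
          · exact ⟨hτ, pts_eq_of_mem_iff hτmem ▸ ht'.1 h, σ, v, Or.inr ⟨rfl, by simp⟩, hvσ, hτmem⟩
          · exact ⟨h1, h2, σ', w, hP σ' w h3, h4⟩
        · rintro ⟨h1, h2, σ', w, h3 | ⟨rfl, h3⟩, h4⟩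
          · exact Or.inr ⟨h1, h2, σ', w, Or.inl h3, h4⟩
          · rcases List.mem_append.1 h3 with h3 | h3
            · exact Or.inr ⟨h1, h2, σ', w, Or.inr ⟨rfl, h3⟩, h4⟩
            · refine Or.inl (h1.ext hτ fun u => ?_)
              rw [h4.2, hτmem, List.mem_singleton.1 h3]
      · rw [nextCost]
        have e : N * ((k + 1) * 2 + 3) = N * (k * 2 + 5) := by ring
        rw [e]
        omega
    · refine fun L' hL' => hL'.congr ?_ ?_
      · rintro σ' w (h | ⟨rfl, h⟩)
        · exact ⟨by simp [h.1], h.2⟩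
        · exact ⟨by simp, h⟩
      · rintro σ' w ⟨h1, h2⟩ - -
        rcases List.mem_append.1 h1 with h1 | h1
        · exact Or.inl ⟨h1, h2⟩
        · exact Or.inr ⟨List.mem_singleton.1 h1, h2⟩
  · exact fun L' hL' => hL'.isSimplexList hk hL

/-! ### The dimension of the complex -/

theorem card_face_le {κ : ℕ} (hκ : HasDimension K κ) {i : ℕ} :
    {ρ ∈ K.faces | ρ.card = i + 1}.Nonempty ↔ i ≤ κ := by
  constructor
  · rintro ⟨ρ, hρ, hc⟩
    have := hκ.2 ρ hρ
    omega
  · intro h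
    obtain ⟨σ, hσ, hc⟩ := hκ.1
    obtain ⟨ρ, hρ, hc'⟩ := Finset.exists_subset_card_eq (show i + 1 ≤ σ.card by omega)
    exact ⟨ρ, face_subset hσ hρ (Finset.card_pos.1 (by omega)), hc'⟩

/-- The dimensions that occur form an initial segment, so the last successful test is at κ; since κ
< d, it is among the tests made. -/
theorem spec_findDimension (hK : K.faces.Finite) (hO : IsOracleFor F O K) {κ : ℕ}
    (hκ : HasDimension K κ) (hκd : κ < d) {s : E d} (hs : ‖s‖ = 1) :
    Spec O (findDimension (O s)) (· = κ) (d * (K.faces.ncard * 6 + 4)) 0 := by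
  set N := K.faces.ncard with hN
  have hlen : ∀ k, (O s k).length ≤ N := length_le_ncard_faces hK hO hs
  refine (Spec.foldC (s := N * 3 + (N * 3 + (1 + (1 + 1)))) (q := 0)
    (fun (pre : List ℕ) x => x = min κ pre.length) (by simp) ?_).mono ?_ ?_ (by simp)
  · rintro pre i suf _ hl rfl
    have hi : i = pre.length + 1 := by
      have h1 : (List.range' 1 (d - 1))[pre.length]? = some i := by rw [hl]; simp
      obtain ⟨h2, h3⟩ := List.getElem?_eq_some_iff.1 h1
      rw [List.getElem_range'] at h3
      omega
    subst hi
    refine Spec.cost (q := 0 + (0 + 0)) (Spec.bind_eq ((Spec.countC (s := 1) (q := 0)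
      (fun _ => true) fun x _ => Spec.op rfl).cost (Nat.mul_le_mul_right _ (hlen _)) (by simp))
      (Spec.bind_eq ((Spec.countC (s := 1) (q := 0) (fun x : Point => decide (x.2 ≠ ⊤))
      fun x _ => Spec.op rfl).cost (Nat.mul_le_mul_right _ (hlen _)) (by simp)) (Spec.bind_op
      (Spec.bind_op ?_)))) le_rfl le_rfl
    have hcount := ncard_simplices hO hs pre.length
    have hfin : {ρ ∈ K.faces | ρ.card = pre.length + 2}.Finite := hK.subset fun ρ h => h.1
    have hzero : (List.countP (fun _ => true) (O s (pre.length + 1)) : ℤ)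
        + (List.countP (fun x : Point => decide (x.2 ≠ ⊤)) (O s (pre.length + 1 - 1)) : ℤ) = 0 ↔
        κ ≤ pre.length := by
      rw [List.countP_true, Nat.add_sub_cancel, ← Nat.cast_add, hcount, Nat.cast_eq_zero,
        Set.ncard_eq_zero hfin, ← Set.not_nonempty_iff_eq_empty, card_face_le hκ]
      omega
    rw [List.length_append, List.length_singleton]
    refine Spec.ite (fun h => Spec.pure' ?_) fun h => Spec.op ?_
    · rw [decide_eq_true_eq, hzero] at h
      omega
    · rw [decide_eq_true_eq, hzero] at h
      omega
  · rintro _ rfl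
    rw [List.length_range']
    omega
  · rw [List.length_range']
    exact Nat.mul_le_mul (by omega) (by omega)

end NextSimplices
/-! ### The reconstruction algorithm -/

section Reconstruct

variable {d : ℕ} {F : Type*} [Field F] {K : Geometry.SimplicialComplex ℝ (E d)} {O : Oracle d}
  {i₁ i₂ : Fin d} {V : List (Vertex d)}

/-- A vanishing cross product puts all three projections on the line through x in direction y - x.
The parameter of z is obtained by division, which is allowed because first coordinates are distinct.
-/
theorem GeneralPosition.planeGeneral {hd : 2 ≤ d} {S : Set (E d)} (h : GeneralPosition hd S) :
    PlaneGeneral ⟨0, by omega⟩ ⟨1, by omega⟩ S := by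
  intro x hx y hy z hz hxy hxz hyz e
  refine h.not_collinear x hx y hy z hz hxy hxz hyz ?_
  have hne : y ⟨0, by omega⟩ - x ⟨0, by omega⟩ ≠ 0 := fun h0 =>
    hxy (h.heights x hx y hy (sub_eq_zero.1 h0).symm)
  rw [collinear_iff_of_mem (p₀ := planeProj hd x) (by simp)]
  refine ⟨planeProj hd y - planeProj hd x, fun p hp => ?_⟩
  simp only [Set.mem_insert_iff, Set.mem_singleton_iff] at hp
  rcases hp with rfl | rfl | rfl
  · exact ⟨0, by simp⟩
  · exact ⟨1, by simp⟩
  · refine ⟨(z ⟨0, by omega⟩ - x ⟨0, by omega⟩) / (y ⟨0, by omega⟩ - x ⟨0, by omega⟩), ?_⟩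
    ext j
    fin_cases j
    · simp [planeProj]
      field_simp
      ring
    · simp [planeProj]
      field_simp
      linear_combination e

theorem IsVertexList.id_lt (hV : IsVertexList K i₁ V) {v w : Vertex d} (hv : v ∈ V) (hw : w ∈ V)
    (h : v.pos i₁ < w.pos i₁) : v.id < w.id := by
  rcases lt_trichotomy v.id w.id with h1 | h1 | h1
  · exact h1
  · rw [hV.id_inj hv hw h1] at h
    exact absurd h (lt_irrefl _)
  · exact (List.Pairwise.forall_of_forall_of_flip
      (R := fun v w : Vertex d => v.pos i₁ < w.pos i₁ → v.id < w.id)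
      (fun _ _ h => absurd h (lt_irrefl _))
      (hV.ids.imp (S := fun v w : Vertex d => v.pos i₁ < w.pos i₁ → v.id < w.id) fun h _ => h)
      (hV.sorted.imp fun h h' => absurd h h'.not_gt) hv hw) h

theorem exists_pts_eq (hV : IsVertexList K i₁ V) {ρ : Finset (E d)} (hρ : ρ ∈ K.faces) :
    ∃ σ, IsVertexSubset V σ ∧ pts σ = ρ := by
  classical
  refine ⟨V.filter fun v => decide (v.pos ∈ ρ), ⟨hV.ids.filter _, fun v hv =>
    List.mem_of_mem_filter hv⟩, ?_⟩
  ext x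
  rw [mem_pts]
  constructor
  · rintro ⟨v, hv, rfl⟩
    simpa using (List.mem_filter.1 hv).2
  · intro hx
    obtain ⟨v, hv, rfl⟩ := hV.exists_mem (mem_vertices_of_mem_face hρ hx)
    exact ⟨v, List.mem_filter.2 ⟨hv, by simpa using hx⟩, rfl⟩

theorem isSimplexList_edges (hV : IsVertexList K i₁ V) {edges : List (Vertex d × Vertex d)}
    (h : IsEdgeList K i₁ V V edges) :
    IsSimplexList K V 2 (edges.map fun e => [e.1, e.2]) := by
  refine ⟨h.nodup.map fun a b e => ?_, fun ρ => ?_⟩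
  · simp only [List.cons.injEq, and_true] at e
    exact Prod.ext e.1 e.2
  · rw [List.mem_map]
    constructor
    · rintro ⟨⟨v, w⟩, he, rfl⟩
      obtain ⟨hv, hw, hadj, hlt⟩ := (h.mem v w).1 he
      refine ⟨⟨by simpa using hV.id_lt hv hw hlt, ?_⟩, rfl, hadj.2⟩
      intro u hu
      simp only [List.mem_cons, List.not_mem_nil, or_false] at hu
      rcases hu with rfl | rfl
      exacts [hv, hw]
    · rintro ⟨hρ, hlen, hf⟩
      obtain ⟨v, w, rfl⟩ := List.length_eq_two.1 hlen
      have hv := hρ.mem v (by simp)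
      have hw := hρ.mem w (by simp)
      have hid : v.id < w.id := by simpa using hρ.ids
      have hne : v ≠ w := fun e => by rw [e] at hid; exact lt_irrefl _ hid
      have hlt : v.pos i₁ < w.pos i₁ := by
        rcases lt_or_gt_of_ne (hV.ne_of_ne hw hv hne) with h1 | h1
        · exact h1
        · exact absurd (hV.id_lt hw hv h1) hid.not_gt
      exact ⟨(v, w), (h.mem v w).2 ⟨hv, hw, ⟨fun e => hne (hV.pos_inj hv hw e), hf⟩, hlt⟩, rfl⟩

theorem one_le_ncard_vertices (hK : K.faces.Finite) {κ : ℕ} (hκ : HasDimension K κ) :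
    1 ≤ K.vertices.ncard := by
  obtain ⟨σ, hσ, -⟩ := hκ.1
  obtain ⟨x, hx⟩ := face_nonempty hσ
  exact (Set.ncard_pos (vertices_finite hK)).2 ⟨x, mem_vertices_of_mem_face hσ hx⟩

/-- An upper bound for the number of steps of `reconstruct` for finding the simplices of
dimension `i`, for `i ≥ 2`. -/
def higherCost (d N n i : ℕ) : ℕ := N * (n * (nextCost d N n i + 1) + 1) + (N + 1)

/-- An upper bound for the number of steps of `reconstruct`. -/
def reconstructCost (d N n κ : ℕ) : ℕ :=
  100 * (d * n ^ 2 + d ^ 2) + d * (N * 6 + 4) + edgesCost d N n + n * 3 + n ^ 2 * 2 + 1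
    + ((List.range' 2 (κ - 1)).map fun i => higherCost d N n i + 1).sum

/-- An upper bound for the number of queries of `reconstruct`. -/
def reconstructQueries (d N n κ : ℕ) : ℕ :=
  (1 + d * 2) + (1 + n * ((n * 2 + 1) * 2))
    + ((List.range' 2 (κ - 1)).map fun i => N * (n * (2 ^ i * 2))).sum

theorem spec_reconstruct (hd : 2 ≤ d) (hK : K.faces.Finite) (hO : IsOracleFor F O K) {κ : ℕ}
    (hκ : HasDimension K κ) (hκd : κ < d) (hgp : GeneralPosition hd K.vertices) :
    Spec O (reconstruct hd) (fun L => facesOf L = K.faces)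
      (reconstructCost d K.faces.ncard K.vertices.ncard κ)
      (reconstructQueries d K.faces.ncard K.vertices.ncard κ) := by
  classical
  set N := K.faces.ncard with hN
  set n := K.vertices.ncard with hn
  refine Spec.cost (s := 100 * (d * n ^ 2 + d ^ 2) + (d * (N * 6 + 4) + (edgesCost d N n +
    (n * (1 + 1) + (n ^ 2 * (1 + 1) + (n + 1 +
    (((List.range' 2 (κ - 1)).map fun i => higherCost d N n i + 1).sum + 0)))))))
    (q := (1 + d * 2) + (0 + ((1 + n * ((n * 2 + 1) * 2)) + (0 + (0 + (0 +
    (((List.range' 2 (κ - 1)).map fun i => N * (n * (2 ^ i * 2))).sum + 0)))))))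
    (Spec.bind (spec_findVertices hK hO hgp.heights ?_) ?_) ?_ ?_
  · exact one_le_ncard_vertices hK hκ
  · rintro ⟨V, D⟩ ⟨hV, hD⟩
    dsimp only at hV hD ⊢
    subst hD
    have hVl := hV.length
    refine Spec.bind_eq (spec_findDimension hK hO hκ hκd (by simp)) (Spec.bind
      (spec_findEdges hK hO hV (by simp) hgp.planeGeneral) fun edges hedges => ?_)
    have hel := hedges.length_le hV fun _ => id
    have hK₁ := isSimplexList_edges hV hedges
    refine Spec.bind_eq ((Spec.mapC (s := 1) (q := 0) (fun v : Vertex d => [v])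
      fun v _ => Spec.op rfl).cost (Nat.mul_le_mul_right _ hVl.le) (by simp)) (Spec.bind_eq
      ((Spec.mapC (s := 1) (q := 0) (fun e : Vertex d × Vertex d => [e.1, e.2])
      fun v _ => Spec.op rfl).cost (Nat.mul_le_mul_right _ hel) (by simp)) (Spec.bind_eq
      ((spec_appendC _ _).cost (by rw [List.length_map, hVl]) le_rfl) (Spec.bind
      -- After j rounds the first list holds the simplices with j + 2 vertices and the second all
      -- those with at most j + 2. The edges provide the start, also if κ ≤ 1 and there are no
      -- rounds.
      (Spec.foldC_sum (fun pre (r : List (Simplex d) × List (Simplex d)) =>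
        IsSimplexList K V (pre.length + 2) r.1 ∧ ∀ t, t ∈ r.2 ↔ IsVertexSubset V t ∧
        t.length ≤ pre.length + 2 ∧ pts t ∈ K.faces) (fun i => higherCost d N n i)
        (fun i => N * (n * (2 ^ i * 2))) ?_ ?_) fun r hr => Spec.pure ?_)))
    · refine ⟨hK₁, fun t => ?_⟩
      rw [List.mem_append, hK₁.mem, List.mem_map]
      constructor
      · rintro (⟨v, hv, rfl⟩ | ⟨h1, h2, h3⟩)
        · exact ⟨isVertexSubset_singleton hv, by simp, pts_singleton_mem_faces hV hv⟩
        · exact ⟨h1, by simp [h2], h3⟩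
      · rintro ⟨h1, h2, h3⟩
        rw [List.length_nil, zero_add] at h2
        have h4 : t ≠ [] := by
          rintro rfl
          exact (face_nonempty h3).ne_empty rfl
        have h5 := List.length_pos_of_ne_nil h4
        rcases (show t.length = 1 ∨ t.length = 2 by omega) with h6 | h6
        · obtain ⟨v, rfl⟩ := List.length_eq_one_iff.1 h6
          exact Or.inl ⟨v, h1.mem v (by simp), rfl⟩
        · exact Or.inr ⟨h1, h6, h3⟩
    · rintro pre i suf r hl ⟨hr1, hr2⟩
      obtain ⟨hi, hiκ⟩ : i = pre.length + 2 ∧ i ≤ κ := by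
        have h1 : (List.range' 2 (κ - 1))[pre.length]? = some i := by rw [hl]; simp
        obtain ⟨h2, h3⟩ := List.getElem?_eq_some_iff.1 h1
        rw [List.getElem_range'] at h3
        rw [List.length_range'] at h2
        omega
      rw [← hi] at hr1 hr2
      have hlen := length_le_ncard_of_faces hK hV hr1.nodup fun ρ hρ =>
        ⟨((hr1.mem ρ).1 hρ).1, ((hr1.mem ρ).1 hρ).2.2⟩
      have hnext := spec_nextSimplices hK hO hV hgp.affineIndependent (by omega) (by omega) hr1
      refine Spec.cost (q := N * (n * (2 ^ i * 2)) + (0 + 0)) (Spec.bind (hnext.cost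
        (Nat.mul_le_mul_right _ hlen) (Nat.mul_le_mul_right _ hlen)) fun L hL => Spec.bind_eq
        (s := N + 1) (s' := 0) ((spec_appendC L r.2).cost (Nat.succ_le_succ
        (length_le_ncard_of_faces hK hV hL.nodup fun ρ hρ =>
        ⟨((hL.mem ρ).1 hρ).1, ((hL.mem ρ).1 hρ).2.2⟩)) le_rfl) (Spec.pure ?_)) le_rfl le_rfl
      rw [List.length_append, List.length_singleton,
        show pre.length + 1 + 2 = i + 1 by omega]
      refine ⟨hL, fun t => ?_⟩
      rw [List.mem_append, hL.mem, hr2]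
      constructor
      · rintro (⟨h1, h2, h3⟩ | ⟨h1, h2, h3⟩)
        · exact ⟨h1, h2.le, h3⟩
        · exact ⟨h1, by omega, h3⟩
      · rintro ⟨h1, h2, h3⟩
        rcases Nat.lt_or_ge i t.length with h4 | h4
        · exact Or.inl ⟨h1, by omega, h3⟩
        · exact Or.inr ⟨h1, h4, h3⟩
    · ext ρ
      constructor
      · rintro ⟨t, ht, rfl⟩
        exact ((hr.2 t).1 ht).2.2
      · intro hρ
        obtain ⟨t, ht, rfl⟩ := exists_pts_eq hV hρ
        refine ⟨t, (hr.2 t).2 ⟨ht, ?_, hρ⟩, rfl⟩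
        -- There are κ - 1 rounds, and κ - 1 + 2 ≥ κ + 1 also holds with truncated subtraction.
        have h1 := hκ.2 _ hρ
        rw [ht.card_pts hV] at h1
        rw [List.length_range']
        omega
  · rw [reconstructCost]
    omega
  · rw [reconstructQueries]
    omega

end Reconstruct
/-! ### Bounds for the running time -/

section Bounds

theorem sq_le_two_pow (k : ℕ) : k * k ≤ 2 * 2 ^ k := by
  rcases lt_or_ge k 4 with h | h
  · interval_cases k <;> norm_num
  · induction k, h using Nat.le_induction with
    | base => norm_num
    | succ k hk ih =>
      rw [pow_succ]
      nlinarith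

/-- The quotient k⁴ / 2^k is largest at k = 6, where it is 20.25; from k = 7 on the numerator grows
by a factor below 2. -/
theorem pow_four_le_two_pow (k : ℕ) : k * k * (k * k) ≤ 21 * 2 ^ k := by
  rcases lt_or_ge k 7 with h | h
  · interval_cases k <;> norm_num
  · induction k, h using Nat.le_induction with
    | base => norm_num
    | succ k hk ih =>
      have h1 : 7 * (k * k * k) ≤ k * k * (k * k) := by
        rw [← mul_assoc (k * k), mul_comm]
        exact Nat.mul_le_mul_left _ hk
      have h2 : 7 * (k * k) ≤ k * k * k := by
        rw [mul_comm]
        exact Nat.mul_le_mul_left _ hk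
      have h3 : 7 * k ≤ k * k := Nat.mul_le_mul_right _ hk
      rw [pow_succ]
      ring_nf at *
      omega

/-- The left side grows by a factor of at most 4 in each step from k = 1 on, so 4^k absorbs the
linear factor. -/
theorem three_pow_mul_le (k : ℕ) : 3 ^ k * (k * 2 + 4) ≤ 8 * (2 ^ k * 2 ^ k) := by
  rw [← mul_pow]
  induction k with
  | zero => norm_num
  | succ k ih =>
    rcases Nat.eq_zero_or_pos k with rfl | hk
    · norm_num
    · have h1 : 3 * ((k + 1) * 2 + 4) ≤ 4 * (k * 2 + 4) := by omega
      calc 3 ^ (k + 1) * ((k + 1) * 2 + 4) = 3 ^ k * (3 * ((k + 1) * 2 + 4)) := by ring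
        _ ≤ 3 ^ k * (4 * (k * 2 + 4)) := Nat.mul_le_mul_left _ h1
        _ = 4 * (3 ^ k * (k * 2 + 4)) := by ring
        _ ≤ 4 * (8 * (2 * 2) ^ k) := Nat.mul_le_mul_left _ ih
        _ = 8 * (2 * 2) ^ (k + 1) := by ring

/-- `Q` is a bound for the number of steps that are needed for one direction. -/
structure IsScale (d N n Q : ℕ) : Prop where
  n_le : n ≤ Q
  d_le : d ≤ Q
  N_le : N ≤ Q
  nn_le : n * n ≤ Q
  dn_le : n * d ≤ Q
  dd_le : d * d ≤ Q
  pos : 1 ≤ Q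

/-- The mixed product is at most n² + d², and n² ≤ N n because every vertex is a simplex. -/
theorem isScale {d N n : ℕ} (hn : 1 ≤ n) (hN : n ≤ N) : IsScale d N n (N * n + d ^ 2) := by
  have h1 : n * n ≤ N * n := Nat.mul_le_mul_right _ hN
  have h2 : N ≤ N * n := Nat.le_mul_of_pos_right _ hn
  have h3 : d ≤ d * d := Nat.le_mul_self d
  have h4 : n * d ≤ n * n + d * d := by
    rcases le_total n d with h | h
    · exact (Nat.mul_le_mul_right _ h).trans (Nat.le_add_left _ _)
    · exact (Nat.mul_le_mul_left _ h).trans (Nat.le_add_right _ _)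
  rw [sq]
  constructor <;> omega

variable {d N n Q : ℕ}

theorem tiltVCost_le (h : IsScale d N n Q) : tiltVCost d n ≤ 31 * Q := by
  obtain ⟨h1, h2, h3, h4, h5, h6, h7⟩ := h
  have e : tiltVCost d n = n * d * 4 + n * n * 2 + n * 10 + d * 8 + 7 := by
    rw [tiltVCost, tiltCost]
    ring
  omega

theorem indegreeCost_le (h : IsScale d N n Q) (k : ℕ) :
    indegreeCost d N n k k ≤ 189 * (2 ^ k * 2 ^ k) + 74 * (2 ^ k * Q) := by
  have ht := tiltVCost_le h
  obtain ⟨h1, h2, h3, h4, h5, h6, h7⟩ := h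
  have k1 : k ≤ 2 ^ k := Nat.lt_two_pow_self.le
  have k2 := sq_le_two_pow k
  have k4 := pow_four_le_two_pow k
  have k3 := three_pow_mul_le k
  have hkd : k * d ≤ k * k + d * d := by
    rcases le_total k d with h | h
    · exact (Nat.mul_le_mul_right _ h).trans (Nat.le_add_left _ _)
    · exact (Nat.mul_le_mul_left _ h).trans (Nat.le_add_right _ _)
  -- Powers of k are separated from d, at the price of k⁴; otherwise the cost of a lifting direction
  -- would give a term 2^k d instead of 2^k + d².
  have hkkd : k * k * d ≤ k * k * (k * k) + d * d := by
    rcases le_total (k * k) d with h | h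
    · exact (Nat.mul_le_mul_right _ h).trans (Nat.le_add_left _ _)
    · exact (Nat.mul_le_mul_left _ h).trans (Nat.le_add_right _ _)
  have hl : liftCost d k = k * k * d * 6 + k * k + k * d * 16 + k * 7 + d * 4 + 1 := by
    rw [liftCost]
    ring
  -- The constant is 181 = 6·21 + 16·2 + 3·2 + 17, from the terms in k² d, k d, k² and k. The table
  -- accesses add 8 to give the 189 of the conclusion.
  have hf : faceCost d N n k k ≤ 181 * 2 ^ k + 74 * Q := by
    have e : k * (k * 2 + 8) = k * k * 2 + k * 8 := by ring
    rw [faceCost, hl, e]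
    omega
  rw [indegreeCost]
  have := Nat.mul_le_mul_left (2 ^ k) hf
  have e : 2 ^ k * (181 * 2 ^ k + 74 * Q) = 181 * (2 ^ k * 2 ^ k) + 74 * (2 ^ k * Q) := by ring
  omega

theorem nextCost_le (h : IsScale d N n Q) (k : ℕ) :
    nextCost d N n k ≤ 378 * (2 ^ k * 2 ^ k) + 461 * (2 ^ k * Q) := by
  have ht := tiltVCost_le h
  have hi := indegreeCost_le h k
  obtain ⟨h1, h2, h3, h4, h5, h6, h7⟩ := h
  have k1 : k ≤ 2 ^ k := Nat.lt_two_pow_self.le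
  have k2 := sq_le_two_pow k
  have hP : 1 ≤ 2 ^ k := Nat.one_le_two_pow
  have hPQ : 2 ^ k ≤ 2 ^ k * Q := Nat.le_mul_of_pos_right _ h7
  have hQP : Q ≤ 2 ^ k * Q := Nat.le_mul_of_pos_left _ hP
  have m1 : k * (d * d) ≤ 2 ^ k * Q := Nat.mul_le_mul k1 h6
  have m2 : k * d ≤ 2 ^ k * Q := Nat.mul_le_mul k1 h2
  have m3 : k * n ≤ 2 ^ k * Q := Nat.mul_le_mul k1 h1
  have m4 : k * N ≤ 2 ^ k * Q := Nat.mul_le_mul k1 h3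
  have m5 : k * (n * d) ≤ 2 ^ k * Q := Nat.mul_le_mul k1 h5
  have m6 : k * k * d ≤ 2 * 2 ^ k * Q := Nat.mul_le_mul k2 h2
  rw [mul_assoc 2] at m6
  have e : nextCost d N n k = k * k * d * 12 + k * k * 2 + k * (d * d) * 6 + k * d * 43 + k * 20
      + k * n * 3 + k * N * 2 + k * (n * d) * 6 + d * d * 8 + d * 43 + n * d * 18 + n * 19 + N * 5
      + tiltVCost d n * 3 + indegreeCost d N n k k * 2 + 19 := by
    rw [nextCost, simplexCost, gramStep, sepCost, liftCost]
    ring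
  rw [e]
  omega

/-- The bound doubles or quadruples its two parts with each new summand, which leaves room for that
summand. -/
theorem sum_range'_le {f : ℕ → ℕ} {a b : ℕ} (h : ∀ i, f i ≤ a * 2 ^ i + b * (2 ^ i * 2 ^ i))
    (m : ℕ) : ((List.range' 2 m).map f).sum
      ≤ a * 2 ^ (m + 2) + b * (2 ^ (m + 2) * 2 ^ (m + 2)) := by
  induction m with
  | zero => simp
  | succ m ih =>
    rw [List.range'_concat, List.map_append, List.sum_append, List.map_singleton,
      List.sum_singleton, one_mul, add_comm 2 m]
    have h1 := h (m + 2)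
    have e1 : 2 ^ (m + 1 + 2) = 2 * 2 ^ (m + 2) := by ring
    rw [e1]
    have e2 : a * (2 * 2 ^ (m + 2)) + b * (2 * 2 ^ (m + 2) * (2 * 2 ^ (m + 2)))
        = 2 * (a * 2 ^ (m + 2)) + 4 * (b * (2 ^ (m + 2) * 2 ^ (m + 2))) := by ring
    rw [e2]
    omega

theorem sum_range'_pred_le {f : ℕ → ℕ} {a b : ℕ}
    (h : ∀ i, f i ≤ a * 2 ^ i + b * (2 ^ i * 2 ^ i)) (κ : ℕ) :
    ((List.range' 2 (κ - 1)).map f).sum ≤ 4 * (a * 2 ^ κ) + 16 * (b * (2 ^ κ * 2 ^ κ)) := by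
  refine (sum_range'_le h (κ - 1)).trans ?_
  -- The exponent is κ + 1 for κ ≥ 1, but κ + 2 for κ = 0 because of truncated subtraction; hence 4,
  -- and 16 for its square.
  have h1 : 2 ^ (κ - 1 + 2) ≤ 4 * 2 ^ κ := by
    rw [show 4 * 2 ^ κ = 2 ^ (κ + 2) by ring]
    exact Nat.pow_le_pow_right (by omega) (by omega)
  calc a * 2 ^ (κ - 1 + 2) + b * (2 ^ (κ - 1 + 2) * 2 ^ (κ - 1 + 2))
      ≤ a * (4 * 2 ^ κ) + b * (4 * 2 ^ κ * (4 * 2 ^ κ)) := by gcongr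
    _ = 4 * (a * 2 ^ κ) + 16 * (b * (2 ^ κ * 2 ^ κ)) := by ring

theorem higherCost_le (h : IsScale d N n Q) (hn : 1 ≤ n) (hN : 1 ≤ N) (i : ℕ) :
    higherCost d N n i + 1 ≤ 466 * (N * n) * Q * 2 ^ i + 378 * (N * n) * (2 ^ i * 2 ^ i) := by
  have h1 := Nat.mul_le_mul_left (N * n) (nextCost_le h i)
  have h2 : N ≤ N * n := Nat.le_mul_of_pos_right _ hn
  have h3 : N * n ≤ N * n * (2 ^ i * Q) :=
    Nat.le_mul_of_pos_right _ (Nat.mul_pos (Nat.two_pow_pos i) h.pos)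
  have e1 : higherCost d N n i + 1 = N * n * nextCost d N n i + N * n + N * 2 + 2 := by
    rw [higherCost]
    ring
  have e2 : N * n * (378 * (2 ^ i * 2 ^ i) + 461 * (2 ^ i * Q))
      = 378 * (N * n) * (2 ^ i * 2 ^ i) + 461 * (N * n * (2 ^ i * Q)) := by ring
  have e3 : 466 * (N * n) * Q * 2 ^ i = 466 * (N * n * (2 ^ i * Q)) := by ring
  rw [e1, e3]
  omega

/-- Each of the n vertices needs O(n) splits of cost O(Q). As n² Q ≤ N n Q, the edges cost no more
than the higher simplices in the final bound. -/
theorem edgesCost_le (h : IsScale d N n Q) (hn : 1 ≤ n) :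
    edgesCost d N n ≤ 2840 * (n * n * Q) := by
  have hi := indegreeCost_le h 1
  obtain ⟨h1, h2, h3, h4, h5, h6, h7⟩ := h
  have hs : splitCost d N n ≤ 924 * Q := by
    have e : n * (d * 2 + 5) = n * d * 2 + n * 5 := by ring
    rw [splitCost, e]
    omega
  have hnQ : Q ≤ n * Q := Nat.le_mul_of_pos_left _ hn
  have hnnQ : n * Q ≤ n * n * Q := Nat.mul_le_mul_right _ (Nat.le_mul_self n)
  have hn' : n ≤ n * Q := Nat.le_mul_of_pos_right _ h7
  have hnn : n * n ≤ n * Q := Nat.mul_le_mul_left _ h1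
  have hu : upEdgesCost d N n ≤ 2790 * (n * Q) := by
    have h8 := Nat.mul_le_mul (show n * 2 + 1 ≤ 3 * n by omega)
      (show splitCost d N n + 2 ≤ 926 * Q by omega)
    have e : 3 * n * (926 * Q) = 2778 * (n * Q) := by ring
    rw [upEdgesCost]
    omega
  have h9 : upEdgesCost d N n + n * (n * 15) + n * 25 + 3 ≤ 2836 * (n * Q) := by
    have e : n * (n * 15) = 15 * (n * n) := by ring
    rw [e]
    omega
  have h10 := Nat.mul_le_mul_left n h9
  have e : n * (2836 * (n * Q)) = 2836 * (n * n * Q) := by ring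
  rw [edgesCost]
  omega

theorem reconstructCost_le (hn : 1 ≤ n) (hN : n ≤ N) (κ : ℕ) :
    reconstructCost d N n κ
      ≤ 7000 * (d * N * n ^ 2 + 2 ^ κ * N * n * (N * n + d ^ 2 + 2 ^ κ)) := by
  have h := isScale (d := d) hn hN
  have hN1 : 1 ≤ N := hn.trans hN
  have hsum := sum_range'_pred_le (higherCost_le h hn hN1) κ
  have hedges := edgesCost_le h hn
  set Q := N * n + d ^ 2 with hQ
  set P := 2 ^ κ with hP
  have hP1 : 1 ≤ P := Nat.one_le_two_pow
  obtain ⟨h1, h2, h3, h4, h5, h6, h7⟩ := h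
  have a1 : N * n * Q ≤ P * (N * n * Q) := Nat.le_mul_of_pos_left _ hP1
  have a2 : n * n * Q ≤ N * n * Q := Nat.mul_le_mul_right _ (Nat.mul_le_mul_right _ hN)
  have a3 : Q ≤ N * n * Q := Nat.le_mul_of_pos_left _ (Nat.mul_pos hN1 hn)
  have a4 : n * n * d ≤ N * (n * n * d) := Nat.le_mul_of_pos_left _ hN1
  have a5 : N * d ≤ N * (n * n * d) :=
    Nat.mul_le_mul_left _ (Nat.le_mul_of_pos_left _ (Nat.mul_pos hn hn))
  -- The coefficient 6048 = 16·378 is the largest that occurs; it determines the size of the final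
  -- constant 7000.
  have e1 : 4 * (466 * (N * n) * Q * P) + 16 * (378 * (N * n) * (P * P))
      = 1864 * (P * (N * n * Q)) + 6048 * (P * (N * n * P)) := by ring
  have e2 : 7000 * (d * N * n ^ 2 + P * N * n * (Q + P))
      = 7000 * (N * (n * n * d)) + 7000 * (P * (N * n * Q)) + 7000 * (P * (N * n * P)) := by ring
  have e3 : 100 * (d * n ^ 2 + d ^ 2) + d * (N * 6 + 4)
      = 100 * (n * n * d) + 100 * (d * d) + 6 * (N * d) + 4 * d := by ring
  have e4 : n ^ 2 * 2 = n * n * 2 := by ring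
  rw [reconstructCost, e2, e3, e4]
  rw [e1] at hsum
  omega

theorem reconstructQueries_le (hN : n ≤ N) (hd : 2 ≤ d) (κ : ℕ) :
    reconstructQueries d N n κ ≤ 7000 * (d + 2 ^ κ * N * n) := by
  have hsum := sum_range'_pred_le (f := fun i => N * (n * (2 ^ i * 2))) (a := 2 * (N * n)) (b := 0)
    (fun i => le_of_eq (by ring)) κ
  set P := 2 ^ κ with hP
  have hP1 : 1 ≤ P := Nat.one_le_two_pow
  have a1 : n * n ≤ N * n := Nat.mul_le_mul_right _ hN
  have a2 : N * n ≤ P * (N * n) := Nat.le_mul_of_pos_left _ hP1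
  have a3 : n ≤ n * n := Nat.le_mul_self n
  have e1 : n * ((n * 2 + 1) * 2) = 4 * (n * n) + 2 * n := by ring
  have e2 : 4 * (2 * (N * n) * P) + 16 * (0 * (P * P)) = 8 * (P * (N * n)) := by ring
  rw [reconstructQueries, e1, mul_assoc P]
  rw [e2] at hsum
  omega

end Bounds
end Recon
end

/-! ### The main theorem -/

theorem mainTheorem1 :
    ∃ C : ℝ, ∀ (F : Type*) [Field F] (d : ℕ) (hd : 2 ≤ d)
      (K : Geometry.SimplicialComplex ℝ (Recon.E d)) (κ : ℕ),
      K.faces.Finite → Recon.HasDimension K κ → κ < d →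
      Recon.GeneralPosition hd K.vertices →
      ∀ O : Recon.Oracle d, Recon.IsOracleFor F O K →
        Recon.facesOf (Recon.reconstruct hd O).val = K.faces ∧
        (∀ T : ℝ, 0 ≤ T →
          (Recon.reconstruct hd O).time T ≤
            C * (d * K.faces.ncard * K.vertices.ncard ^ 2
              + 2 ^ κ * K.faces.ncard * K.vertices.ncard
                * (K.faces.ncard * K.vertices.ncard + d ^ 2 + 2 ^ κ + T)
              + d * T)) ∧
        ((Recon.reconstruct hd O).queries : ℝ) ≤
          C * (d + 2 ^ κ * K.faces.ncard * K.vertices.ncard) := by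
  refine ⟨7000, fun F _ d hd K κ hK hκ hκd hgp O hO => ?_⟩
  have h := Recon.spec_reconstruct hd hK hO hκ hκd hgp
  have hn := Recon.one_le_ncard_vertices hK hκ
  have hN := Recon.ncard_vertices_le hK
  have hs : ((Recon.reconstruct hd O).steps : ℝ) ≤ 7000 * (d * K.faces.ncard * K.vertices.ncard ^ 2
      + 2 ^ κ * K.faces.ncard * K.vertices.ncard
        * (K.faces.ncard * K.vertices.ncard + d ^ 2 + 2 ^ κ)) := by
    exact_mod_cast h.steps.trans (Recon.reconstructCost_le hn hN κ)
  have hq : ((Recon.reconstruct hd O).queries : ℝ)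
      ≤ 7000 * (d + 2 ^ κ * K.faces.ncard * K.vertices.ncard) := by
    exact_mod_cast h.queries.trans (Recon.reconstructQueries_le hN hd κ)
  refine ⟨h.val, fun T hT => ?_, hq⟩
  -- The terms with T in the time bound are exactly T times the bound for the number of diagrams.
  have h1 := mul_le_mul_of_nonneg_left hq hT
  rw [Recon.Outcome.time]
  linarith
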